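/- Let $\Gamma$ be a connected compact metric graph (finitely many vertices and edges, at least one edge, no loops or multiple edges), where each edge $e$ is identified with an interval $[0,\ell_e]$, $0<\ell_e<\infty$, oriented from its initial vertex (coordinate $0$) to its terminal vertex (coordinate $\ell_e$). Functions $u$ on $\Gamma$ are families $[u]_e$ of functions on $(0,\ell_e)$, $\int_\Gamma u=\sum_e\int_0^{\ell_e}[u]_e$, $\ell(D)=\int_\Gamma\chi_D$ is the length of $D\subset\Gamma$, and $BV(\Gamma)$, $L^p(\Gamma)$, $W^{1,2}(\Gamma)$ are defined edgewise, with no condition at the vertices. Let $X_K(\Gamma)$ be the set of $\mathbf z\in W^{1,2}(\Gamma)$ such that at every vertex $\mathbf v$ the sum of $[\mathbf z]_e(\ell_e)$ over the edges $e$ ending at $\mathbf v$ equals the sum of $[\mathbf z]_e(0)$ over the edges starting at $\mathbf v$. For $u\in BV(\Gamma)$ put $$TV_\Gamma(u)=\sup\Big\{\Big|\int_\Gamma u\,\mathbf z'\Big| : \mathbf z\in X_K(\Gamma),\ \|\mathbf z\|_{L^\infty(\Gamma)}\le 1\Big\},$$ and let $\mathcal F_\Gamma:L^2(\Gamma)\to[0,+\infty]$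 be $TV_\Gamma$ on $BV(\Gamma)$ and $+\infty$ elsewhere; $-\Delta_1^\Gamma$ is its subdifferential $\partial\mathcal F_\Gamma$ in $L^2(\Gamma)$. Call $D\subset\Gamma$ of finite perimeter if $\chi_D\in BV(\Gamma)$, with $\mathrm{Per}_\Gamma(D)=TV_\Gamma(\chi_D)$. The Cheeger constant is $$h(\Gamma)=\inf\Big\{\frac{\mathrm{Per}_\Gamma(D)}{\min\{\ell(D),\ell(\Gamma\setminus D)\}} : D\subset\Gamma \text{ of finite perimeter},\ 0<\ell(D)<\ell(\Gamma)\Big\},$$ and $D$ (of finite perimeter) is a Cheeger cut if $0<\ell(D)\le\frac12\ell(\Gamma)$ and $h(\Gamma)=\mathrm{Per}_\Gamma(D)/\ell(D)$. A pair $(\lambda,u)\in\mathbb R\times BV(\Gamma)$ is a $\Gamma$-eigenpair of $-\Delta_1^\Gamma$, and $\lambda$ a $\Gamma$-eigenvalue, if $\|u\|_{L^1(\Gamma)}=1$ and $\lambda\xi\in\partial\mathcal F_\Gamma(u)$ for some $\xi$ with $\xi=1$ on $\{u>0\}$, $\xi=-1$ on $\{u<0\}$ and $\xi\in[-1,1]$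 on $\{u=0\}$. Finally let $\Pi(\Gamma)$ be the set of $u\in BV(\Gamma)$ with $\|u\|_{L^1(\Gamma)}=1$, $\ell(\{u<0\})\le\frac12\ell(\Gamma)$ and $\ell(\{u>0\})\le\frac12\ell(\Gamma)$, and write $E_t(u)=\{x\in\Gamma: u(x)>t\}$. Theorem. (1) $h(\Gamma)=\inf\{\lambda\ne 0:\lambda \text{ is a } \Gamma\text{-eigenvalue of } -\Delta_1^\Gamma\}$. (2) $h(\Gamma)$ is itself a nonzero $\Gamma$-eigenvalue of $-\Delta_1^\Gamma$, hence the smallest one. (3) Let $u$ be a minimizer of $TV_\Gamma$ over $\Pi(\Gamma)$. If $\ell(\{u>0\})>0$, there is $t\ge 0$ such that $E_t(u)$ is a Cheeger cut of $\Gamma$ and $$\Big(h(\Gamma),\ \tfrac{1}{\ell(E_t(u))}\chi_{E_t(u)}\Big)$$ is a $\Gamma$-eigenpair of $-\Delta_1^\Gamma$. If $\ell(\{u<0\})>0$, the same holds with $u$ replaced by $-u$. (At least one of the two cases occurs, since $\|u\|_{L^1(\Gamma)}=1$.) -/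

import Mathlib

open MeasureTheory Set
open scoped ContDiff

noncomputable section

/-- Smooth test functions with compact support in the open interval `(a, b)`. -/
def IsTestFunction (a b : ℝ) (φ : ℝ → ℝ) : Prop :=
  ContDiff ℝ ∞ φ ∧ HasCompactSupport φ ∧ tsupport φ ⊆ Ioo a b

/-- `w` is the weak (distributional) derivative of `z` on `(a, b)`. -/
def HasWeakDerivOn (a b : ℝ) (z w : ℝ → ℝ) : Prop :=
  ∀ φ : ℝ → ℝ, IsTestFunction a b φ →
    ∫ x in Ioo a b, z x * deriv φ x = - ∫ x in Ioo a b, w x * φ x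

/-- `u ∈ BV(a, b)`: `u ∈ L¹(a, b)` and the distributional derivative of `u` is a signed
measure of finite total variation, written as a difference `μ - ν` of two finite measures. -/
def IsBVOn (a b : ℝ) (u : ℝ → ℝ) : Prop :=
  IntegrableOn u (Ioo a b) ∧
    ∃ μ ν : Measure ℝ, IsFiniteMeasure μ ∧ IsFiniteMeasure ν ∧
      ∀ φ : ℝ → ℝ, IsTestFunction a b φ →
        ∫ x in Ioo a b, u x * deriv φ x = - ((∫ x, φ x ∂μ) - ∫ x, φ x ∂ν)

/-- The multivalued sign. -/
def signSet (a : ℝ) : Set ℝ :=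
  if 0 < a then {1} else if a < 0 then {-1} else Icc (-1) 1

/-- A connected compact metric graph with vertex set `V` and edge set `E` (both are taken finite
below), without loops and multiple edges.  The edge `e` runs from `ini e` to `ter e` and is
identified with `[0, len e]`. -/
structure MetricGraph (V E : Type*) where
  ini : E → V
  ter : E → V
  len : E → ℝ
  len_pos : ∀ e, 0 < len e
  no_loops : ∀ e, ini e ≠ ter e
  no_multiple_edges : ∀ e e', s(ini e, ter e) = s(ini e', ter e') → e = e'
  connected : (SimpleGraph.fromRel fun v w => ∃ e, ini e = v ∧ ter e = w).Connected

namespace MetricGraph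

/-! A function on the graph is a family `u : E → ℝ → ℝ`, where `u e` is the function on the
edge `e` in its coordinate; only the values on `(0, len e)` matter (and, for continuous
representatives, on `[0, len e]`).  Likewise a subset is a family `D : E → Set ℝ`, `D e` being the
part in the edge `e`; vertices have length zero and are not recorded. -/

variable {V E : Type*} [Fintype V] [Fintype E] (Γ : MetricGraph V E)

/-- The open edge, in its coordinate. -/
def edge (e : E) : Set ℝ := Ioo 0 (Γ.len e)

/-- `∫_Γ u`. -/
def integral (u : E → ℝ → ℝ) : ℝ := ∑ e, ∫ x in Γ.edge e, u e x

/-- The length `ℓ(D)` of a subset `D`. -/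
def length (D : E → Set ℝ) : ℝ := ∑ e, volume.real (D e ∩ Γ.edge e)

/-- The length `ℓ(Γ)`. -/
def totalLength : ℝ := ∑ e, Γ.len e

/-- The complement `Γ \ D`. -/
def compl (D : E → Set ℝ) : E → Set ℝ := fun e => Γ.edge e \ D e

/-- The characteristic function of `D`. -/
def chi (D : E → Set ℝ) : E → ℝ → ℝ := fun e => (D e).indicator 1

/-- The superlevel set `E_t(u) = {u > t}`. -/
def superlevel (u : E → ℝ → ℝ) (t : ℝ) : E → Set ℝ := fun e => {x ∈ Γ.edge e | t < u e x}

/-- The sublevel set `{u < t}`. -/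
def sublevel (u : E → ℝ → ℝ) (t : ℝ) : E → Set ℝ := fun e => {x ∈ Γ.edge e | u e x < t}

/-- `u ∈ L²(Γ)`. -/
def IsL2 (u : E → ℝ → ℝ) : Prop := ∀ e, MemLp (u e) 2 (volume.restrict (Γ.edge e))

/-- `‖u‖_{L¹(Γ)}`. -/
def norm1 (u : E → ℝ → ℝ) : ℝ := Γ.integral fun e x => |u e x|

/-- `u ∈ BV(Γ)`. -/
def IsBV (u : E → ℝ → ℝ) : Prop := ∀ e, IsBVOn 0 (Γ.len e) (u e)

/-- `z ∈ W^{1,2}(Γ)` with weak derivative `z' = dz`; `z` is the representative that is continuous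
on every closed edge (continuity across vertices is not required). -/
def IsW12 (z dz : E → ℝ → ℝ) : Prop :=
  Γ.IsL2 z ∧ Γ.IsL2 dz ∧ (∀ e, HasWeakDerivOn 0 (Γ.len e) (z e) (dz e)) ∧
    ∀ e, ContinuousOn (z e) (Icc 0 (Γ.len e))

open Classical in
/-- The value `[z]_e(v)` at a vertex `v` of the edge `e`, with the sign of the outward normal. -/
def vertexValue (z : E → ℝ → ℝ) (e : E) (v : V) : ℝ :=
  if v = Γ.ter e then z e (Γ.len e) else - z e 0

open Classical in
/-- `z ∈ X_K(Γ)`, with `z' = dz`: `z ∈ W^{1,2}(Γ)` satisfies the Kirchhoff condition at every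
vertex. -/
def IsXK (z dz : E → ℝ → ℝ) : Prop :=
  Γ.IsW12 z dz ∧
    ∀ v : V, ∑ e with (v = Γ.ini e ∨ v = Γ.ter e), Γ.vertexValue z e v = 0

/-- The total variation `TV_Γ(u)`, used only for `u ∈ BV(Γ)`, where the supremum is finite. -/
def TV (u : E → ℝ → ℝ) : ℝ :=
  sSup {r | ∃ z dz : E → ℝ → ℝ, Γ.IsXK z dz ∧
    (∀ e, ∀ᵐ x ∂(volume.restrict (Γ.edge e)), |z e x| ≤ 1) ∧
    r = |Γ.integral fun e x => u e x * dz e x|}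

/-- `D` is a set of finite perimeter. -/
def FinitePerimeter (D : E → Set ℝ) : Prop := Γ.IsBV (chi D)

/-- The perimeter `Per_Γ(D)`. -/
def Per (D : E → Set ℝ) : ℝ := Γ.TV (chi D)

open Classical in
/-- The energy functional `F_Γ` on `L²(Γ)`. -/
def energy (u : E → ℝ → ℝ) : EReal := if Γ.IsBV u then ((Γ.TV u : ℝ) : EReal) else ⊤

/-- `v ∈ ∂F_Γ(u)`, the subdifferential in `L²(Γ)`; equivalently `v ∈ -Δ₁ u`. -/
def IsSubgradient (u v : E → ℝ → ℝ) : Prop :=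
  Γ.IsL2 u ∧ Γ.IsL2 v ∧ ∀ w : E → ℝ → ℝ, Γ.IsL2 w →
    Γ.energy u + ((Γ.integral fun e x => v e x * (w e x - u e x) : ℝ) : EReal) ≤ Γ.energy w

/-- `(lam, u)` is an eigenpair of the operator `-Δ₁`. -/
def IsEigenpair (lam : ℝ) (u : E → ℝ → ℝ) : Prop :=
  Γ.IsBV u ∧ Γ.norm1 u = 1 ∧
    ∃ ξ : E → ℝ → ℝ, (∀ e, ∀ x ∈ Γ.edge e, ξ e x ∈ signSet (u e x)) ∧
      Γ.IsSubgradient u fun e x => lam * ξ e x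

/-- `lam` is an eigenvalue of `-Δ₁`. -/
def IsEigenvalue (lam : ℝ) : Prop := ∃ u, Γ.IsEigenpair lam u

/-- The Cheeger constant `h(Γ)`.  Sets that are not of finite perimeter have infinite perimeter
and do not compete. -/
def cheeger : ℝ :=
  sInf {r | ∃ D : E → Set ℝ, Γ.FinitePerimeter D ∧ 0 < Γ.length D ∧ Γ.length D < Γ.totalLength ∧
    r = Γ.Per D / min (Γ.length D) (Γ.length (Γ.compl D))}

/-- `(D, Γ \ D)` is a Cheeger cut. -/
def IsCheegerCut (D : E → Set ℝ) : Prop :=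
  Γ.FinitePerimeter D ∧ 0 < Γ.length D ∧ Γ.length D ≤ Γ.totalLength / 2 ∧
    Γ.cheeger = Γ.Per D / Γ.length D

/-- `m` is a median of `u`. -/
def IsMedian (u : E → ℝ → ℝ) (m : ℝ) : Prop :=
  Γ.length (Γ.sublevel u m) ≤ Γ.totalLength / 2 ∧
    Γ.length (Γ.superlevel u m) ≤ Γ.totalLength / 2

/-- The class `Π(Γ)` of competitors. -/
def competitors : Set (E → ℝ → ℝ) := {u | Γ.IsBV u ∧ Γ.norm1 u = 1 ∧ Γ.IsMedian u 0}

/-- `u` minimizes `TV_Γ` over `Π(Γ)`. -/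
def IsMinimizer (u : E → ℝ → ℝ) : Prop :=
  u ∈ Γ.competitors ∧ ∀ w ∈ Γ.competitors, Γ.TV u ≤ Γ.TV w

end MetricGraph

end

/-! The core is the inequality `IsBV.integral_comp_add_le`: if `f` and `g` are nondecreasing with `f
+ g = id`, if `y` is an admissible field, and if `|ξ| ≤ 1` with `∫ ξ = 0`, then `∫ f(u) y' + h ∫
g(u) ξ ≤ TV(u)`. It replaces the coarea formula. It holds because a single field can be optimal for
all superlevel sets at once.

For a function that is constant on the cells of a partition, a field matters only through its values
at the nodes, and summation by parts decouples the nodes. An optimal field is then explicit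
(`exists_optimal_nodal`). At an interior node it takes the sign of the drop; at a vertex the
adjacent values are paired, largest with smallest, and get weights `1` and `-1`, which respects
Kirchhoff's condition. Testing with this field on each superlevel set `D` gives at least `∫ χ_D y'`,
and also at least `h min(ℓ(D), ℓ(Γ \ D)) ≥ h ∫ χ_D ξ`. Layer cake turns these into the inequality
for step functions, and convergence of cell averages in `L¹` gives the rest.

With `f = 0` this is a Poincaré inequality, `h ∫ u ξ ≤ TV(u)`. If `(λ, u)` is an eigenpair with `λ ≠
0`, then testing the subgradient inequality with `2u`, `0` and `u + c` gives `TV(u) = λ` and `∫ ξ =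
0`, hence `h ≤ λ`. Conversely, for a Cheeger cut `D` the sign that is `1` on `D` and constant off
`D` with mean zero makes `h ξ` a subgradient at `χ_D / ℓ(D)`, again by Poincaré. Cheeger cuts exist
by the direct method: sets of bounded perimeter are compact in `L¹`, and a lower bound for the
perimeter, obtained from flows on the connected graph, excludes vanishing length and gives `h > 0`.

A minimizer satisfies `TV(u) ≤ h` by comparison with a Cheeger cut. Take `f` to be the truncation of
`x⁺` at `ε` and `ξ` a mean-zero sign of `u`. The inequality becomes `∫ f(u) y' ≤ h ∫ f(u)`; dividing
by `ε` and letting `ε → 0` gives `Per({u > 0}) ≤ h ℓ({u > 0})`. So `t = 0` always works. -/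

noncomputable section

/-! ### One-dimensional preliminaries -/

/-- Fubini's theorem on the triangle `s ≤ x`. -/
theorem integral_setIntegral_Iic_mul {m n : Measure ℝ} [SFinite m] [SFinite n] {f g : ℝ → ℝ}
    (hg : Integrable g m) (hf : Integrable f n) :
    ∫ x, (∫ s in Iic x, g s ∂m) * f x ∂n = ∫ s, g s * (∫ x in Ici s, f x ∂n) ∂m := by
  have hT : MeasurableSet {p : ℝ × ℝ | p.2 ≤ p.1} :=
    measurableSet_le measurable_snd measurable_fst
  have h_int : Integrable (Function.uncurry fun x s => {p : ℝ × ℝ | p.2 ≤ p.1}.indicator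
      (fun p => f p.1 * g p.2) (x, s)) (n.prod m) :=
    (hf.mul_prod hg).indicator hT
  have := integral_integral_swap h_int
  calc _ = ∫ x, ∫ s, {p : ℝ × ℝ | p.2 ≤ p.1}.indicator (fun p => f p.1 * g p.2) (x, s) ∂m ∂n := by
        refine integral_congr_ae (Filter.Eventually.of_forall fun x => ?_)
        simp only
        rw [← integral_indicator measurableSet_Iic, ← integral_mul_const]
        refine integral_congr_ae (Filter.Eventually.of_forall fun s => ?_)
        simp only [indicator, mem_Iic, mem_ofPred_eq]
        split_ifs <;> ring
    _ = _ := this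
    _ = _ := by
        refine integral_congr_ae (Filter.Eventually.of_forall fun s => ?_)
        simp only
        rw [← integral_indicator measurableSet_Ici, ← integral_const_mul]
        refine integral_congr_ae (Filter.Eventually.of_forall fun x => ?_)
        simp only [indicator, mem_Ici, mem_ofPred_eq]
        split_ifs <;> ring

theorem setIntegral_Ici_restrict_Ioo {L s : ℝ} (f : ℝ → ℝ) (hs : s ∈ Icc 0 L) :
    ∫ x in Ici s, f x ∂(volume.restrict (Ioo 0 L)) = ∫ x in s..L, f x := by
  rw [Measure.restrict_restrict measurableSet_Ici, intervalIntegral.integral_of_le hs.2]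
  refine setIntegral_congr_set ?_
  have h1 : (Ioo s L : Set ℝ) =ᵐ[volume] Ioc s L := Ioo_ae_eq_Ioc
  have h2 : (Ico s L : Set ℝ) =ᵐ[volume] Ioc s L := Ico_ae_eq_Ioc
  rcases eq_or_lt_of_le hs.1 with h | h
  · have : Ici s ∩ Ioo 0 L = Ioo s L := by
      ext x; simp only [mem_inter_iff, mem_Ici, mem_Ioo]; constructor <;> intro hx
      · exact ⟨h ▸ hx.2.1, hx.2.2⟩
      · exact ⟨hx.1.le, h ▸ hx.1, hx.2⟩
    rw [this]; exact h1
  · have : Ici s ∩ Ioo 0 L = Ico s L := by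
      ext x; simp only [mem_inter_iff, mem_Ici, mem_Ioo, mem_Ico]; constructor <;> intro hx
      · exact ⟨hx.1, hx.2.2⟩
      · exact ⟨hx.1, h.trans_le hx.1, hx.2⟩
    rw [this]; exact h2

theorem setIntegral_Iic_restrict_Ioo {L x : ℝ} (f : ℝ → ℝ) (hx : x ∈ Icc 0 L) :
    ∫ s in Iic x, f s ∂(volume.restrict (Ioo 0 L)) = ∫ s in (0 : ℝ)..x, f s := by
  rw [Measure.restrict_restrict measurableSet_Iic, intervalIntegral.integral_of_le hx.1]
  refine setIntegral_congr_set ?_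
  have h1 : (Ioo 0 x : Set ℝ) =ᵐ[volume] Ioc 0 x := Ioo_ae_eq_Ioc
  rcases eq_or_lt_of_le hx.2 with h | h
  · have : Iic x ∩ Ioo 0 L = Ioo 0 x := by
      ext y; simp only [mem_inter_iff, mem_Iic, mem_Ioo]; constructor <;> intro hy
      · exact ⟨hy.2.1, h ▸ hy.2.2⟩
      · exact ⟨hy.2.le, hy.1, h ▸ hy.2⟩
    rw [this]; exact h1
  · have : Iic x ∩ Ioo 0 L = Ioc 0 x := by
      ext y; simp only [mem_inter_iff, mem_Iic, mem_Ioo, mem_Ioc]; constructor <;> intro hy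
      · exact ⟨hy.2.1, hy.1⟩
      · exact ⟨hy.2, hy.1, hy.2.trans_lt h⟩
    rw [this]; exact Filter.EventuallyEq.rfl

theorem IsTestFunction.apply_eq_zero {a b x : ℝ} {φ : ℝ → ℝ} (h : IsTestFunction a b φ)
    (hx : x ∉ Ioo a b) : φ x = 0 :=
  image_eq_zero_of_notMem_tsupport fun h' => hx (h.2.2 h')

theorem IsTestFunction.integrable_deriv {a b : ℝ} {φ : ℝ → ℝ} (h : IsTestFunction a b φ) :
    Integrable (deriv φ) :=
  (h.1.continuous_deriv (by simp)).integrable_of_hasCompactSupport h.2.1.deriv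

theorem IsTestFunction.integral_deriv {L s : ℝ} {φ : ℝ → ℝ} (h : IsTestFunction 0 L φ) :
    ∫ x in s..L, deriv φ x = - φ s := by
  rw [intervalIntegral.integral_deriv_eq_sub (fun x _ => h.1.differentiable (by simp) x)
    h.integrable_deriv.intervalIntegrable, h.apply_eq_zero (by simp)]
  ring

/-- If `g` integrates to `F` against the measure `m` on `(0, L)`, then `F' = g m` weakly. -/
theorem IsTestFunction.integral_Iic_mul_deriv {L : ℝ} {φ g : ℝ → ℝ} (h : IsTestFunction 0 L φ)
    {m : Measure ℝ} [SFinite m] (hg : Integrable g m) (hm : ∀ᵐ s ∂m, s ∈ Ioo 0 L) :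
    ∫ x in Ioo 0 L, (∫ s in Iic x, g s ∂m) * deriv φ x = - ∫ s, g s * φ s ∂m := by
  rw [integral_setIntegral_Iic_mul hg h.integrable_deriv.integrableOn, ← integral_neg]
  refine integral_congr_ae ?_
  filter_upwards [hm] with s hs
  rw [setIntegral_Ici_restrict_Ioo _ (Ioo_subset_Icc_self hs), h.integral_deriv]
  ring

theorem IsTestFunction.setIntegral_deriv {L : ℝ} (hL : 0 < L) {φ : ℝ → ℝ}
    (h : IsTestFunction 0 L φ) : ∫ x in Ioo 0 L, deriv φ x = 0 := by
  rw [← integral_Ioc_eq_integral_Ioo, ← intervalIntegral.integral_of_le hL.le, h.integral_deriv,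
    h.apply_eq_zero (by simp), neg_zero]

/-- Primitives are weak antiderivatives. -/
theorem hasWeakDerivOn_primitive {L : ℝ} (hL : 0 < L) {w z : ℝ → ℝ} {a : ℝ}
    (hw : IntegrableOn w (Ioo 0 L)) (hz : ∀ x ∈ Ioo 0 L, z x = a + ∫ s in (0 : ℝ)..x, w s) :
    HasWeakDerivOn 0 L z w := by
  intro φ hφ
  have h1 := hφ.integral_Iic_mul_deriv hw (ae_restrict_mem measurableSet_Ioo)
  rw [← h1]
  have h2 : ∫ x in Ioo 0 L, z x * deriv φ x = ∫ x in Ioo 0 L,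
      (a * deriv φ x + (∫ s in Iic x, w s ∂(volume.restrict (Ioo 0 L))) * deriv φ x) := by
    refine setIntegral_congr_fun measurableSet_Ioo fun x hx => ?_
    rw [setIntegral_Iic_restrict_Ioo _ (Ioo_subset_Icc_self hx), hz x hx]; ring
  rw [h2, integral_add, integral_const_mul, hφ.setIntegral_deriv hL]
  · ring
  · exact (hφ.integrable_deriv.const_mul a).integrableOn
  · have hm : AEStronglyMeasurable (fun x => ∫ s in Iic x, w s ∂(volume.restrict (Ioo 0 L)))
        (volume.restrict (Ioo 0 L)) := by
      have hc : ContinuousOn (fun x => ∫ s in (0 : ℝ)..x, w s) (Icc 0 L) := by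
        have := intervalIntegral.continuousOn_primitive_interval (μ := volume) (f := w)
          (a := 0) (b := L) (by
            rw [uIcc_of_le hL.le]; exact (integrableOn_Icc_iff_integrableOn_Ioo).2 hw)
        rwa [uIcc_of_le hL.le] at this
      refine ((hc.mono Ioo_subset_Icc_self).aestronglyMeasurable measurableSet_Ioo).congr ?_
      filter_upwards [ae_restrict_mem measurableSet_Ioo] with x hx
      rw [setIntegral_Iic_restrict_Ioo _ (Ioo_subset_Icc_self hx)]
    refine Integrable.bdd_mul (c := ∫ s in Ioo 0 L, |w s|) hφ.integrable_deriv.integrableOn hm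
      (Filter.Eventually.of_forall fun x => ?_)
    refine (norm_integral_le_integral_norm _).trans ?_
    exact setIntegral_le_integral hw.norm (Filter.Eventually.of_forall fun _ => norm_nonneg _)

/-- A function whose weak derivative vanishes is constant. -/
theorem HasWeakDerivOn.ae_eq_const {L : ℝ} (hL : 0 < L) {f : ℝ → ℝ}
    (hf : IntegrableOn f (Ioo 0 L))
    (h : ∀ φ, IsTestFunction 0 L φ → ∫ x in Ioo 0 L, f x * deriv φ x = 0) :
    ∃ c, ∀ᵐ x ∂(volume.restrict (Ioo 0 L)), f x = c := by
  -- A bump `η` of integral one: for every test function `ψ` the difference `ψ - (∫ ψ) η` is the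
  -- derivative of a test function, so `f` minus its `η`-mean is orthogonal to every `ψ`.
  obtain ⟨η, hη1, hη2, hη3⟩ : ∃ η : ℝ → ℝ, IsTestFunction 0 L η ∧ Integrable η ∧ ∫ x, η x = 1 := by
    let b : ContDiffBump (L / 2) := ⟨L / 8, L / 4, by positivity, by linarith⟩
    refine ⟨b.normed volume, ⟨b.contDiff_normed, b.hasCompactSupport_normed, ?_⟩,
      b.integrable_normed, b.integral_normed⟩
    rw [b.tsupport_normed_eq]
    intro x hx
    rw [Metric.mem_closedBall, Real.dist_eq, abs_le] at hx
    simp only [b] at hx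
    constructor <;> linarith
  refine ⟨∫ x in Ioo 0 L, f x * η x, ?_⟩
  set c := ∫ x in Ioo 0 L, f x * η x
  have hbd : ∀ ψ : ℝ → ℝ, Continuous ψ → HasCompactSupport ψ →
      IntegrableOn (fun x => f x * ψ x) (Ioo 0 L) := fun ψ hc hs => by
    obtain ⟨C, hC⟩ := hs.exists_bound_of_continuous hc
    exact Integrable.mul_bdd (c := C) hf hc.aestronglyMeasurable.restrict
      (Filter.Eventually.of_forall hC)
  have key : ∀ ψ : ℝ → ℝ, IsTestFunction 0 L ψ → ∫ x in Ioo 0 L, (f x - c) * ψ x = 0 := by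
    intro ψ hψ
    set A := ∫ x, ψ x with hA
    have hψi : Integrable ψ := hψ.1.continuous.integrable_of_hasCompactSupport hψ.2.1
    set w : ℝ → ℝ := fun x => ψ x - A * η x with hw
    have hwc : ContDiff ℝ ∞ w := hψ.1.sub (contDiff_const.mul hη1.1)
    have hwi : Integrable w := hψi.sub (hη2.const_mul A)
    have hw0 : ∫ x, w x = 0 := by
      rw [integral_sub hψi (hη2.const_mul A), integral_const_mul, hη3]; ring
    set K := tsupport ψ ∪ tsupport η with hK
    have hKc : IsCompact K := hψ.2.1.union hη1.2.1
    have hKs : K ⊆ Ioo 0 L := union_subset hψ.2.2 hη1.2.2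
    have hKn : K.Nonempty := by
      by_contra hne
      rw [not_nonempty_iff_eq_empty, hK, union_empty_iff] at hne
      have : η = 0 := tsupport_eq_empty_iff.1 hne.2
      simp [this] at hη3
    have hwK : ∀ x, x ∉ K → w x = 0 := fun x hx => by
      have h1 : ψ x = 0 := image_eq_zero_of_notMem_tsupport fun h' => hx (Or.inl h')
      have h2 : η x = 0 := image_eq_zero_of_notMem_tsupport fun h' => hx (Or.inr h')
      simp [hw, h1, h2]
    have ha := hKs (hKc.sInf_mem hKn)
    have hb := hKs (hKc.sSup_mem hKn)
    have hlo : ∀ x, x < sInf K → w x = 0 := fun x hx =>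
      hwK x fun h' => absurd (csInf_le hKc.bddBelow h') (not_le.2 hx)
    have hhi : ∀ x, sSup K < x → w x = 0 := fun x hx =>
      hwK x fun h' => absurd (le_csSup hKc.bddAbove h') (not_le.2 hx)
    -- This primitive vanishes to the left of `K` because `w` does, and to the right of `K` because
    -- `w` has integral zero.
    set φ : ℝ → ℝ := fun x => ∫ s in (0 : ℝ)..x, w s with hφ
    have hd : ∀ x, HasDerivAt φ (w x) x := fun x =>
      intervalIntegral.integral_hasDerivAt_right hwi.intervalIntegrable
        (hwc.continuous.stronglyMeasurableAtFilter _ _) hwc.continuous.continuousAt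
    have hdd : deriv φ = w := funext fun x => (hd x).deriv
    have hφc : ContDiff ℝ ∞ φ := by
      rw [contDiff_infty_iff_deriv, hdd]
      exact ⟨fun x => (hd x).differentiableAt, hwc⟩
    have hsupp : Function.support φ ⊆ Icc (sInf K) (sSup K) := by
      intro x hx
      by_contra hx'
      apply hx
      rw [mem_Icc, not_and_or, not_le, not_le] at hx'
      have hφlo : ∀ y, y < sInf K → φ y = 0 := fun y hy => by
        have : ∀ s ∈ uIcc 0 y, w s = 0 := fun s hs => hlo s (by
          rcases mem_uIcc.1 hs with hs | hs
          · exact hs.2.trans_lt hy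
          · exact hs.2.trans_lt ha.1)
        simp only [hφ]
        rw [intervalIntegral.integral_congr this]; simp
      rcases hx' with hx' | hx'
      · exact hφlo x hx'
      · have h1 : ∫ s in Iic x, w s = 0 := by
          rw [← hw0, ← integral_add_compl (measurableSet_Iic (a := x)) hwi]
          have : ∫ s in (Iic x)ᶜ, w s = 0 :=
            setIntegral_eq_zero_of_forall_eq_zero fun s hs => hhi s (hx'.trans (by simpa using hs))
          rw [this, add_zero]
        have h2 : ∫ s in Iic (0 : ℝ), w s = 0 :=
          setIntegral_eq_zero_of_forall_eq_zero fun s hs => hlo s (lt_of_le_of_lt hs ha.1)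
        have := intervalIntegral.integral_Iic_sub_Iic (f := w) (μ := volume) (a := 0) (b := x)
          hwi.integrableOn hwi.integrableOn
        simp only [hφ]
        rw [← this, h1, h2, sub_zero]
    have hφt : IsTestFunction 0 L φ := by
      have ht : tsupport φ ⊆ Icc (sInf K) (sSup K) := closure_minimal hsupp isClosed_Icc
      refine ⟨hφc, IsCompact.of_isClosed_subset isCompact_Icc (isClosed_tsupport _) ht,
        ht.trans fun x hx => ⟨ha.1.trans_le hx.1, hx.2.trans_lt hb.2⟩⟩
    have h0 := h φ hφt
    rw [hdd] at h0
    have hA' : ∫ x in Ioo 0 L, ψ x = A := by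
      rw [hA]
      refine setIntegral_eq_integral_of_forall_compl_eq_zero fun x hx => hψ.apply_eq_zero hx
    have e1 : ∫ x in Ioo 0 L, f x * w x = (∫ x in Ioo 0 L, f x * ψ x) - A * c := by
      rw [← integral_const_mul, ← integral_sub (hbd ψ hψ.1.continuous hψ.2.1)
        ((hbd η hη1.1.continuous hη1.2.1).const_mul A)]
      refine integral_congr_ae (Filter.Eventually.of_forall fun x => ?_)
      simp only [hw]; ring
    have e2 : ∫ x in Ioo 0 L, (f x - c) * ψ x = (∫ x in Ioo 0 L, f x * ψ x) - c * A := by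
      rw [← hA', ← integral_const_mul, ← integral_sub (hbd ψ hψ.1.continuous hψ.2.1)
        (hψi.integrableOn.const_mul c)]
      refine integral_congr_ae (Filter.Eventually.of_forall fun x => ?_)
      simp only; ring
    rw [e2]; rw [e1] at h0; linarith
  have hfc : IntegrableOn (fun x => f x - c) (Ioo 0 L) := hf.sub (integrableOn_const (by simp))
  have := isOpen_Ioo.ae_eq_zero_of_integral_contDiff_smul_eq_zero (U := Ioo 0 L) (μ := volume)
    (f := fun x => f x - c) hfc.locallyIntegrableOn fun g hg hgc hgs => by
      have h1 := key g ⟨hg, hgc, hgs⟩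
      have h2 : ∫ x in Ioo 0 L, (f x - c) * g x = ∫ x, (f x - c) * g x :=
        setIntegral_eq_integral_of_forall_compl_eq_zero fun x hx => by
          rw [IsTestFunction.apply_eq_zero ⟨hg, hgc, hgs⟩ hx, mul_zero]
      rw [h2] at h1
      simpa [mul_comm] using h1
  rw [ae_restrict_iff' measurableSet_Ioo]
  filter_upwards [this] with x hx hx'
  linarith [hx hx']

theorem continuousOn_primitive_Icc {L : ℝ} (hL : 0 < L) {w : ℝ → ℝ}
    (hw : IntegrableOn w (Ioo 0 L)) :
    ContinuousOn (fun x => ∫ s in (0 : ℝ)..x, w s) (Icc 0 L) := by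
  have := intervalIntegral.continuousOn_primitive_interval (μ := volume) (f := w)
    (a := 0) (b := L) (by
      rw [uIcc_of_le hL.le]; exact (integrableOn_Icc_iff_integrableOn_Ioo).2 hw)
  rwa [uIcc_of_le hL.le] at this

/-- The continuous representative of a weakly differentiable function is the primitive of its
weak derivative. -/
theorem HasWeakDerivOn.eq_primitive {L : ℝ} (hL : 0 < L) {z dz : ℝ → ℝ}
    (hz : ContinuousOn z (Icc 0 L)) (hdz : IntegrableOn dz (Ioo 0 L))
    (h : HasWeakDerivOn 0 L z dz) {x : ℝ} (hx : x ∈ Icc 0 L) :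
    z x = z 0 + ∫ s in (0 : ℝ)..x, dz s := by
  set P : ℝ → ℝ := fun x => ∫ s in (0 : ℝ)..x, dz s with hP
  have hPc : ContinuousOn P (Icc 0 L) := continuousOn_primitive_Icc hL hdz
  have hPw : HasWeakDerivOn 0 L P dz :=
    hasWeakDerivOn_primitive hL (a := 0) hdz fun x _ => by simp [hP]
  have hi : ∀ f : ℝ → ℝ, ContinuousOn f (Icc 0 L) → IntegrableOn f (Ioo 0 L) := fun f hf =>
    hf.integrableOn_Icc.mono_set Ioo_subset_Icc_self
  have him : ∀ f φ : ℝ → ℝ, ContinuousOn f (Icc 0 L) → IsTestFunction 0 L φ →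
      IntegrableOn (fun x => f x * deriv φ x) (Ioo 0 L) := fun f φ hf hφ =>
    hi _ (hf.mul (hφ.1.continuous_deriv (by simp)).continuousOn)
  obtain ⟨c, hc⟩ := HasWeakDerivOn.ae_eq_const hL (f := fun x => z x - P x)
    ((hi z hz).sub (hi P hPc)) fun φ hφ => by
      have : ∀ x, (z x - P x) * deriv φ x = z x * deriv φ x - P x * deriv φ x := fun x => by ring
      simp only [this]
      rw [integral_sub (him z φ hz hφ) (him P φ hPc hφ), h φ hφ, hPw φ hφ, sub_self]
  have hEq : EqOn (fun x => z x - P x) (fun _ => c) (Icc 0 L) := by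
    refine Measure.eqOn_Icc_of_ae_eq volume hL.ne ?_ (hz.sub hPc) continuousOn_const
    rw [← restrict_Ioo_eq_restrict_Icc]
    exact hc
  have h0 := hEq (left_mem_Icc.2 hL.le)
  have h1 := hEq hx
  simp only [hP, intervalIntegral.integral_same, sub_zero] at h0 h1
  linarith

/-- Functions of bounded variation are essentially bounded, and their weak derivative acts boundedly
on primitives. -/
theorem IsBVOn.exists_bound {L : ℝ} (hL : 0 < L) {u : ℝ → ℝ} (h : IsBVOn 0 L u) :
    ∃ C, 0 ≤ C ∧ (∀ᵐ x ∂(volume.restrict (Ioo 0 L)), |u x| ≤ C) ∧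
      ∀ z dz : ℝ → ℝ, IntegrableOn dz (Ioo 0 L) →
        (∀ x ∈ Icc 0 L, z x = z 0 + ∫ s in (0 : ℝ)..x, dz s) → (∀ x ∈ Icc 0 L, |z x| ≤ 1) →
        |∫ x in Ioo 0 L, u x * dz x| ≤ C := by
  obtain ⟨hu, μ, ν, hμ, hν, huw⟩ := h
  -- The distribution function of `m` on the interval has weak derivative `m`, so `u` differs from
  -- `G μ - G ν` by a constant.
  set G : Measure ℝ → ℝ → ℝ := fun m x => ∫ _ in Iic x, (1 : ℝ) ∂(m.restrict (Ioo 0 L)) with hG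
  have hGr : ∀ m x, G m x = (m.restrict (Ioo 0 L)).real (Iic x) := fun m x => by simp [hG]
  have hGm : ∀ m : Measure ℝ, IsFiniteMeasure m → Measurable (G m) := fun m _ => by
    refine Monotone.measurable fun x y hxy => ?_
    rw [hGr, hGr]
    exact measureReal_mono (Iic_subset_Iic.2 hxy)
  have hGb : ∀ m : Measure ℝ, IsFiniteMeasure m → ∀ x, |G m x| ≤ m.real univ := fun m _ x => by
    rw [hGr, abs_of_nonneg measureReal_nonneg, measureReal_restrict_apply measurableSet_Iic]
    exact measureReal_mono (subset_univ _)
  have hGmul : ∀ m : Measure ℝ, IsFiniteMeasure m → ∀ f : ℝ → ℝ, IntegrableOn f (Ioo 0 L) →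
      IntegrableOn (fun x => G m x * f x) (Ioo 0 L) := fun m hm f hf =>
    Integrable.bdd_mul (c := m.real univ) hf (hGm m hm).aestronglyMeasurable
      (Filter.Eventually.of_forall (hGb m hm))
  have hGi : ∀ m : Measure ℝ, IsFiniteMeasure m → IntegrableOn (G m) (Ioo 0 L) := fun m hm => by
    simpa using hGmul m hm (fun _ => 1) (integrableOn_const (by simp))
  have hGw : ∀ m : Measure ℝ, IsFiniteMeasure m → ∀ φ, IsTestFunction 0 L φ →
      ∫ x in Ioo 0 L, G m x * deriv φ x = - ∫ x, φ x ∂m := fun m _ φ hφ => by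
    have := hφ.integral_Iic_mul_deriv (g := fun _ => (1 : ℝ)) (m := m.restrict (Ioo 0 L))
      (integrable_const _) (ae_restrict_mem measurableSet_Ioo)
    rw [this]
    simp only [one_mul]
    rw [setIntegral_eq_integral_of_forall_compl_eq_zero fun x hx => hφ.apply_eq_zero hx]
  obtain ⟨c, hc⟩ := HasWeakDerivOn.ae_eq_const hL (f := fun x => u x - (G μ x - G ν x))
    (hu.sub ((hGi μ hμ).sub (hGi ν hν))) fun φ hφ => by
      have hd : IntegrableOn (deriv φ) (Ioo 0 L) := hφ.integrable_deriv.integrableOn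
      have hud : IntegrableOn (fun x => u x * deriv φ x) (Ioo 0 L) := by
        obtain ⟨C, hC⟩ := hφ.2.1.deriv.exists_bound_of_continuous
          (hφ.1.continuous_deriv (by simp))
        exact Integrable.mul_bdd (c := C) hu
          (hφ.1.continuous_deriv (by simp)).aestronglyMeasurable.restrict
          (Filter.Eventually.of_forall hC)
      have : ∀ x, (u x - (G μ x - G ν x)) * deriv φ x =
        u x * deriv φ x - (G μ x * deriv φ x - G ν x * deriv φ x) := fun x => by ring
      simp only [this]
      rw [integral_sub hud ((hGmul μ hμ _ hd).fun_sub (hGmul ν hν _ hd)),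
        integral_sub (hGmul μ hμ _ hd) (hGmul ν hν _ hd), huw φ hφ, hGw μ hμ φ hφ, hGw ν hν φ hφ]
      ring
  have hμ0 : 0 ≤ μ.real univ := measureReal_nonneg
  have hν0 : 0 ≤ ν.real univ := measureReal_nonneg
  refine ⟨2 * |c| + 2 * μ.real univ + 2 * ν.real univ, by positivity, ?_, ?_⟩
  · filter_upwards [hc] with x hx
    have h1 := hGb μ hμ x
    have h2 := hGb ν hν x
    have h3 : u x = c + (G μ x - G ν x) := by linarith
    rw [h3]
    have h4 := abs_add_le c (G μ x - G ν x)
    have h5 := abs_sub (G μ x) (G ν x)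
    have := abs_nonneg c
    linarith
  · intro z dz hdz hz hz1
    have hzb : ∀ m : Measure ℝ, IsFiniteMeasure m →
        |∫ x in Ioo 0 L, G m x * dz x| ≤ 2 * m.real univ := fun m _ => by
      -- Fubini turns the integral of `G m * dz` into the integral of `z L - z s` against `m`, and
      -- this difference is at most `2` in absolute value.
      have := integral_setIntegral_Iic_mul (m := m.restrict (Ioo 0 L))
        (n := volume.restrict (Ioo 0 L)) (g := fun _ => (1 : ℝ)) (integrable_const _) hdz
      rw [this]
      have hb : ∀ᵐ s ∂(m.restrict (Ioo 0 L)),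
          ‖1 * ∫ x in Ici s, dz x ∂(volume.restrict (Ioo 0 L))‖ ≤ 2 := by
        filter_upwards [ae_restrict_mem measurableSet_Ioo] with s hs
        have hs' := Ioo_subset_Icc_self hs
        have hii : ∀ a ∈ Icc 0 L, ∀ b ∈ Icc 0 L, IntervalIntegrable dz volume a b :=
          fun a ha b hb => by
            have : IntegrableOn dz (Icc 0 L) := (integrableOn_Icc_iff_integrableOn_Ioo).2 hdz
            exact (this.mono_set (uIcc_subset_Icc ha hb)).intervalIntegrable
        have h0 : (0 : ℝ) ∈ Icc 0 L := left_mem_Icc.2 hL.le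
        have hL' : L ∈ Icc 0 L := right_mem_Icc.2 hL.le
        rw [setIntegral_Ici_restrict_Ioo _ hs', one_mul, Real.norm_eq_abs]
        have e := intervalIntegral.integral_add_adjacent_intervals (hii 0 h0 s hs') (hii s hs' L hL')
        have e1 := hz s hs'
        have e2 := hz L hL'
        have b1 := abs_le.1 (hz1 s hs')
        have b2 := abs_le.1 (hz1 L hL')
        rw [abs_le]; constructor <;> linarith
      refine (norm_integral_le_of_norm_le_const hb).trans ?_
      have : (m.restrict (Ioo 0 L)).real univ ≤ m.real univ := by
        rw [measureReal_restrict_apply MeasurableSet.univ]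
        exact measureReal_mono (subset_univ _)
      linarith
    have e : ∫ x in Ioo 0 L, u x * dz x = c * (∫ x in Ioo 0 L, dz x) +
        ((∫ x in Ioo 0 L, G μ x * dz x) - ∫ x in Ioo 0 L, G ν x * dz x) := by
      rw [← integral_sub (hGmul μ hμ _ hdz) (hGmul ν hν _ hdz), ← integral_const_mul,
        ← integral_add (hdz.const_mul c) ((hGmul μ hμ _ hdz).fun_sub (hGmul ν hν _ hdz))]
      refine integral_congr_ae ?_
      filter_upwards [hc] with x hx
      have h3 : u x = c + (G μ x - G ν x) := by linarith
      rw [h3]; ring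
    have e2 : ∫ x in Ioo 0 L, dz x = z L - z 0 := by
      rw [← integral_Ioc_eq_integral_Ioo, ← intervalIntegral.integral_of_le hL.le,
        hz L (right_mem_Icc.2 hL.le)]
      ring
    have hz2 : |z L - z 0| ≤ 2 := by
      have b1 := abs_le.1 (hz1 0 (left_mem_Icc.2 hL.le))
      have b2 := abs_le.1 (hz1 L (right_mem_Icc.2 hL.le))
      rw [abs_le]; constructor <;> linarith
    have h1 := hzb μ hμ
    have h2 := hzb ν hν
    rw [e, e2]
    refine (abs_add_le _ _).trans ?_
    have h4 := abs_sub (∫ x in Ioo 0 L, G μ x * dz x) (∫ x in Ioo 0 L, G ν x * dz x)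
    have h5 : |c * (z L - z 0)| ≤ 2 * |c| := by
      rw [abs_mul, mul_comm]; exact mul_le_mul_of_nonneg_right hz2 (abs_nonneg c)
    linarith

/-- The weak derivative on `(0, L)` of a monotone function is a finite measure. -/
theorem Monotone.exists_measure_weakDeriv {L : ℝ} (hL : 0 < L) {p : ℝ → ℝ} (hp : Monotone p) :
    ∃ μ : Measure ℝ, IsFiniteMeasure μ ∧ ∀ φ : ℝ → ℝ, IsTestFunction 0 L φ →
      ∫ x in Ioo 0 L, p x * deriv φ x = - ∫ x, φ x ∂μ := by
  set F := hp.stieltjesFunction with hF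
  have hfin : IsFiniteMeasure (F.measure.restrict (Ioo 0 L)) :=
    ⟨by
      rw [Measure.restrict_apply_univ]
      refine (measure_mono Ioo_subset_Ioc_self).trans_lt ?_
      rw [F.measure_Ioc]; exact ENNReal.ofReal_lt_top⟩
  refine ⟨F.measure.restrict (Ioo 0 L), hfin, fun φ hφ => ?_⟩
  have h1 := hφ.integral_Iic_mul_deriv (g := fun _ => (1 : ℝ)) (m := F.measure.restrict (Ioo 0 L))
    (integrable_const _) (ae_restrict_mem measurableSet_Ioo)
  simp only [one_mul] at h1
  rw [← h1]
  have hpF : ∀ᵐ x ∂(volume.restrict (Ioo 0 L)), p x = F x := by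
    refine ae_restrict_of_ae ?_
    filter_upwards [hp.countable_not_continuousAt.ae_notMem volume] with x hx
    have hx' : ContinuousAt p x := not_not.1 hx
    rw [hF, Monotone.stieltjesFunction_eq]
    exact (hx'.continuousWithinAt.rightLim_eq).symm
  have h2 : ∫ x in Ioo 0 L, (∫ _ in Iic x, (1 : ℝ) ∂(F.measure.restrict (Ioo 0 L))) * deriv φ x
      = ∫ x in Ioo 0 L, (p x * deriv φ x - F 0 * deriv φ x) := by
    refine integral_congr_ae ?_
    filter_upwards [hpF, ae_restrict_mem measurableSet_Ioo] with x hx hx'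
    have : (Iic x ∩ Ioo 0 L : Set ℝ) = Ioc 0 x := by
      ext y; simp only [mem_inter_iff, mem_Iic, mem_Ioo, mem_Ioc]; constructor <;> intro hy
      · exact ⟨hy.2.1, hy.1⟩
      · exact ⟨hy.2, hy.1, hy.2.trans_lt hx'.2⟩
    rw [setIntegral_const, smul_eq_mul, mul_one, measureReal_restrict_apply measurableSet_Iic, this,
      measureReal_def, F.measure_Ioc, ENNReal.toReal_ofReal (sub_nonneg.2 (F.mono hx'.1.le)), hx]
    ring
  have hd : IntegrableOn (deriv φ) (Ioo 0 L) := hφ.integrable_deriv.integrableOn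
  rw [h2, integral_sub _ (hd.const_mul _), integral_const_mul, hφ.setIntegral_deriv hL]
  · ring
  · refine Integrable.bdd_mul (c := |p 0| + |p L|) hd hp.measurable.aestronglyMeasurable ?_
    filter_upwards [ae_restrict_mem measurableSet_Ioo] with x hx
    have h3 := hp hx.1.le
    have h4 := hp hx.2.le
    rw [Real.norm_eq_abs, abs_le]
    have := neg_abs_le (p 0)
    have := le_abs_self (p L)
    have := abs_nonneg (p 0)
    have := abs_nonneg (p L)
    constructor <;> linarith

/-- A function of bounded variation on a set of full measure is in `BV`. -/
theorem BoundedVariationOn.isBVOn {L : ℝ} (hL : 0 < L) {u : ℝ → ℝ} {S : Set ℝ}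
    (hu : IntegrableOn u (Ioo 0 L)) (hS : ∀ᵐ x ∂(volume.restrict (Ioo 0 L)), x ∈ S)
    (h : BoundedVariationOn u S) : IsBVOn 0 L u := by
  obtain ⟨p, q, hp, hq, hpq, hv⟩ := h.locallyBoundedVariationOn.exists_monotoneOn_sub_monotoneOn'
  set T := (eVariationOn u S).toReal with hT
  have hvb : ∀ x y, x ≤ y → variationOnFromTo u S x y ≤ T := fun x y hxy => by
    rw [variationOnFromTo.eq_of_le _ _ hxy]
    exact ENNReal.toReal_mono h (eVariationOn.mono _ inter_subset_left)
  have hbd : ∀ x ∈ S, ∀ y ∈ S, x ≤ y → p y - p x ≤ T ∧ q y - q x ≤ T := fun x hx y hy hxy => by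
    have h1 := hv x hx y hy
    have h2 := hvb x y hxy
    have h3 := hp hx hy hxy
    have h4 := hq hx hy hxy
    constructor <;> linarith
  -- The Jordan parts have increments at most the total variation `T`, hence are bounded on `S` and
  -- extend to monotone functions on the line, whose weak derivatives are Stieltjes measures.
  have hex : ∀ r : ℝ → ℝ, MonotoneOn r S → (∀ x ∈ S, ∀ y ∈ S, x ≤ y → r y - r x ≤ T) →
      ∃ g : ℝ → ℝ, Monotone g ∧ EqOn r g S := fun r hr hrb => by
    rcases S.eq_empty_or_nonempty with hSe | ⟨c, hc⟩
    · exact ⟨0, monotone_const, by simp [hSe]⟩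
    have hT0 : 0 ≤ T := ENNReal.toReal_nonneg
    refine hr.exists_monotone_extension ⟨r c - T, ?_⟩ ⟨r c + T, ?_⟩
    · rintro _ ⟨x, hx, rfl⟩
      rcases le_total c x with hcx | hcx
      · linarith [hr hc hx hcx]
      · linarith [hrb x hx c hc hcx]
    · rintro _ ⟨x, hx, rfl⟩
      rcases le_total c x with hcx | hcx
      · linarith [hrb c hc x hx hcx]
      · linarith [hr hx hc hcx]
  obtain ⟨P, hP, hpP⟩ := hex p hp fun x hx y hy hxy => (hbd x hx y hy hxy).1
  obtain ⟨Q, hQ, hqQ⟩ := hex q hq fun x hx y hy hxy => (hbd x hx y hy hxy).2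
  obtain ⟨μ, hμ, hμw⟩ := hP.exists_measure_weakDeriv hL
  obtain ⟨ν, hν, hνw⟩ := hQ.exists_measure_weakDeriv hL
  refine ⟨hu, μ, ν, hμ, hν, fun φ hφ => ?_⟩
  have hI : ∀ R : ℝ → ℝ, Monotone R → IntegrableOn (fun x => R x * deriv φ x) (Ioo 0 L) :=
    fun R hR => by
      have h1 : IntegrableOn R (Icc 0 L) := (hR.monotoneOn _).integrableOn_isCompact isCompact_Icc
      obtain ⟨C, hC⟩ := hφ.2.1.deriv.exists_bound_of_continuous
          (hφ.1.continuous_deriv (by simp))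
      exact Integrable.mul_bdd (c := C) (h1.mono_set Ioo_subset_Icc_self)
          (hφ.1.continuous_deriv (by simp)).aestronglyMeasurable.restrict
          (Filter.Eventually.of_forall hC)
  have : ∫ x in Ioo 0 L, u x * deriv φ x =
      ∫ x in Ioo 0 L, (P x * deriv φ x - Q x * deriv φ x) := by
    refine integral_congr_ae ?_
    filter_upwards [hS] with x hx
    rw [hpq, Pi.sub_apply, hpP hx, hqQ hx]; ring
  rw [this, integral_sub (hI P hP) (hI Q hQ), hμw φ hφ, hνw φ hφ]
  ring

/-- The primitive is a ramp of height `δ` starting at `t`; after division by `δ` such ramps build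
the test functions for `isBVOn_of_bound`. -/
theorem integral_indicator_Ioc {t δ x : ℝ} (ht : 0 ≤ t) (hx : 0 ≤ x) :
    ∫ s in (0 : ℝ)..x, (Ioc t (t + δ)).indicator (fun _ => (1 : ℝ)) s
      = max (min δ (x - t)) 0 := by
  rw [intervalIntegral.integral_of_le hx, setIntegral_indicator measurableSet_Ioc, Ioc_inter_Ioc,
    setIntegral_const, smul_eq_mul, mul_one, Real.volume_real_Ioc]
  congr 1
  rw [max_eq_right ht, ← min_sub_sub_right, min_comm]
  simp

/-- Bounded duality with test functions vanishing at the end points characterizes `BV`. -/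
theorem isBVOn_of_bound {L : ℝ} (hL : 0 < L) {u : ℝ → ℝ} (hu : IntegrableOn u (Ioo 0 L)) {C : ℝ}
    (h : ∀ s : ℝ → ℝ, Measurable s → (∃ M, ∀ x, |s x| ≤ M) →
      (∀ x ∈ Icc 0 L, |∫ y in (0 : ℝ)..x, s y| ≤ 1) → ∫ y in (0 : ℝ)..L, s y = 0 →
      ∫ x in Ioo 0 L, u x * s x ≤ C) : IsBVOn 0 L u := by
  have huI : IntervalIntegrable u volume 0 L :=
    (intervalIntegrable_iff_integrableOn_Ioo_of_le hL.le).2 hu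
  set U : ℝ → ℝ := fun x => ∫ y in (0 : ℝ)..x, u y with hU
  -- On this set of full measure `u` is a limit of difference quotients of its primitive `U`, and
  -- these are integrals of `u` against bounded functions.
  set S : Set ℝ := {x ∈ Ioo 0 L | HasDerivAt U (u x) x} with hS
  refine BoundedVariationOn.isBVOn hL (S := S) hu ?_ ?_
  · filter_upwards [ae_restrict_of_ae huI.ae_hasDerivAt_integral,
      ae_restrict_mem measurableSet_Ioo] with x hx hx'
    refine ⟨hx', hx (uIcc_of_le hL.le ▸ Ioo_subset_Icc_self hx') 0 left_mem_uIcc⟩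
  refine ne_top_of_le_ne_top (b := ENNReal.ofReal C) ENNReal.ofReal_ne_top (iSup_le ?_)
  rintro ⟨n, t, htm, htS⟩
  simp only [edist_dist, Real.dist_eq]
  rw [← ENNReal.ofReal_sum_of_nonneg fun _ _ => abs_nonneg _]
  refine ENNReal.ofReal_le_ofReal ?_
  set σ : ℕ → ℝ := fun i => if 0 ≤ u (t (i + 1)) - u (t i) then 1 else -1 with hσ
  have hσa : ∀ i, |u (t (i + 1)) - u (t i)| = σ i * (u (t (i + 1)) - u (t i)) := fun i => by
    simp only [hσ]; split_ifs with h'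
    · rw [abs_of_nonneg h', one_mul]
    · rw [abs_of_neg (not_le.1 h'), neg_one_mul]
  have hσ1 : ∀ i, |σ i| = 1 := fun i => by simp only [hσ]; split_ifs <;> simp
  simp only [hσa]
  set Δ : ℝ → ℝ → ℝ := fun δ x => δ⁻¹ * (U (x + δ) - U x) with hΔ
  have hlim : ∀ x ∈ S, Filter.Tendsto (fun δ => Δ δ x) (nhdsWithin 0 (Ioi 0)) (nhds (u x)) :=
    fun x hx => by
      have := hx.2.tendsto_slope_zero_right
      simpa [hΔ, smul_eq_mul] using this
  have hlim2 : Filter.Tendsto (fun δ => ∑ i ∈ Finset.range n, σ i * (Δ δ (t (i + 1)) - Δ δ (t i)))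
      (nhdsWithin 0 (Ioi 0)) (nhds (∑ i ∈ Finset.range n, σ i * (u (t (i + 1)) - u (t i)))) :=
    tendsto_finsetSum _ fun i _ =>
      ((hlim _ (htS (i + 1))).sub (hlim _ (htS i))).const_mul (σ i)
  refine le_of_tendsto hlim2 ?_
  have hpos : (0 : ℝ) < L - t n := sub_pos.2 (htS n).1.2
  filter_upwards [Ioo_mem_nhdsGT hpos] with δ hδ
  have hδ0 : 0 < δ := hδ.1
  have ht0 : ∀ i, 0 ≤ t i := fun i => (htS i).1.1.le
  have htL : ∀ i, i ≤ n → t i + δ < L := fun i hi => by linarith [htm hi, hδ.2]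
  set I : ℝ → ℝ → ℝ := fun a => (Ioc a (a + δ)).indicator (fun _ => (1 : ℝ)) with hI
  have hIm : ∀ a, Measurable (I a) := fun a => measurable_const.indicator measurableSet_Ioc
  have hIb : ∀ a x, |I a x| ≤ 1 := fun a x => by
    simp only [hI, indicator]; split_ifs <;> simp
  have hIi : ∀ a b c, IntervalIntegrable (I a) volume b c := fun a b c => by
    have : Integrable (I a) :=
      (integrable_indicator_iff measurableSet_Ioc).2 (integrableOn_const (by simp))
    exact this.intervalIntegrable
  -- Tested against `u`, this gives the signed sum of difference quotients that approximates the
  -- variation. Its primitive is a signed sum of differences of unit ramps. The ramps are ordered,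
  -- so the absolute differences telescope to at most `1`; at `L` all ramps have reached `1`, so the
  -- primitive vanishes there.
  set s : ℝ → ℝ := fun x => ∑ i ∈ Finset.range n, σ i * (δ⁻¹ * (I (t (i + 1)) x - I (t i) x))
    with hs
  set r : ℝ → ℝ → ℝ := fun a x => δ⁻¹ * max (min δ (x - a)) 0 with hr
  have hrint : ∀ x, 0 ≤ x → ∫ y in (0 : ℝ)..x, s y =
      ∑ i ∈ Finset.range n, σ i * (r (t (i + 1)) x - r (t i) x) := fun x hx => by
    simp only [hs]
    rw [intervalIntegral.integral_finsetSum fun i _ =>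
      (((hIi _ _ _).sub (hIi _ _ _)).const_mul _).const_mul _]
    refine Finset.sum_congr rfl fun i _ => ?_
    rw [intervalIntegral.integral_const_mul, intervalIntegral.integral_const_mul,
      intervalIntegral.integral_sub (hIi _ _ _) (hIi _ _ _), integral_indicator_Ioc (ht0 _) hx,
      integral_indicator_Ioc (ht0 _) hx]
    simp only [hr]; ring
  have hanti : ∀ a b x, a ≤ b → r b x ≤ r a x := fun a b x hab => by
    simp only [hr]; gcongr
  have hr0 : ∀ a x, 0 ≤ r a x := fun a x => by simp only [hr]; positivity
  have hr1 : ∀ a x, r a x ≤ 1 := fun a x => by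
    simp only [hr]
    rw [inv_mul_le_iff₀ hδ0, mul_one]
    exact max_le (min_le_left _ _) hδ0.le
  have hkey := h s (by
      simp only [hs]
      exact Finset.measurable_sum _ fun i _ =>
        (((hIm _).sub (hIm _)).const_mul _).const_mul _)
    ⟨∑ i ∈ Finset.range n, 2 * δ⁻¹, fun x => by
      simp only [hs]
      refine (Finset.abs_sum_le_sum_abs _ _).trans (Finset.sum_le_sum fun i _ => ?_)
      rw [abs_mul, hσ1, one_mul, abs_mul, abs_of_pos (inv_pos.2 hδ0), mul_comm]
      refine mul_le_mul_of_nonneg_right ?_ (inv_pos.2 hδ0).le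
      refine (abs_sub _ _).trans ?_
      linarith [hIb (t (i + 1)) x, hIb (t i) x]⟩
    (fun x hx => by
      rw [hrint x hx.1]
      refine (Finset.abs_sum_le_sum_abs _ _).trans ?_
      have : ∑ i ∈ Finset.range n, |σ i * (r (t (i + 1)) x - r (t i) x)| =
          ∑ i ∈ Finset.range n, (r (t i) x - r (t (i + 1)) x) :=
        Finset.sum_congr rfl fun i _ => by
          rw [abs_mul, hσ1, one_mul, abs_of_nonpos (sub_nonpos.2 (hanti _ _ x (htm i.le_succ)))]
          ring
      rw [this, Finset.sum_range_sub' (fun i => r (t i) x)]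
      linarith [hr0 (t n) x, hr1 (t 0) x])
    (by
      rw [hrint L hL.le]
      refine Finset.sum_eq_zero fun i hi => ?_
      have h1 : ∀ j, j ≤ n → r (t j) L = 1 := fun j hj => by
        simp only [hr]
        rw [min_eq_left (by linarith [htL j hj]), max_eq_left hδ0.le, inv_mul_cancel₀ hδ0.ne']
      have hi' := Finset.mem_range.1 hi
      rw [h1 _ hi', h1 _ hi'.le]; ring)
  refine le_trans (le_of_eq ?_) hkey
  have hUI : ∀ i, i ≤ n → ∫ x in Ioo 0 L, u x * I (t i) x = U (t i + δ) - U (t i) :=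
    fun i hi => by
      have e : ∀ x, u x * I (t i) x = (Ioc (t i) (t i + δ)).indicator u x := fun x => by
        simp only [hI, indicator]; split_ifs <;> simp
      have hsub : Ioc (t i) (t i + δ) ⊆ Ioo 0 L := fun x hx =>
        ⟨(ht0 i).trans_lt hx.1, hx.2.trans_lt (htL i hi)⟩
      have hle : t i ≤ t i + δ := by linarith
      simp only [e]
      rw [setIntegral_indicator measurableSet_Ioc, inter_eq_right.2 hsub,
        ← intervalIntegral.integral_of_le hle]
      simp only [hU]
      rw [intervalIntegral.integral_interval_sub_left]
      · refine huI.mono_set (uIcc_subset_uIcc left_mem_uIcc ?_)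
        rw [uIcc_of_le hL.le]; exact ⟨by linarith [ht0 i], (htL i hi).le⟩
      · refine huI.mono_set (uIcc_subset_uIcc left_mem_uIcc ?_)
        rw [uIcc_of_le hL.le]; exact ⟨ht0 i, by linarith [htL i hi]⟩
  have huIi : ∀ a, IntegrableOn (fun x => u x * I a x) (Ioo 0 L) := fun a =>
    Integrable.mul_bdd (c := 1) hu (hIm a).aestronglyMeasurable
      (Filter.Eventually.of_forall (hIb a))
  have e3 : ∀ x, u x * s x = ∑ i ∈ Finset.range n,
      σ i * (δ⁻¹ * (u x * I (t (i + 1)) x - u x * I (t i) x)) := fun x => by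
    simp only [hs, Finset.mul_sum]
    exact Finset.sum_congr rfl fun i _ => by ring
  simp only [e3]
  rw [integral_finsetSum _ fun i _ =>
    (((huIi _).fun_sub (huIi _)).const_mul _).const_mul _]
  refine Finset.sum_congr rfl fun i hi => ?_
  have hi' := Finset.mem_range.1 hi
  rw [integral_const_mul, integral_const_mul, integral_sub (huIi _) (huIi _), hUI _ hi',
    hUI _ hi'.le]
  simp only [hΔ]; ring

set_option linter.unusedSectionVars false

namespace MetricGraph

/-! ### Admissible fields and the dual description of the total variation -/

variable {V E : Type*} [Fintype V] [Fintype E] (Γ : MetricGraph V E)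

/-- Lebesgue measure on an edge. -/
abbrev edgeMeasure (e : E) : Measure ℝ := volume.restrict (Γ.edge e)

/-- The competitors in the definition of the total variation. -/
def IsAdmissible (z dz : E → ℝ → ℝ) : Prop :=
  Γ.IsXK z dz ∧ ∀ e, ∀ᵐ x ∂(volume.restrict (Γ.edge e)), |z e x| ≤ 1

/-- The linear functionals in the definition of the total variation of `u` are bounded by `C`. -/
def DualBound (u : E → ℝ → ℝ) (C : ℝ) : Prop :=
  ∀ z dz : E → ℝ → ℝ, Γ.IsAdmissible z dz → Γ.integral (fun e x => u e x * dz e x) ≤ C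

/-- `u` is measurable and essentially bounded by `M`. -/
def BddBy (u : E → ℝ → ℝ) (M : ℝ) : Prop :=
  ∀ e, AEStronglyMeasurable (u e) (Γ.edgeMeasure e) ∧ ∀ᵐ x ∂(Γ.edgeMeasure e), |u e x| ≤ M

/-- Edgewise integrability. -/
def IsL1 (u : E → ℝ → ℝ) : Prop := ∀ e, Integrable (u e) (Γ.edgeMeasure e)

variable {Γ}

instance (e : E) : IsFiniteMeasure (Γ.edgeMeasure e) :=
  ⟨by simp [edge]⟩

theorem IsL2.isL1 {u : E → ℝ → ℝ} (h : Γ.IsL2 u) : Γ.IsL1 u := fun e =>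
  (h e).integrable (by norm_num)

theorem BddBy.isL2 {u : E → ℝ → ℝ} {M : ℝ} (h : Γ.BddBy u M) : Γ.IsL2 u := fun e =>
  MemLp.of_bound (h e).1 M (h e).2

theorem BddBy.isL1 {u : E → ℝ → ℝ} {M : ℝ} (h : Γ.BddBy u M) : Γ.IsL1 u := h.isL2.isL1

theorem BddBy.mul_isL1 {u f : E → ℝ → ℝ} {M : ℝ} (h : Γ.BddBy u M) (hf : Γ.IsL1 f) :
    Γ.IsL1 fun e x => u e x * f e x := fun e =>
  Integrable.bdd_mul (c := M) (hf e) (h e).1 (h e).2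

theorem IsL1.mul_bddBy {u f : E → ℝ → ℝ} {M : ℝ} (hf : Γ.IsL1 f) (h : Γ.BddBy u M) :
    Γ.IsL1 fun e x => f e x * u e x := fun e =>
  Integrable.mul_bdd (c := M) (hf e) (h e).1 (h e).2

theorem IsL1.add {u v : E → ℝ → ℝ} (hu : Γ.IsL1 u) (hv : Γ.IsL1 v) :
    Γ.IsL1 fun e x => u e x + v e x := fun e => (hu e).add (hv e)

theorem IsL1.sub {u v : E → ℝ → ℝ} (hu : Γ.IsL1 u) (hv : Γ.IsL1 v) :
    Γ.IsL1 fun e x => u e x - v e x := fun e => (hu e).sub (hv e)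

theorem IsL1.const_mul {u : E → ℝ → ℝ} (hu : Γ.IsL1 u) (c : ℝ) :
    Γ.IsL1 fun e x => c * u e x := fun e => (hu e).const_mul c

theorem IsL1.abs {u : E → ℝ → ℝ} (hu : Γ.IsL1 u) :
    Γ.IsL1 fun e x => |u e x| := fun e => (hu e).abs

theorem isL1_const (c : ℝ) : Γ.IsL1 fun _ _ => c := fun _ => integrable_const c

theorem integral_add {u v : E → ℝ → ℝ} (hu : Γ.IsL1 u) (hv : Γ.IsL1 v) :
    Γ.integral (fun e x => u e x + v e x) = Γ.integral u + Γ.integral v := by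
  simp only [integral, ← Finset.sum_add_distrib]
  exact Finset.sum_congr rfl fun e _ => MeasureTheory.integral_add (hu e) (hv e)

theorem integral_sub {u v : E → ℝ → ℝ} (hu : Γ.IsL1 u) (hv : Γ.IsL1 v) :
    Γ.integral (fun e x => u e x - v e x) = Γ.integral u - Γ.integral v := by
  simp only [integral, ← Finset.sum_sub_distrib]
  exact Finset.sum_congr rfl fun e _ => MeasureTheory.integral_sub (hu e) (hv e)

theorem integral_const_mul (c : ℝ) (u : E → ℝ → ℝ) :
    Γ.integral (fun e x => c * u e x) = c * Γ.integral u := by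
  simp only [integral, Finset.mul_sum]
  exact Finset.sum_congr rfl fun e _ => MeasureTheory.integral_const_mul _ _

theorem integral_neg (u : E → ℝ → ℝ) :
    Γ.integral (fun e x => - u e x) = - Γ.integral u := by
  simp only [integral, ← Finset.sum_neg_distrib]
  exact Finset.sum_congr rfl fun e _ => MeasureTheory.integral_neg _

theorem integral_congr {u v : E → ℝ → ℝ} (h : ∀ e, ∀ᵐ x ∂(Γ.edgeMeasure e), u e x = v e x) :
    Γ.integral u = Γ.integral v :=
  Finset.sum_congr rfl fun e _ => integral_congr_ae (h e)

theorem integral_mono {u v : E → ℝ → ℝ} (hu : Γ.IsL1 u) (hv : Γ.IsL1 v)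
    (h : ∀ e, ∀ᵐ x ∂(Γ.edgeMeasure e), u e x ≤ v e x) : Γ.integral u ≤ Γ.integral v :=
  Finset.sum_le_sum fun e _ => integral_mono_ae (hu e) (hv e) (h e)

theorem integral_nonneg {u : E → ℝ → ℝ} (h : ∀ e x, 0 ≤ u e x) : 0 ≤ Γ.integral u :=
  Finset.sum_nonneg fun e _ => MeasureTheory.integral_nonneg (h e)

theorem abs_integral_le (u : E → ℝ → ℝ) : |Γ.integral u| ≤ Γ.integral fun e x => |u e x| :=
  (Finset.abs_sum_le_sum_abs _ _).trans
    (Finset.sum_le_sum fun _ _ => abs_integral_le_integral_abs)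

theorem integral_const (c : ℝ) : Γ.integral (fun _ _ => c) = c * Γ.totalLength := by
  simp only [integral, totalLength, Finset.mul_sum]
  refine Finset.sum_congr rfl fun e _ => ?_
  rw [setIntegral_const, edge, Real.volume_real_Ioo_of_le (Γ.len_pos e).le]
  simp [mul_comm]

theorem setIntegral_edge (e : E) (f : ℝ → ℝ) :
    ∫ x in Γ.edge e, f x = ∫ x in (0 : ℝ)..Γ.len e, f x := by
  rw [intervalIntegral.integral_of_le (Γ.len_pos e).le, integral_Ioc_eq_integral_Ioo, edge]

-- Without loops the two ends of an edge are distinct vertices, so each edge contributes exactly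
-- once at each end.
open Classical in
theorem sum_incident (F : E → V → ℝ) :
    ∑ v, ∑ e with (v = Γ.ini e ∨ v = Γ.ter e), F e v = ∑ e, (F e (Γ.ini e) + F e (Γ.ter e)) := by
  simp only [Finset.sum_filter]
  rw [Finset.sum_comm]
  refine Finset.sum_congr rfl fun e _ => ?_
  rw [← Finset.sum_filter]
  have : (Finset.univ.filter fun v => v = Γ.ini e ∨ v = Γ.ter e) = {Γ.ini e, Γ.ter e} := by
    ext v; simp
  rw [this, Finset.sum_pair (Γ.no_loops e)]

theorem vertexValue_ini (z : E → ℝ → ℝ) (e : E) : Γ.vertexValue z e (Γ.ini e) = - z e 0 := by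
  simp [vertexValue, Γ.no_loops e]

theorem vertexValue_ter (z : E → ℝ → ℝ) (e : E) :
    Γ.vertexValue z e (Γ.ter e) = z e (Γ.len e) := by
  simp [vertexValue]

theorem IsXK.isL2_deriv {z dz : E → ℝ → ℝ} (h : Γ.IsXK z dz) : Γ.IsL2 dz := h.1.2.1

theorem IsXK.eq_primitive {z dz : E → ℝ → ℝ} (h : Γ.IsXK z dz) (e : E) {x : ℝ}
    (hx : x ∈ Icc 0 (Γ.len e)) : z e x = z e 0 + ∫ s in (0 : ℝ)..x, dz e s :=
  (h.1.2.2.1 e).eq_primitive (Γ.len_pos e) (h.1.2.2.2 e) (h.isL2_deriv.isL1 e) hx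

/-- Each edge contributes the sum of its two outward boundary values; regrouped by vertices, these
cancel by Kirchhoff's condition. -/
theorem IsXK.integral_deriv {z dz : E → ℝ → ℝ} (h : Γ.IsXK z dz) : Γ.integral dz = 0 := by
  classical
  have h1 : Γ.integral dz = ∑ e, (Γ.vertexValue z e (Γ.ini e) + Γ.vertexValue z e (Γ.ter e)) := by
    refine Finset.sum_congr rfl fun e _ => ?_
    rw [vertexValue_ini, vertexValue_ter, setIntegral_edge,
      h.eq_primitive e (right_mem_Icc.2 (Γ.len_pos e).le)]
    ring
  rw [h1, ← sum_incident]
  exact Finset.sum_eq_zero fun v _ => by convert h.2 v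

/-- Continuity upgrades the almost everywhere bound to the closed edge; the values at nodes and
vertices are needed pointwise. -/
theorem IsAdmissible.abs_le_one {z dz : E → ℝ → ℝ} (h : Γ.IsAdmissible z dz) (e : E) {x : ℝ}
    (hx : x ∈ Icc 0 (Γ.len e)) : |z e x| ≤ 1 := by
  have hc := h.1.1.2.2.2 e
  have h2 : EqOn (fun x => max |z e x| 1) (fun _ => 1) (Icc 0 (Γ.len e)) := by
    refine Measure.eqOn_Icc_of_ae_eq volume (Γ.len_pos e).ne ?_ (hc.abs.sup continuousOn_const)
      continuousOn_const
    rw [← restrict_Ioo_eq_restrict_Icc]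
    filter_upwards [h.2 e] with x hx
    exact max_eq_right hx
  exact max_eq_right_iff.1 (h2 hx)

open Classical in
/-- Primitives of square integrable functions satisfying Kirchhoff's condition. -/
theorem isXK_primitive {s : E → ℝ → ℝ} (hs : Γ.IsL2 s) (a : E → ℝ)
    (hK : ∀ v : V, ∑ e with (v = Γ.ini e ∨ v = Γ.ter e),
      (if v = Γ.ter e then a e + ∫ x in Γ.edge e, s e x else - a e) = 0) :
    Γ.IsXK (fun e x => a e + ∫ y in (0 : ℝ)..x, s e y) s := by
  have hc : ∀ e, ContinuousOn (fun x => a e + ∫ y in (0 : ℝ)..x, s e y) (Icc 0 (Γ.len e)) :=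
    fun e => continuousOn_const.add (continuousOn_primitive_Icc (Γ.len_pos e) (hs.isL1 e))
  refine ⟨⟨fun e => ?_, hs, fun e => ?_, hc⟩, fun v => ?_⟩
  · obtain ⟨C, hC⟩ := isCompact_Icc.exists_bound_of_continuousOn (hc e)
    refine MemLp.of_bound ((hc e).mono Ioo_subset_Icc_self |>.aestronglyMeasurable
      measurableSet_Ioo) C ?_
    filter_upwards [ae_restrict_mem (μ := volume) (s := Γ.edge e) measurableSet_Ioo] with x hx
    exact hC x (Ioo_subset_Icc_self hx)
  · exact hasWeakDerivOn_primitive (Γ.len_pos e) (a := a e) (hs.isL1 e) fun x _ => rfl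
  · refine (Finset.sum_congr rfl fun e _ => ?_).trans (hK v)
    simp only [vertexValue, setIntegral_edge, intervalIntegral.integral_same, add_zero]

theorem IsAdmissible.neg {z dz : E → ℝ → ℝ} (h : Γ.IsAdmissible z dz) :
    Γ.IsAdmissible (fun e x => - z e x) (fun e x => - dz e x) := by
  obtain ⟨⟨⟨h1, h2, h3, h4⟩, h5⟩, h6⟩ := h
  refine ⟨⟨⟨fun e => (h1 e).neg, fun e => (h2 e).neg, fun e φ hφ => ?_, fun e => (h4 e).neg⟩,
    fun v => ?_⟩, fun e => ?_⟩
  · have := h3 e φ hφ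
    simp only [neg_mul, MeasureTheory.integral_neg]
    rw [this]
  · have := h5 v
    rw [← neg_eq_zero, ← Finset.sum_neg_distrib] at this
    rw [← this]
    refine Finset.sum_congr rfl fun e _ => ?_
    simp only [vertexValue]; split_ifs <;> rfl
  · filter_upwards [h6 e] with x hx
    rwa [abs_neg]

theorem isAdmissible_zero : Γ.IsAdmissible (fun _ _ => 0) (fun _ _ => 0) := by
  have h := isXK_primitive (Γ := Γ) (s := fun _ _ => 0) (fun _ => MemLp.zero') (fun _ => 0)
    (fun v => Finset.sum_eq_zero fun e _ => by simp)
  refine ⟨by simpa using h, fun e => by simp⟩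

theorem DualBound.abs_le {u : E → ℝ → ℝ} {C : ℝ} (h : Γ.DualBound u C) {z dz : E → ℝ → ℝ}
    (hz : Γ.IsAdmissible z dz) : |Γ.integral fun e x => u e x * dz e x| ≤ C := by
  refine _root_.abs_le.2 ⟨?_, h z dz hz⟩
  have := h _ _ hz.neg
  simp only [mul_neg, integral_neg] at this
  linarith

theorem DualBound.nonneg {u : E → ℝ → ℝ} {C : ℝ} (h : Γ.DualBound u C) : 0 ≤ C :=
  (abs_nonneg _).trans (h.abs_le isAdmissible_zero)

theorem DualBound.TV_le {u : E → ℝ → ℝ} {C : ℝ} (h : Γ.DualBound u C) : Γ.TV u ≤ C := by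
  refine csSup_le ⟨_, _, _, isAdmissible_zero.1, isAdmissible_zero.2, rfl⟩ ?_
  rintro r ⟨z, dz, h1, h2, rfl⟩
  exact h.abs_le ⟨h1, h2⟩

theorem TV_nonneg (u : E → ℝ → ℝ) : 0 ≤ Γ.TV u := by
  refine Real.sSup_nonneg ?_
  rintro r ⟨z, dz, _, _, rfl⟩
  exact abs_nonneg _

theorem DualBound.congr {u v : E → ℝ → ℝ} {C : ℝ} (h : Γ.DualBound u C)
    (huv : ∀ e, ∀ᵐ x ∂(Γ.edgeMeasure e), u e x = v e x) : Γ.DualBound v C := fun z dz hz => by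
  rw [← integral_congr (u := fun e x => u e x * dz e x)]
  · exact h z dz hz
  · intro e
    filter_upwards [huv e] with x hx
    rw [hx]

theorem DualBound.const_mul {u : E → ℝ → ℝ} {C c : ℝ} (h : Γ.DualBound u C) (hc : 0 ≤ c) :
    Γ.DualBound (fun e x => c * u e x) (c * C) := fun z dz hz => by
  simp only [mul_assoc]
  rw [integral_const_mul]
  exact mul_le_mul_of_nonneg_left (h z dz hz) hc

theorem DualBound.neg {u : E → ℝ → ℝ} {C : ℝ} (h : Γ.DualBound u C) :
    Γ.DualBound (fun e x => - u e x) C := fun z dz hz => by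
  have := h _ _ hz.neg
  simpa [neg_mul, mul_neg] using this

theorem DualBound.add_const {u : E → ℝ → ℝ} {C M : ℝ} (hu : Γ.BddBy u M) (h : Γ.DualBound u C)
    (c : ℝ) : Γ.DualBound (fun e x => u e x + c) C := fun z dz hz => by
  simp only [add_mul]
  rw [integral_add (hu.mul_isL1 hz.1.isL2_deriv.isL1) (hz.1.isL2_deriv.isL1.const_mul c),
    integral_const_mul, hz.1.integral_deriv, mul_zero, add_zero]
  exact h z dz hz

/-- Bounded duality implies bounded variation. -/
theorem DualBound.isBV {u : E → ℝ → ℝ} {C : ℝ} (h : Γ.DualBound u C) (hu : Γ.IsL1 u) :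
    Γ.IsBV u := by
  classical
  intro e₀
  refine isBVOn_of_bound (Γ.len_pos e₀) (C := C) (hu e₀) fun s hs ⟨M, hM⟩ hs1 hs0 => ?_
  -- Extended by zero to the other edges, the primitive vanishes at all ends of edges, so
  -- Kirchhoff's condition holds trivially.
  set S : E → ℝ → ℝ := fun e => if e = e₀ then s else fun _ => 0 with hS
  have hS2 : Γ.IsL2 S := fun e => by
    simp only [hS]; split_ifs
    · exact MemLp.of_bound hs.aestronglyMeasurable M (Filter.Eventually.of_forall hM)
    · exact MemLp.zero'
  have hS0 : ∀ e, ∫ x in Γ.edge e, S e x = 0 := fun e => by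
    simp only [hS]; split_ifs with he
    · rw [setIntegral_edge, he, hs0]
    · simp
  have hX := isXK_primitive hS2 (fun _ => 0) fun v => Finset.sum_eq_zero fun e _ => by simp [hS0 e]
  have := h _ _ ⟨hX, fun e => by
    filter_upwards [ae_restrict_mem (μ := volume) (s := Γ.edge e) measurableSet_Ioo] with x hx
    simp only [hS, zero_add]; split_ifs with he
    · subst he; exact hs1 x (Ioo_subset_Icc_self hx)
    · simp⟩
  refine le_trans (le_of_eq ?_) this
  rw [integral, Finset.sum_eq_single e₀]
  · simp [hS, edge]
  · intro e _ he; simp [hS, he]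
  · simp

theorem IsBV.isL1 {u : E → ℝ → ℝ} (h : Γ.IsBV u) : Γ.IsL1 u := fun e => (h e).1

theorem IsBV.exists_bddBy {u : E → ℝ → ℝ} (h : Γ.IsBV u) : ∃ M, 0 ≤ M ∧ Γ.BddBy u M := by
  choose C hC0 hC1 _ using fun e => (h e).exists_bound (Γ.len_pos e)
  refine ⟨∑ e, C e, Finset.sum_nonneg fun e _ => hC0 e, fun e => ⟨(h e).1.1, ?_⟩⟩
  filter_upwards [hC1 e] with x hx
  exact hx.trans (Finset.single_le_sum (fun e _ => hC0 e) (Finset.mem_univ e))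

/-- A real supremum bounds its set only if the set is bounded above; the edgewise constants of
`IsBVOn.exists_bound` provide this. -/
theorem IsBV.dualBound {u : E → ℝ → ℝ} (h : Γ.IsBV u) : Γ.DualBound u (Γ.TV u) := by
  choose C hC0 _ hC2 using fun e => (h e).exists_bound (Γ.len_pos e)
  intro z dz hz
  refine (le_abs_self _).trans (le_csSup ⟨∑ e, C e, ?_⟩ ⟨z, dz, hz.1, hz.2, rfl⟩)
  rintro r ⟨z, dz, h1, h2, rfl⟩
  refine (Finset.abs_sum_le_sum_abs _ _).trans (Finset.sum_le_sum fun e _ => ?_)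
  exact hC2 e (z e) (dz e) (h1.isL2_deriv.isL1 e) (fun x hx => h1.eq_primitive e hx)
    (fun x hx => IsAdmissible.abs_le_one ⟨h1, h2⟩ e hx)

end MetricGraph

/-! ### Functions that are constant on the cells of an equidistant partition -/

theorem floor_div_eq_of_mem_Ico {δ x : ℝ} (hδ : 0 < δ) {i : ℕ}
    (hx : x ∈ Ico (i * δ) ((i + 1 : ℕ) * δ)) : ⌊x / δ⌋₊ = i := by
  have h0 : 0 ≤ x := le_trans (by positivity) hx.1
  rw [Nat.floor_eq_iff (by positivity)]
  refine ⟨(le_div_iff₀ hδ).2 hx.1, ?_⟩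
  rw [div_lt_iff₀ hδ]
  simpa using hx.2

theorem intervalIntegral_step_cell {δ x : ℝ} (hδ : 0 < δ) (c : ℕ → ℝ) (g : ℝ → ℝ) {i : ℕ}
    (hx : x ∈ Icc (i * δ) ((i + 1 : ℕ) * δ)) :
    ∫ y in (i * δ)..x, c ⌊y / δ⌋₊ * g y = c i * ∫ y in (i * δ)..x, g y := by
  rw [← intervalIntegral.integral_const_mul, intervalIntegral.integral_of_le hx.1,
    intervalIntegral.integral_of_le hx.1, integral_Ioc_eq_integral_Ioo,
    integral_Ioc_eq_integral_Ioo]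
  refine setIntegral_congr_fun measurableSet_Ioo fun y hy => ?_
  rw [floor_div_eq_of_mem_Ico hδ (i := i) ⟨hy.1.le, hy.2.trans_le hx.2⟩]

theorem IntervalIntegrable.step_cell {δ x : ℝ} (hδ : 0 < δ) (c : ℕ → ℝ) {g : ℝ → ℝ} {i : ℕ}
    (hx : x ∈ Icc (i * δ) ((i + 1 : ℕ) * δ)) (hg : IntervalIntegrable g volume (i * δ) x) :
    IntervalIntegrable (fun y => c ⌊y / δ⌋₊ * g y) volume (i * δ) x := by
  rw [intervalIntegrable_iff_integrableOn_Ioo_of_le hx.1] at hg ⊢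
  refine (hg.const_mul (c i)).congr ?_
  filter_upwards [ae_restrict_mem measurableSet_Ioo] with y hy
  rw [floor_div_eq_of_mem_Ico hδ (i := i) ⟨hy.1.le, hy.2.trans_le hx.2⟩]

/-- The interval is cut at the nodes. Cells are closed at both ends so that the end of an edge may
be read with `i = n`, where the last term vanishes. -/
theorem intervalIntegral_step {δ x : ℝ} (hδ : 0 < δ) (c : ℕ → ℝ) {g : ℝ → ℝ} {i : ℕ}
    (hx : x ∈ Icc (i * δ) ((i + 1 : ℕ) * δ)) (hg : IntervalIntegrable g volume 0 x) :
    ∫ y in (0 : ℝ)..x, c ⌊y / δ⌋₊ * g y =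
      (∑ j ∈ Finset.range i, c j * ∫ y in (j * δ)..((j + 1 : ℕ) * δ), g y) +
        c i * ∫ y in (i * δ)..x, g y := by
  have h0x : 0 ≤ x := le_trans (by positivity) hx.1
  have hsub : ∀ j < i, IntervalIntegrable g volume (j * δ) ((j + 1 : ℕ) * δ) := fun j hj => by
    refine hg.mono_set ?_
    rw [uIcc_of_le (by gcongr; omega), uIcc_of_le h0x]
    refine Icc_subset_Icc (by positivity) (le_trans ?_ hx.1)
    gcongr; omega
  have hlast : IntervalIntegrable g volume (i * δ) x := by
    refine hg.mono_set ?_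
    rw [uIcc_of_le hx.1, uIcc_of_le h0x]
    exact Icc_subset_Icc (by positivity) le_rfl
  have hcell : ∀ j < i, IntervalIntegrable (fun y => c ⌊y / δ⌋₊ * g y) volume (j * δ)
      ((j + 1 : ℕ) * δ) := fun j hj =>
    (hsub j hj).step_cell hδ c (right_mem_Icc.2 (by gcongr; omega))
  have h1 := intervalIntegral.sum_integral_adjacent_intervals (a := fun j : ℕ => (j : ℝ) * δ) hcell
  have h2 := IntervalIntegrable.trans_iterate (a := fun j : ℕ => (j : ℝ) * δ) hcell
  simp only [Nat.cast_zero, zero_mul] at h1 h2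
  rw [← intervalIntegral.integral_add_adjacent_intervals h2 (hlast.step_cell hδ c hx), ← h1,
    intervalIntegral_step_cell hδ c g hx]
  congr 1
  refine Finset.sum_congr rfl fun j hj => ?_
  exact intervalIntegral_step_cell hδ c g (right_mem_Icc.2 (by gcongr; omega))

theorem exists_cell {δ x : ℝ} (hδ : 0 < δ) (hx : 0 ≤ x) :
    x ∈ Icc (⌊x / δ⌋₊ * δ) ((⌊x / δ⌋₊ + 1 : ℕ) * δ) := by
  refine ⟨(le_div_iff₀ hδ).1 (Nat.floor_le (by positivity)), ?_⟩
  have := (Nat.lt_floor_add_one (x / δ)).le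
  rw [div_le_iff₀ hδ] at this
  simpa using this

/-- Integrals of piecewise constant functions are piecewise affine. -/
theorem intervalIntegral_step_slope {δ x : ℝ} (hδ : 0 < δ) (ζ : ℕ → ℝ) {i : ℕ}
    (hx : x ∈ Icc (i * δ) ((i + 1 : ℕ) * δ)) :
    ζ 0 + ∫ y in (0 : ℝ)..x, (ζ (⌊y / δ⌋₊ + 1) - ζ ⌊y / δ⌋₊) / δ =
      ζ i + (x - i * δ) / δ * (ζ (i + 1) - ζ i) := by
  have h := intervalIntegral_step hδ (fun i => (ζ (i + 1) - ζ i) / δ) (g := fun _ => 1) hx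
    (by simp)
  simp only [mul_one, intervalIntegral.integral_const, smul_eq_mul] at h
  rw [h]
  have : ∀ j : ℕ, (ζ (j + 1) - ζ j) / δ * (((j + 1 : ℕ) : ℝ) * δ - j * δ) = ζ (j + 1) - ζ j :=
    fun j => by push_cast; field_simp; ring
  simp only [this, Finset.sum_range_sub]
  field_simp; ring

/-- On a cell the primitive is a convex combination of two neighbouring nodal values. The end point
`n * δ` is assigned to the cell `n - 1`, since nothing is known about `ζ (n + 1)`. -/
theorem abs_intervalIntegral_step_slope_le {δ x : ℝ} (hδ : 0 < δ) {n : ℕ} (hn : 0 < n) {ζ : ℕ → ℝ}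
    (hζ : ∀ i ≤ n, |ζ i| ≤ 1) (hx : x ∈ Icc 0 (n * δ)) :
    |ζ 0 + ∫ y in (0 : ℝ)..x, (ζ (⌊y / δ⌋₊ + 1) - ζ ⌊y / δ⌋₊) / δ| ≤ 1 := by
  obtain ⟨i, hi, hxi⟩ : ∃ i < n, x ∈ Icc (i * δ) ((i + 1 : ℕ) * δ) := by
    rcases eq_or_lt_of_le hx.2 with h | h
    · refine ⟨n - 1, by omega, ?_⟩
      rw [Nat.sub_add_cancel hn, h]
      exact right_mem_Icc.2 (by gcongr; omega)
    · refine ⟨_, ?_, exists_cell hδ hx.1⟩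
      rw [Nat.floor_lt (div_nonneg hx.1 hδ.le), div_lt_iff₀ hδ]
      exact h
  rw [intervalIntegral_step_slope hδ ζ hxi]
  set θ := (x - i * δ) / δ with hθ
  have h0 : 0 ≤ θ := div_nonneg (by linarith [hxi.1]) hδ.le
  have h1 : θ ≤ 1 := by
    rw [hθ, div_le_one hδ]; have := hxi.2; push_cast at this; linarith
  have a1 := abs_le.1 (hζ i hi.le)
  have a2 := abs_le.1 (hζ (i + 1) hi)
  rw [abs_le]; constructor <;> nlinarith

/-! ### Cell averages on the graph -/

namespace MetricGraph

set_option linter.unusedSectionVars false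

variable {V E : Type*} [Fintype V] [Fintype E] (Γ : MetricGraph V E)

/-- The length of the cells when the edge `e` is divided into `n` equal cells. -/
def mesh (n : ℕ) (e : E) : ℝ := Γ.len e / n

/-- The function with the value `c e i` on the cell `i` of the edge `e`. -/
def step (n : ℕ) (c : E → ℕ → ℝ) : E → ℝ → ℝ := fun e x => c e ⌊x / Γ.mesh n e⌋₊

/-- The integral over a cell. -/
def cellIntegral (n : ℕ) (f : E → ℝ → ℝ) (e : E) (i : ℕ) : ℝ :=
  ∫ x in (i * Γ.mesh n e)..((i + 1 : ℕ) * Γ.mesh n e), f e x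

/-- The mean value over a cell. -/
def cellAvg (n : ℕ) (f : E → ℝ → ℝ) (e : E) (i : ℕ) : ℝ :=
  Γ.cellIntegral n f e i / Γ.mesh n e

/-- Summation over all cells. -/
def cellSum (n : ℕ) (c : E → ℕ → ℝ) : ℝ := ∑ e : E, ∑ i ∈ Finset.range n, c e i

variable {Γ}

theorem mesh_pos {n : ℕ} (hn : 0 < n) (e : E) : 0 < Γ.mesh n e :=
  div_pos (Γ.len_pos e) (Nat.cast_pos.2 hn)

theorem mul_mesh {n : ℕ} (hn : 0 < n) (e : E) : n * Γ.mesh n e = Γ.len e := by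
  have : (n : ℝ) ≠ 0 := Nat.cast_ne_zero.2 hn.ne'
  rw [mesh]; field_simp

theorem IsL1.intervalIntegrable {f : E → ℝ → ℝ} (hf : Γ.IsL1 f) (e : E) {a b : ℝ}
    (ha : a ∈ Icc 0 (Γ.len e)) (hb : b ∈ Icc 0 (Γ.len e)) :
    IntervalIntegrable (f e) volume a b := by
  have : IntegrableOn (f e) (Icc 0 (Γ.len e)) := (integrableOn_Icc_iff_integrableOn_Ioo).2 (hf e)
  exact (this.mono_set (uIcc_subset_Icc ha hb)).intervalIntegrable

theorem node_mem {n : ℕ} (hn : 0 < n) (e : E) {i : ℕ} (hi : i ≤ n) :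
    i * Γ.mesh n e ∈ Icc 0 (Γ.len e) := by
  have := mesh_pos (Γ := Γ) hn e
  refine ⟨by positivity, ?_⟩
  rw [← mul_mesh hn e]
  gcongr

theorem integral_step_mul {n : ℕ} (hn : 0 < n) (c : E → ℕ → ℝ) {f : E → ℝ → ℝ} (hf : Γ.IsL1 f) :
    Γ.integral (fun e x => Γ.step n c e x * f e x) =
      cellSum n fun e i => c e i * Γ.cellIntegral n f e i := by
  refine Finset.sum_congr rfl fun e _ => ?_
  have hδ := mesh_pos (Γ := Γ) hn e
  rw [setIntegral_edge]
  have h := intervalIntegral_step hδ (c e) (g := f e) (i := n) (x := Γ.len e)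
    (by rw [← mul_mesh hn e]; exact ⟨le_rfl, by gcongr; omega⟩)
    (hf.intervalIntegrable e (left_mem_Icc.2 (Γ.len_pos e).le)
      (right_mem_Icc.2 (Γ.len_pos e).le))
  rw [mul_mesh hn e, intervalIntegral.integral_same, mul_zero, add_zero] at h
  exact h

theorem step_measurable (n : ℕ) (c : E → ℕ → ℝ) (e : E) : Measurable (Γ.step n c e) :=
  (measurable_of_countable (c e)).comp (Nat.measurable_floor.comp (measurable_id.div_const _))

theorem floor_lt_of_mem_edge {n : ℕ} (hn : 0 < n) {e : E} {x : ℝ} (hx : x ∈ Γ.edge e) :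
    ⌊x / Γ.mesh n e⌋₊ < n := by
  have hδ := mesh_pos (Γ := Γ) hn e
  rw [Nat.floor_lt (div_nonneg hx.1.le hδ.le), div_lt_iff₀ hδ, mul_mesh hn e]
  exact hx.2

theorem ae_mem_edge (e : E) : ∀ᵐ x ∂(Γ.edgeMeasure e), x ∈ Γ.edge e :=
  ae_restrict_mem measurableSet_Ioo

theorem step_bddBy {n : ℕ} (hn : 0 < n) {c : E → ℕ → ℝ} {M : ℝ} (hc : ∀ e, ∀ i < n, |c e i| ≤ M) :
    Γ.BddBy (Γ.step n c) M := fun e =>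
  ⟨(step_measurable n c e).aestronglyMeasurable, by
    filter_upwards [ae_mem_edge e] with x hx
    exact hc e _ (floor_lt_of_mem_edge hn hx)⟩

theorem exists_step_bddBy {n : ℕ} (hn : 0 < n) (c : E → ℕ → ℝ) : ∃ M, Γ.BddBy (Γ.step n c) M := by
  refine ⟨∑ e, ∑ i ∈ Finset.range n, |c e i|, step_bddBy hn fun e i hi => ?_⟩
  refine le_trans ?_ (Finset.single_le_sum (f := fun e => ∑ i ∈ Finset.range n, |c e i|)
    (fun e _ => Finset.sum_nonneg fun _ _ => abs_nonneg _) (Finset.mem_univ e))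
  exact Finset.single_le_sum (f := fun i => |c e i|) (fun _ _ => abs_nonneg _)
    (Finset.mem_range.2 hi)

theorem cellIntegral_step {n : ℕ} (hn : 0 < n) (c : E → ℕ → ℝ) (e : E) (i : ℕ) :
    Γ.cellIntegral n (Γ.step n c) e i = c e i * Γ.mesh n e := by
  have hδ := mesh_pos (Γ := Γ) hn e
  have h := intervalIntegral_step_cell hδ (c e) (fun _ => 1) (i := i)
    (x := (i + 1 : ℕ) * Γ.mesh n e) (right_mem_Icc.2 (by gcongr; omega))
  simp only [mul_one, intervalIntegral.integral_const, smul_eq_mul] at h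
  rw [cellIntegral]
  refine h.trans ?_
  push_cast; ring

theorem BddBy.cellAvg_le {n : ℕ} (hn : 0 < n) {u : E → ℝ → ℝ} {M : ℝ} (h : Γ.BddBy u M) (e : E)
    {i : ℕ} (hi : i < n) : |Γ.cellAvg n u e i| ≤ M := by
  have hδ := mesh_pos (Γ := Γ) hn e
  rw [cellAvg, abs_div, abs_of_pos hδ, div_le_iff₀ hδ, cellIntegral]
  have h1 := intervalIntegral.norm_integral_le_of_norm_le_const_ae (C := M) (f := u e)
    (a := i * Γ.mesh n e) (b := (i + 1 : ℕ) * Γ.mesh n e) (by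
      have hle : (i : ℝ) * Γ.mesh n e ≤ (i + 1 : ℕ) * Γ.mesh n e := by gcongr; omega
      rw [uIoc_of_le hle]
      have h2 := (ae_restrict_iff' measurableSet_Ioo).1 (h e).2
      -- The last cell contains the end of the edge, where the bound is not available; a null set is
      -- discarded.
      have h3 : ∀ᵐ x : ℝ, x ≠ Γ.len e := by simp [ae_iff]
      filter_upwards [h2, h3] with x hx hx3 hx'
      refine hx ⟨lt_of_le_of_lt (by positivity) hx'.1, lt_of_le_of_ne ?_ hx3⟩
      exact hx'.2.trans (node_mem hn e (i := i + 1) hi).2)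
  refine h1.trans (le_of_eq ?_)
  have : ((i + 1 : ℕ) : ℝ) * Γ.mesh n e - i * Γ.mesh n e = Γ.mesh n e := by push_cast; ring
  rw [this, abs_of_pos hδ]

theorem len_le_totalLength (e : E) : Γ.len e ≤ Γ.totalLength :=
  Finset.single_le_sum (f := Γ.len) (fun e _ => (Γ.len_pos e).le) (Finset.mem_univ e)

theorem totalLength_pos [Nonempty E] (Γ : MetricGraph V E) : 0 < Γ.totalLength :=
  Finset.sum_pos (fun e _ => Γ.len_pos e) Finset.univ_nonempty

/-- Functions of finite total variation are close to their cell averages in `L¹`. -/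
theorem DualBound.integral_sub_step_le [Nonempty E] {n : ℕ} (hn : 0 < n) {u : E → ℝ → ℝ} {C : ℝ}
    (hu : Γ.IsL1 u) (h : Γ.DualBound u C) :
    Γ.integral (fun e x => |u e x - Γ.step n (Γ.cellAvg n u) e x|) ≤
      2 * Γ.totalLength / n * C := by
  have hT := totalLength_pos Γ
  have hn' : (0 : ℝ) < n := Nat.cast_pos.2 hn
  set sg : ℝ → ℝ := fun y => if 0 ≤ y then 1 else -1 with hsg
  have hsgm : Measurable sg := Measurable.ite measurableSet_Ici measurable_const measurable_const
  have hsga : ∀ y, y * sg y = |y| := fun y => by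
    simp only [hsg]; split_ifs with hy
    · rw [mul_one, abs_of_nonneg hy]
    · rw [abs_of_neg (not_le.1 hy)]; ring
  set s : E → ℝ → ℝ := fun e x => sg (u e x - Γ.step n (Γ.cellAvg n u) e x) with hs
  have hsb : Γ.BddBy s 1 := fun e => by
    refine ⟨(hsgm.comp_aemeasurable ((hu e).1.aemeasurable.sub
      (step_measurable _ _ e).aemeasurable)).aestronglyMeasurable,
      Filter.Eventually.of_forall fun x => ?_⟩
    simp only [hs, hsg]; split_ifs <;> simp
  obtain ⟨M', hM'⟩ := exists_step_bddBy (Γ := Γ) hn (Γ.cellAvg n u)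
  have hAb : Γ.BddBy (Γ.step n (Γ.cellAvg n s)) 1 := step_bddBy hn fun e i hi => hsb.cellAvg_le hn e hi
  -- The sign `s` minus its cell average has a primitive that vanishes at every node and is at most
  -- twice the mesh in between; `κ` scales this bound to at most `1`.
  set κ : ℝ := n / (2 * Γ.totalLength) with hκ
  have hκ0 : 0 < κ := by positivity
  set t : E → ℝ → ℝ := fun e x => κ * (s e x - Γ.step n (Γ.cellAvg n s) e x) with ht
  have ht2 : Γ.IsL2 t := fun e => ((hsb.isL2 e).sub (hAb.isL2 e)).const_mul κ
  have hprim : ∀ e, ∀ i ≤ n, ∀ x ∈ Icc 0 (Γ.len e),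
      x ∈ Icc (i * Γ.mesh n e) ((i + 1 : ℕ) * Γ.mesh n e) →
      ∫ y in (0 : ℝ)..x, t e y = κ * ((∫ y in (i * Γ.mesh n e)..x, s e y) -
        Γ.cellAvg n s e i * (x - i * Γ.mesh n e)) := fun e i hi x hx hxi => by
    have hδ := mesh_pos (Γ := Γ) hn e
    have h0 : (0 : ℝ) ∈ Icc 0 (Γ.len e) := left_mem_Icc.2 (Γ.len_pos e).le
    have e1 := intervalIntegral_step hδ (fun _ => 1) (g := s e) hxi
      (hsb.isL1.intervalIntegrable e h0 hx)
    have e2 := intervalIntegral_step hδ (Γ.cellAvg n s e) (g := fun _ => 1) hxi (by simp)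
    simp only [one_mul] at e1
    simp only [mul_one, intervalIntegral.integral_const, smul_eq_mul] at e2
    simp only [ht]
    rw [intervalIntegral.integral_const_mul, intervalIntegral.integral_sub
      (hsb.isL1.intervalIntegrable e h0 hx) (hAb.isL1.intervalIntegrable e h0 hx), e1]
    have e3 : ∫ y in (0 : ℝ)..x, Γ.step n (Γ.cellAvg n s) e y = _ := e2
    rw [e3]
    have e4 : ∀ j : ℕ, Γ.cellAvg n s e j * (((j + 1 : ℕ) : ℝ) * Γ.mesh n e - j * Γ.mesh n e) =
        ∫ y in (j * Γ.mesh n e)..((j + 1 : ℕ) * Γ.mesh n e), s e y := fun j => by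
      rw [cellAvg, cellIntegral]; push_cast; field_simp; ring
    simp only [e4]
    ring
  have ht0 : ∀ e, ∫ x in Γ.edge e, t e x = 0 := fun e => by
    rw [setIntegral_edge, hprim e n le_rfl (Γ.len e) (right_mem_Icc.2 (Γ.len_pos e).le)
      (by have hδ := mesh_pos (Γ := Γ) hn e
          rw [← mul_mesh hn e]; exact ⟨le_rfl, by gcongr; omega⟩), mul_mesh hn e]
    simp
  have hX := isXK_primitive ht2 (fun _ => 0) fun v => Finset.sum_eq_zero fun e _ => by simp [ht0 e]
  have hadm : Γ.IsAdmissible (fun e x => 0 + ∫ y in (0 : ℝ)..x, t e y) t := by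
    refine ⟨hX, fun e => ?_⟩
    filter_upwards [ae_mem_edge e] with x hx
    have hδ := mesh_pos (Γ := Γ) hn e
    have hfl := floor_lt_of_mem_edge hn hx
    have hxi := exists_cell hδ hx.1.le
    set i := ⌊x / Γ.mesh n e⌋₊
    rw [zero_add, hprim e i hfl.le x (Ioo_subset_Icc_self hx) hxi]
    have hxw : 0 ≤ x - i * Γ.mesh n e := by linarith [hxi.1]
    have hxw' : x - i * Γ.mesh n e ≤ Γ.mesh n e := by
      have := hxi.2; push_cast at this; linarith
    have b1 : ‖∫ y in (i * Γ.mesh n e)..x, s e y‖ ≤ 1 * |x - i * Γ.mesh n e| := by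
      refine intervalIntegral.norm_integral_le_of_norm_le_const fun y _ => ?_
      simp only [hs, hsg, Real.norm_eq_abs]; split_ifs <;> simp
    rw [abs_of_nonneg hxw, one_mul, Real.norm_eq_abs] at b1
    have b2 : |Γ.cellAvg n s e i * (x - i * Γ.mesh n e)| ≤ x - i * Γ.mesh n e := by
      rw [abs_mul, abs_of_nonneg hxw]
      exact mul_le_of_le_one_left hxw (hsb.cellAvg_le hn e hfl)
    have b3 := abs_sub (∫ y in (i * Γ.mesh n e)..x, s e y)
      (Γ.cellAvg n s e i * (x - i * Γ.mesh n e))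
    have b4 : Γ.mesh n e ≤ Γ.totalLength / n := by
      rw [mesh]; gcongr; exact len_le_totalLength e
    rw [abs_mul, abs_of_pos hκ0]
    calc κ * _ ≤ κ * (2 * (Γ.totalLength / n)) := by gcongr; linarith
      _ = 1 := by rw [hκ]; field_simp
  have hfin := h _ _ hadm
  have hus : Γ.IsL1 fun e x => u e x * s e x := hu.mul_bddBy hsb
  have huA : Γ.IsL1 fun e x => Γ.step n (Γ.cellAvg n s) e x * u e x := hAb.mul_isL1 hu
  have hAs : Γ.IsL1 fun e x => Γ.step n (Γ.cellAvg n u) e x * s e x := hM'.mul_isL1 hsb.isL1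
  have e1 : (Γ.integral fun e x => u e x * t e x) = κ *
      ((Γ.integral fun e x => u e x * s e x) -
        Γ.integral fun e x => Γ.step n (Γ.cellAvg n s) e x * u e x) := by
    rw [← integral_sub hus huA, ← integral_const_mul]
    congr 1; funext e x; simp only [ht]; ring
  have e2 : (Γ.integral fun e x => |u e x - Γ.step n (Γ.cellAvg n u) e x|) =
      (Γ.integral fun e x => u e x * s e x) -
        Γ.integral fun e x => Γ.step n (Γ.cellAvg n u) e x * s e x := by
    rw [← integral_sub hus hAs]
    congr 1; funext e x; rw [← hsga, ← sub_mul]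
  -- Cell averaging is self-adjoint, so testing `u` with `t` gives `κ` times the `L¹` distance of
  -- `u` from its cell averages.
  have e3 : (Γ.integral fun e x => Γ.step n (Γ.cellAvg n s) e x * u e x) =
      Γ.integral fun e x => Γ.step n (Γ.cellAvg n u) e x * s e x := by
    rw [integral_step_mul hn _ hu, integral_step_mul hn _ hsb.isL1]
    refine Finset.sum_congr rfl fun e _ => Finset.sum_congr rfl fun i _ => ?_
    simp only [cellAvg]; ring
  rw [e1, e3, ← e2] at hfin
  calc _ = κ⁻¹ * (κ * Γ.integral fun e x => |u e x - Γ.step n (Γ.cellAvg n u) e x|) := by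
        rw [inv_mul_cancel_left₀ hκ0.ne']
    _ ≤ κ⁻¹ * C := by gcongr
    _ = _ := by rw [hκ, inv_div]

end MetricGraph

/-! ### A discrete field that is optimal for all superlevel sets at once -/

open Classical in
/-- Among the balanced weights `ζ` in `[-1, 1]` there is one that maximizes the sum over every
superlevel set of `α`. -/
theorem exists_balanced_weights {ι : Type*} (α : ι → ℝ) (I : Finset ι) :
    ∃ ζ : ι → ℝ, (∀ i, |ζ i| ≤ 1) ∧ ∑ i ∈ I, ζ i = 0 ∧
      ∀ U : Set ℝ, IsUpperSet U → ∀ η : ι → ℝ, (∀ i ∈ I, |η i| ≤ 1) → ∑ i ∈ I, η i = 0 →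
        ∑ i ∈ I with α i ∈ U, η i ≤ ∑ i ∈ I with α i ∈ U, ζ i := by
  -- A balanced `η` in `[-1, 1]` sums over a subset to at most the size of the subset, and also to
  -- at most the size of its complement. It suffices to reach the smaller of the two on every
  -- superlevel set.
  suffices H : ∃ ζ : ι → ℝ, (∀ i, |ζ i| ≤ 1) ∧ ∑ i ∈ I, ζ i = 0 ∧
      ∀ U : Set ℝ, IsUpperSet U → min ((I.filter fun i => α i ∈ U).card : ℝ)
        ((I.filter fun i => α i ∉ U).card : ℝ) ≤ ∑ i ∈ I with α i ∈ U, ζ i by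
    obtain ⟨ζ, h1, h2, h3⟩ := H
    refine ⟨ζ, h1, h2, fun U hU η hη hη0 => le_trans (le_min ?_ ?_) (h3 U hU)⟩
    · refine (Finset.sum_le_sum (g := fun _ => (1 : ℝ)) fun i hi =>
        (abs_le.1 (hη i (Finset.mem_filter.1 hi).1)).2).trans ?_
      simp
    · have := Finset.sum_filter_add_sum_filter_not I (fun i => α i ∈ U) η
      have h4 : ∑ i ∈ I with α i ∈ U, η i = ∑ i ∈ I with α i ∉ U, - η i := by
        rw [Finset.sum_neg_distrib]; linarith
      rw [h4]
      refine (Finset.sum_le_sum (g := fun _ => (1 : ℝ)) fun i hi => by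
        linarith [(abs_le.1 (hη i (Finset.mem_filter.1 hi).1)).1]).trans ?_
      simp
  induction I using Finset.strongInduction with
  | H I ih =>
    by_cases hc : I.card ≤ 1
    · refine ⟨fun _ => 0, by simp, by simp, fun U _ => ?_⟩
      rw [Finset.sum_const_zero]
      have h5 := Finset.card_filter_add_card_filter_not (s := I) (fun i => α i ∈ U)
      by_cases h6 : (I.filter fun i => α i ∈ U).card = 0
      · exact (min_le_left _ _).trans (by rw [h6]; simp)
      · have h7 : (I.filter fun i => α i ∉ U).card = 0 := by omega
        exact (min_le_right _ _).trans (by rw [h7]; simp)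
    · have hne : I.Nonempty := Finset.card_pos.1 (by omega)
      -- The largest value gets weight `1`, the smallest remaining one `-1`, and the rest is treated
      -- by induction. A superlevel set that separates `p` from `q` gains one element on each side,
      -- so the minimum and the sum both grow by `1`.
      obtain ⟨p, hp, hpmax⟩ := I.exists_max_image α hne
      have hne' : (I.erase p).Nonempty := Finset.card_pos.1 (by
        rw [Finset.card_erase_of_mem hp]; omega)
      obtain ⟨q, hq, hqmin⟩ := (I.erase p).exists_min_image α hne'
      have hqI : q ∈ I := Finset.mem_of_mem_erase hq
      have hqp : q ≠ p := Finset.ne_of_mem_erase hq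
      have hqmin' : ∀ i ∈ I, α q ≤ α i := fun i hi => by
        by_cases h : i = p
        · rw [h]; exact hpmax q hqI
        · exact hqmin i (Finset.mem_erase.2 ⟨h, hi⟩)
      set J := (I.erase p).erase q with hJ
      have hqJ : q ∉ J := Finset.notMem_erase _ _
      have hpJ : p ∉ J := fun h => Finset.notMem_erase p I (Finset.mem_of_mem_erase h)
      have hIJ : I = insert p (insert q J) := by
        rw [hJ, Finset.insert_erase hq, Finset.insert_erase hp]
      have hpqJ : p ∉ insert q J := by
        simp only [Finset.mem_insert, not_or]; exact ⟨hqp.symm, hpJ⟩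
      obtain ⟨ζ, h1, h2, h3⟩ := ih J (by
        rw [hIJ]
        exact (Finset.ssubset_insert hqJ).trans (Finset.ssubset_insert hpqJ))
      set ζ' : ι → ℝ := fun i => if i = p then 1 else if i = q then -1 else ζ i with hζ'
      have hζJ : ∀ i ∈ J, ζ' i = ζ i := fun i hi => by
        simp only [hζ']
        rw [if_neg (ne_of_mem_of_not_mem hi hpJ), if_neg (ne_of_mem_of_not_mem hi hqJ)]
      have hζp : ζ' p = 1 := by simp [hζ']
      have hζq : ζ' q = -1 := by simp [hζ', hqp]
      refine ⟨ζ', fun i => ?_, ?_, fun U hU => ?_⟩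
      · simp only [hζ']; split_ifs <;> simp [h1]
      · rw [hIJ, Finset.sum_insert hpqJ, Finset.sum_insert hqJ, hζp, hζq,
          Finset.sum_congr rfl hζJ, h2]; ring
      · by_cases hpU : α p ∈ U
        · by_cases hqU : α q ∈ U
          · have : (I.filter fun i => α i ∉ U) = ∅ := by
              refine Finset.filter_eq_empty_iff.2 fun i hi => not_not.2 (hU (hqmin' i hi) hqU)
            have h8 : (I.filter fun i => α i ∈ U) = I :=
              Finset.filter_true_of_mem fun i hi => hU (hqmin' i hi) hqU
            refine (min_le_right _ _).trans ?_
            rw [this, h8, hIJ, Finset.sum_insert hpqJ, Finset.sum_insert hqJ, hζp, hζq,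
              Finset.sum_congr rfl hζJ, h2]
            simp
          · have h4 := h3 U hU
            have h9 : ∑ i ∈ J with α i ∈ U, ζ' i = ∑ i ∈ J with α i ∈ U, ζ i :=
              Finset.sum_congr rfl fun i hi => hζJ i (Finset.mem_filter.1 hi).1
            have hpJ' : p ∉ J.filter fun i => α i ∈ U := fun h => hpJ (Finset.mem_filter.1 h).1
            have hqJ' : q ∉ J.filter fun i => α i ∉ U := fun h => hqJ (Finset.mem_filter.1 h).1
            rw [hIJ, Finset.filter_insert, if_pos hpU, Finset.filter_insert, if_neg hqU,
              Finset.filter_insert, if_neg (not_not.2 hpU), Finset.filter_insert, if_pos hqU,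
              Finset.sum_insert hpJ', h9, hζp, Finset.card_insert_of_notMem hpJ',
              Finset.card_insert_of_notMem hqJ']
            push_cast
            rw [min_add_add_right]
            linarith
        · have : (I.filter fun i => α i ∈ U) = ∅ :=
            Finset.filter_eq_empty_iff.2 fun i hi h => hpU (hU (hpmax i hi) h)
          rw [this]; simp

/-- Summation by parts. -/
theorem sum_mul_sub_eq (b η : ℕ → ℝ) (m : ℕ) :
    ∑ i ∈ Finset.range (m + 1), b i * (η (i + 1) - η i) =
      b m * η (m + 1) - b 0 * η 0 + ∑ i ∈ Finset.range m, (b i - b (i + 1)) * η (i + 1) := by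
  induction m with
  | zero => simp; ring
  | succ m ih => rw [Finset.sum_range_succ, ih, Finset.sum_range_succ _ m]; ring

/-- For an upper set the difference of the two indicators vanishes or has the sign of `x - y`, so
one choice of sign is optimal for every `U`. -/
theorem IsUpperSet.ite_sub_mul_le {U : Set ℝ} (hU : IsUpperSet U) [DecidablePred (· ∈ U)]
    {x y η : ℝ} (hη : |η| ≤ 1) :
    ((if x ∈ U then (1 : ℝ) else 0) - if y ∈ U then (1 : ℝ) else 0) * η ≤
      ((if x ∈ U then (1 : ℝ) else 0) - if y ∈ U then (1 : ℝ) else 0) *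
        (if y ≤ x then 1 else -1) := by
  have h := abs_le.1 hη
  by_cases hx : x ∈ U <;> by_cases hy : y ∈ U <;> simp only [hx, hy, if_true, if_false] <;>
    split_ifs with hxy <;> try linarith
  · exact absurd (hU (not_le.1 hxy).le hx) hy
  · exact absurd (hU hxy hy) hx

/-- A finite layer cake argument. -/
theorem sum_monotone_mul_nonneg {ι : Type*} (s : Finset ι) (a F : ι → ℝ) (h0 : ∑ i ∈ s, F i = 0)
    (h : ∀ U : Set ℝ, IsUpperSet U → 0 ≤ ∑ i ∈ s, U.indicator (fun _ => (1 : ℝ)) (a i) * F i)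
    {f : ℝ → ℝ} (hf : Monotone f) : 0 ≤ ∑ i ∈ s, f (a i) * F i := by
  set M := ∑ i ∈ s, |f (a i)| with hM
  have hM0 : 0 ≤ M := Finset.sum_nonneg fun _ _ => abs_nonneg _
  have hfM : ∀ i ∈ s, |f (a i)| ≤ M := fun i hi =>
    Finset.single_le_sum (f := fun i => |f (a i)|) (fun _ _ => abs_nonneg _) hi
  set χ : ι → ℝ → ℝ := fun i => (Iio (f (a i))).indicator fun _ => 1 with hχ
  have hχi : ∀ i, IntervalIntegrable (χ i) volume (-M) M := fun i => by
    have h1 : IntervalIntegrable (fun _ => (1 : ℝ)) volume (-M) M := by simp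
    rw [intervalIntegrable_iff] at h1 ⊢
    exact h1.indicator measurableSet_Iio
  have h_int : ∀ i ∈ s, ∫ t in (-M)..M, χ i t = f (a i) + M := fun i hi => by
    have hb := abs_le.1 (hfM i hi)
    rw [intervalIntegral.integral_of_le (by linarith), integral_Ioc_eq_integral_Ioo]
    simp only [hχ]
    rw [setIntegral_indicator measurableSet_Iio, setIntegral_const, Ioo_inter_Iio,
      min_eq_right hb.2, Real.volume_real_Ioo_of_le hb.1]
    simp
  -- Adding `M` to `f` costs nothing because `F` sums to zero, and `f + M ≥ 0` is the integral over
  -- `t` of the indicators of `t < f`, whose sets are upper sets since `f` is monotone.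
  have e : ∑ i ∈ s, f (a i) * F i = ∫ t in (-M)..M, ∑ i ∈ s, χ i t * F i := by
    rw [intervalIntegral.integral_finsetSum fun i _ => (hχi i).mul_const _]
    calc ∑ i ∈ s, f (a i) * F i = ∑ i ∈ s, (f (a i) + M) * F i - M * ∑ i ∈ s, F i := by
          rw [Finset.mul_sum, ← Finset.sum_sub_distrib]
          exact Finset.sum_congr rfl fun i _ => by ring
      _ = ∑ i ∈ s, (f (a i) + M) * F i := by rw [h0]; ring
      _ = _ := Finset.sum_congr rfl fun i hi => by
          rw [intervalIntegral.integral_mul_const, h_int i hi]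
  rw [e]
  refine intervalIntegral.integral_nonneg (by linarith) fun t _ => ?_
  refine (h {x | t < f x} fun x y hxy hx => lt_of_lt_of_le hx (hf hxy)).trans (le_of_eq ?_)
  refine Finset.sum_congr rfl fun i _ => ?_
  congr 1

/-! ### Optimal nodal values and the fields they generate -/

namespace MetricGraph

set_option linter.unusedSectionVars false

variable {V E : Type*} [Fintype V] [Fintype E] (Γ : MetricGraph V E)

open Classical in
/-- Values at the nodes of the partition into cells that satisfy the constraints of admissible
fields. -/
def IsNodal (n : ℕ) (η : E → ℕ → ℝ) : Prop :=
  (∀ e, ∀ i ≤ n, |η e i| ≤ 1) ∧ ∀ v : V, ∑ e with (v = Γ.ini e ∨ v = Γ.ter e),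
    (if v = Γ.ter e then η e n else - η e 0) = 0

variable {Γ}

/-- The essential point is that `ζ` does not depend on `U`. The values at interior nodes are free in
`[-1, 1]`, and Kirchhoff's condition couples only the values at one vertex, so the maximization
splits node by node; each local optimum depends only on the order of the adjacent values of `a`. -/
theorem exists_optimal_nodal {n : ℕ} (hn : 0 < n) (a : E → ℕ → ℝ) :
    ∃ ζ, Γ.IsNodal n ζ ∧ ∀ η, Γ.IsNodal n η → ∀ U : Set ℝ, IsUpperSet U →
      cellSum n (fun e i => U.indicator (fun _ => (1 : ℝ)) (a e i) * (η e (i + 1) - η e i)) ≤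
      cellSum n (fun e i => U.indicator (fun _ => (1 : ℝ)) (a e i) * (ζ e (i + 1) - ζ e i)) := by
  classical
  obtain ⟨m, rfl⟩ : ∃ m, n = m + 1 := ⟨n - 1, by omega⟩
  choose wt h1 h2 h3 using fun v : V => exists_balanced_weights
    (fun e => if v = Γ.ter e then a e m else a e 0)
    (Finset.univ.filter fun e => v = Γ.ini e ∨ v = Γ.ter e)
  -- With `m + 1` cells the interior nodes are `1, …, m`. The minus sign at node `0` converts the
  -- balanced weight, which is an outward value, into a value along the orientation of the edge.
  set ζ : E → ℕ → ℝ := fun e i => if i = 0 then - wt (Γ.ini e) e else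
    if i = m + 1 then wt (Γ.ter e) e else if a e i ≤ a e (i - 1) then 1 else -1 with hζ
  have hζ0 : ∀ e, ζ e 0 = - wt (Γ.ini e) e := fun e => by simp [hζ]
  have hζn : ∀ e, ζ e (m + 1) = wt (Γ.ter e) e := fun e => by simp [hζ]
  have hζi : ∀ e, ∀ i < m, ζ e (i + 1) = if a e (i + 1) ≤ a e i then 1 else -1 := fun e i hi => by
    simp only [hζ]
    rw [if_neg (by omega), if_neg (by omega), Nat.add_sub_cancel]
  have hvert : ∀ v, ∀ e ∈ Finset.univ.filter fun e => v = Γ.ini e ∨ v = Γ.ter e,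
      (if v = Γ.ter e then ζ e (m + 1) else - ζ e 0) = wt v e := fun v e he => by
    split_ifs with hv
    · rw [hζn, ← hv]
    · rw [hζ0, neg_neg]
      rcases (Finset.mem_filter.1 he).2 with h | h
      · rw [← h]
      · exact absurd h hv
  refine ⟨ζ, ⟨fun e i _ => ?_, fun v => ?_⟩, fun η hη U hU => ?_⟩
  · simp only [hζ]; split_ifs
    · rw [abs_neg]; exact h1 _ _
    · exact h1 _ _
    · simp
    · simp
  · rw [← h2 v]; exact Finset.sum_congr rfl (hvert v)
  · have hind : ∀ x, U.indicator (fun _ => (1 : ℝ)) x = if x ∈ U then 1 else 0 := fun x => rfl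
    -- Summation by parts separates the vertex terms from the interior nodes.
    have hsplit : ∀ η : E → ℕ → ℝ,
        cellSum (m + 1) (fun e i => U.indicator (fun _ => (1 : ℝ)) (a e i) *
          (η e (i + 1) - η e i)) =
        ∑ v, ∑ e with v = Γ.ini e ∨ v = Γ.ter e,
          U.indicator (fun _ => (1 : ℝ)) (if v = Γ.ter e then a e m else a e 0) *
            (if v = Γ.ter e then η e (m + 1) else - η e 0) +
        ∑ e, ∑ i ∈ Finset.range m, (U.indicator (fun _ => (1 : ℝ)) (a e i) -
          U.indicator (fun _ => (1 : ℝ)) (a e (i + 1))) * η e (i + 1) := fun η => by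
      rw [sum_incident (Γ := Γ) (F := fun e v =>
        U.indicator (fun _ => (1 : ℝ)) (if v = Γ.ter e then a e m else a e 0) *
            (if v = Γ.ter e then η e (m + 1) else - η e 0)), ← Finset.sum_add_distrib]
      refine Finset.sum_congr rfl fun e _ => ?_
      rw [sum_mul_sub_eq (fun i => U.indicator (fun _ => (1 : ℝ)) (a e i)) (η e) m]
      simp only [if_neg (Γ.no_loops e), if_true]
      ring
    rw [hsplit, hsplit]
    refine add_le_add (Finset.sum_le_sum fun v _ => ?_)
      (Finset.sum_le_sum fun e _ => Finset.sum_le_sum fun i hi => ?_)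
    · have h4 := h3 v U hU (fun e => if v = Γ.ter e then η e (m + 1) else - η e 0)
        (fun e _ => by
          split_ifs
          · exact hη.1 e _ le_rfl
          · rw [abs_neg]; exact hη.1 e _ (Nat.zero_le _)) (hη.2 v)
      rw [Finset.sum_filter, Finset.sum_filter (s := Finset.univ.filter _)] at h4
      refine le_trans (le_of_eq ?_) (h4.trans (le_of_eq ?_))
      · refine Finset.sum_congr rfl fun e _ => ?_
        rw [hind, ite_mul, one_mul, zero_mul]
      · refine Finset.sum_congr rfl fun e he => ?_
        rw [hvert v e he, hind, ite_mul, one_mul, zero_mul]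
    · have hi' := Finset.mem_range.1 hi
      rw [hζi e i hi', hind, hind]
      exact hU.ite_sub_mul_le (hη.1 e (i + 1) (by omega))

theorem IsAdmissible.isNodal {n : ℕ} (hn : 0 < n) {z dz : E → ℝ → ℝ} (h : Γ.IsAdmissible z dz) :
    Γ.IsNodal n fun e i => z e (i * Γ.mesh n e) := by
  refine ⟨fun e i hi => h.abs_le_one e (node_mem hn e hi), fun v => ?_⟩
  simpa only [Nat.cast_zero, zero_mul, mul_mesh hn, vertexValue] using h.1.2 v

/-- Against piecewise constant functions a field counts only through its nodal values, so the dual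
problem becomes finite-dimensional. -/
theorem IsXK.cellIntegral_eq {n : ℕ} (hn : 0 < n) {z dz : E → ℝ → ℝ} (h : Γ.IsXK z dz) (e : E)
    {i : ℕ} (hi : i < n) :
    Γ.cellIntegral n dz e i = z e ((i + 1 : ℕ) * Γ.mesh n e) - z e (i * Γ.mesh n e) := by
  have h0 : (0 : ℝ) ∈ Icc 0 (Γ.len e) := left_mem_Icc.2 (Γ.len_pos e).le
  have hi1 := node_mem (Γ := Γ) hn e hi.le
  have hi2 := node_mem (Γ := Γ) hn e (i := i + 1) hi
  have hI := h.isL2_deriv.isL1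
  rw [h.eq_primitive e hi1, h.eq_primitive e hi2, cellIntegral,
    ← intervalIntegral.integral_add_adjacent_intervals (hI.intervalIntegrable e h0 hi1)
      (hI.intervalIntegrable e hi1 hi2)]
  ring

/-- Nodal values are those of an admissible field that is affine on every cell. -/
theorem IsNodal.exists_isAdmissible {n : ℕ} (hn : 0 < n) {ζ : E → ℕ → ℝ} (h : Γ.IsNodal n ζ) :
    ∃ z, Γ.IsAdmissible z (Γ.step n fun e i => (ζ e (i + 1) - ζ e i) / Γ.mesh n e) := by
  set s := Γ.step n fun e i => (ζ e (i + 1) - ζ e i) / Γ.mesh n e with hs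
  obtain ⟨M, hM⟩ := exists_step_bddBy (Γ := Γ) hn fun e i => (ζ e (i + 1) - ζ e i) / Γ.mesh n e
  refine ⟨_, isXK_primitive hM.isL2 (fun e => ζ e 0) fun v => ?_, fun e => ?_⟩
  · rw [← h.2 v]
    refine Finset.sum_congr rfl fun e _ => ?_
    have hδ := mesh_pos (Γ := Γ) hn e
    have := intervalIntegral_step_slope hδ (ζ e) (i := n) (x := Γ.len e)
      (by rw [← mul_mesh hn e]; exact ⟨le_rfl, by gcongr; omega⟩)
    rw [mul_mesh hn e, sub_self, zero_div, zero_mul, add_zero] at this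
    rw [setIntegral_edge, ← this]
    rfl
  · filter_upwards [ae_mem_edge e] with x hx
    refine abs_intervalIntegral_step_slope_le (mesh_pos hn e) hn (h.1 e) ?_
    rw [mul_mesh hn e]; exact Ioo_subset_Icc_self hx

/-! ### The Cheeger constant and a Poincaré inequality -/

theorem chi_nonneg (D : E → Set ℝ) (e : E) (x : ℝ) : 0 ≤ chi D e x :=
  indicator_nonneg (fun _ _ => zero_le_one) _

theorem chi_le_one (D : E → Set ℝ) (e : E) (x : ℝ) : chi D e x ≤ 1 :=
  indicator_le_self' (fun _ _ => zero_le_one) _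

theorem abs_chi_le_one (D : E → Set ℝ) (e : E) (x : ℝ) : |chi D e x| ≤ 1 := by
  rw [abs_of_nonneg (chi_nonneg D e x)]; exact chi_le_one D e x

theorem IsL1.chi_bddBy {D : E → Set ℝ} (h : Γ.IsL1 (chi D)) : Γ.BddBy (chi D) 1 := fun e =>
  ⟨(h e).1, Filter.Eventually.of_forall (abs_chi_le_one D e)⟩

theorem length_nonneg (D : E → Set ℝ) : 0 ≤ Γ.length D :=
  Finset.sum_nonneg fun _ _ => measureReal_nonneg

theorem nullMeasurableSet_of_isL1 {D : E → Set ℝ} (h : Γ.IsL1 (chi D)) (e : E) :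
    NullMeasurableSet (D e) (Γ.edgeMeasure e) := by
  have := (h e).1.aemeasurable
  exact (aemeasurable_indicator_const_iff (1 : ℝ)).1 this

theorem length_eq_integral {D : E → Set ℝ} (h : Γ.IsL1 (chi D)) :
    Γ.length D = Γ.integral (chi D) := by
  refine Finset.sum_congr rfl fun e _ => ?_
  have h1 : ∫ x in Γ.edge e, chi D e x = ∫ x in D e, (1 : ℝ) ∂(Γ.edgeMeasure e) :=
    integral_indicator₀ (nullMeasurableSet_of_isL1 h e)
  rw [h1, setIntegral_const, smul_eq_mul, mul_one,
    measureReal_restrict_apply₀ (nullMeasurableSet_of_isL1 h e)]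

theorem chi_compl {D : E → Set ℝ} {e : E} {x : ℝ} (hx : x ∈ Γ.edge e) :
    chi (Γ.compl D) e x = 1 - chi D e x := by
  by_cases h : x ∈ D e <;> simp [chi, compl, h, hx]

theorem isL1_chi_compl {D : E → Set ℝ} (h : Γ.IsL1 (chi D)) : Γ.IsL1 (chi (Γ.compl D)) := fun e => by
  refine ((integrable_const (1 : ℝ)).sub (h e)).congr ?_
  filter_upwards [ae_mem_edge e] with x hx
  rw [chi_compl hx]; rfl

theorem length_compl {D : E → Set ℝ} (h : Γ.IsL1 (chi D)) :
    Γ.length (Γ.compl D) = Γ.totalLength - Γ.length D := by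
  rw [length_eq_integral (isL1_chi_compl h), length_eq_integral h, ← one_mul Γ.totalLength,
    ← integral_const, ← integral_sub (isL1_const 1) h]
  refine integral_congr fun e => ?_
  filter_upwards [ae_mem_edge e] with x hx
  exact chi_compl hx

theorem cheeger_set_nonneg {r : ℝ} (h : ∃ D : E → Set ℝ, Γ.FinitePerimeter D ∧ 0 < Γ.length D ∧
    Γ.length D < Γ.totalLength ∧ r = Γ.Per D / min (Γ.length D) (Γ.length (Γ.compl D))) : 0 ≤ r := by
  obtain ⟨D, -, -, -, rfl⟩ := h
  exact div_nonneg (TV_nonneg _) (le_min (length_nonneg _) (length_nonneg _))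

theorem cheeger_nonneg (Γ : MetricGraph V E) : 0 ≤ Γ.cheeger :=
  Real.sInf_nonneg fun _ h => cheeger_set_nonneg h

theorem cheeger_le {D : E → Set ℝ} (hD : Γ.FinitePerimeter D) (h0 : 0 < Γ.length D)
    (h1 : Γ.length D < Γ.totalLength) :
    Γ.cheeger ≤ Γ.Per D / min (Γ.length D) (Γ.length (Γ.compl D)) :=
  csInf_le ⟨0, fun _ h => cheeger_set_nonneg h⟩ ⟨D, hD, h0, h1, rfl⟩

/-- When the minimum is zero the set does not compete for `h`, but the inequality is trivial; this
covers null and full superlevel sets. -/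
theorem DualBound.cheeger_mul_min_le {D : E → Set ℝ} {C : ℝ} (hD : Γ.IsL1 (chi D))
    (h : Γ.DualBound (chi D) C) :
    Γ.cheeger * min (Γ.length D) (Γ.length (Γ.compl D)) ≤ C := by
  rcases (le_min (length_nonneg D) (length_nonneg (Γ.compl D)) :
    0 ≤ min (Γ.length D) (Γ.length (Γ.compl D))).eq_or_lt with h0 | h0
  · rw [← h0, mul_zero]; exact h.nonneg
  · have h1 := (lt_min_iff.1 h0).1
    have h2 := (lt_min_iff.1 h0).2
    rw [length_compl hD] at h2
    have h3 := cheeger_le (h.isBV hD) h1 (by linarith)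
    rw [le_div_iff₀ h0] at h3
    exact h3.trans h.TV_le

/-- Since `ξ` has mean zero, its integral over `D` is minus that over the complement; each is
bounded using `|ξ| ≤ 1`. -/
theorem integral_chi_mul_le {D : E → Set ℝ} (hD : Γ.IsL1 (chi D)) {ξ : E → ℝ → ℝ}
    (hξ : Γ.BddBy ξ 1) (hξ0 : Γ.integral ξ = 0) :
    Γ.integral (fun e x => chi D e x * ξ e x) ≤ min (Γ.length D) (Γ.length (Γ.compl D)) := by
  have hm := hD.mul_bddBy hξ
  refine le_min ?_ ?_
  · rw [length_eq_integral hD]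
    refine integral_mono hm hD fun e => ?_
    filter_upwards [(hξ e).2] with x hx
    exact mul_le_of_le_one_right (chi_nonneg D e x) (abs_le.1 hx).2
  · rw [length_compl hD, length_eq_integral hD, ← one_mul Γ.totalLength,
      ← integral_const, ← integral_sub (isL1_const 1) hD,
      show (Γ.integral fun e x => chi D e x * ξ e x) =
        Γ.integral fun e x => chi D e x * ξ e x - ξ e x by
          rw [integral_sub hm hξ.isL1, hξ0, sub_zero]]
    refine integral_mono (hm.sub hξ.isL1) ((isL1_const 1).sub hD) fun e => ?_
    filter_upwards [(hξ e).2] with x hx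
    have h1 := chi_le_one D e x
    nlinarith [(abs_le.1 hx).1]

/-- On a partition into cells there is an admissible field that is optimal for all superlevel sets
of a piecewise constant function. -/
theorem exists_optimal_field {n : ℕ} (hn : 0 < n) (a : E → ℕ → ℝ) :
    ∃ z c, Γ.IsAdmissible z (Γ.step n c) ∧ ∀ y dy, Γ.IsAdmissible y dy →
      ∀ U : Set ℝ, IsUpperSet U →
        Γ.integral (fun e x => Γ.step n (fun e i => U.indicator (fun _ => (1 : ℝ)) (a e i)) e x *
          dy e x) ≤
        Γ.integral (fun e x => Γ.step n (fun e i => U.indicator (fun _ => (1 : ℝ)) (a e i)) e x *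
          Γ.step n c e x) := by
  obtain ⟨ζ, hζ, hopt⟩ := exists_optimal_nodal (Γ := Γ) hn a
  obtain ⟨z, hz⟩ := hζ.exists_isAdmissible hn
  refine ⟨z, _, hz, fun y dy hy U hU => ?_⟩
  rw [integral_step_mul hn _ hy.1.isL2_deriv.isL1, integral_step_mul hn _ hz.1.isL2_deriv.isL1]
  refine le_trans (le_of_eq ?_) ((hopt _ (hy.isNodal hn) U hU).trans (le_of_eq ?_))
  · refine Finset.sum_congr rfl fun e _ => Finset.sum_congr rfl fun i hi => ?_
    beta_reduce
    rw [hy.1.cellIntegral_eq hn e (Finset.mem_range.1 hi)]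
  · refine Finset.sum_congr rfl fun e _ => Finset.sum_congr rfl fun i hi => ?_
    beta_reduce
    rw [cellIntegral_step hn, div_mul_cancel₀ _ (mesh_pos hn e).ne']

/-- This is `sum_monotone_mul_nonneg` with the cells as index set and the integrals of `F` over
cells as weights. -/
theorem integral_step_monotone_mul_nonneg {n : ℕ} (hn : 0 < n) (a : E → ℕ → ℝ) {F : E → ℝ → ℝ}
    (hF : Γ.IsL1 F) (hF0 : Γ.integral F = 0)
    (h : ∀ U : Set ℝ, IsUpperSet U → 0 ≤ Γ.integral fun e x =>
      Γ.step n (fun e i => U.indicator (fun _ => (1 : ℝ)) (a e i)) e x * F e x)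
    {f : ℝ → ℝ} (hf : Monotone f) :
    0 ≤ Γ.integral fun e x => Γ.step n (fun e i => f (a e i)) e x * F e x := by
  have hprod : ∀ c : E → ℕ → ℝ, cellSum n c =
      ∑ p ∈ (Finset.univ : Finset E) ×ˢ Finset.range n, c p.1 p.2 := fun c =>
    (Finset.sum_product' _ _ _).symm
  rw [integral_step_mul hn _ hF, hprod]
  refine sum_monotone_mul_nonneg _ (fun p : E × ℕ => a p.1 p.2)
    (fun p => Γ.cellIntegral n F p.1 p.2) ?_ (fun U hU => ?_) hf
  · rw [← hprod (fun e i => Γ.cellIntegral n F e i), ← hF0]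
    have := integral_step_mul hn (fun _ _ => 1) hF
    simpa [step] using this.symm
  · have := h U hU
    rwa [integral_step_mul hn _ hF, hprod] at this

/-- The discrete version of `IsBV.integral_comp_add_le`. -/
theorem DualBound.integral_step_add_le {n : ℕ} (hn : 0 < n) {u : E → ℝ → ℝ} {C : ℝ}
    (hu : Γ.IsL1 u) (hC : Γ.DualBound u C) {f g : ℝ → ℝ} (hf : Monotone f) (hg : Monotone g)
    (hfg : ∀ x, f x + g x = x) {y dy : E → ℝ → ℝ} (hy : Γ.IsAdmissible y dy) {ξ : E → ℝ → ℝ}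
    (hξ : Γ.BddBy ξ 1) (hξ0 : Γ.integral ξ = 0) :
    Γ.integral (fun e x => f (Γ.step n (Γ.cellAvg n u) e x) * dy e x) +
      Γ.cheeger * Γ.integral (fun e x => g (Γ.step n (Γ.cellAvg n u) e x) * ξ e x) ≤ C := by
  set a := Γ.cellAvg n u with ha
  obtain ⟨z, c, hz, hopt⟩ := exists_optimal_field (Γ := Γ) hn a
  set dz := Γ.step n c with hdz
  have hdzL := hz.1.isL2_deriv.isL1
  have hdyL := hy.1.isL2_deriv.isL1
  have hsL : ∀ (b : E → ℕ → ℝ) {F : E → ℝ → ℝ}, Γ.IsL1 F →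
      Γ.IsL1 fun e x => Γ.step n b e x * F e x := fun b F hF => by
    obtain ⟨M, hM⟩ := exists_step_bddBy (Γ := Γ) hn b
    exact hM.mul_isL1 hF
  -- As `dz` is constant on cells, it does not distinguish `u` from its cell averages, so the bound
  -- `C` passes to the averages without loss.
  have h1 : Γ.integral (fun e x => u e x * dz e x) =
      Γ.integral fun e x => Γ.step n a e x * dz e x := by
    obtain ⟨M, hM⟩ := exists_step_bddBy (Γ := Γ) hn a
    have e1 : Γ.integral (fun e x => u e x * dz e x) =
        Γ.integral (fun e x => Γ.step n c e x * u e x) := by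
      congr 1; funext e x; rw [mul_comm]
    have e2 : Γ.integral (fun e x => Γ.step n a e x * dz e x) =
        Γ.integral (fun e x => Γ.step n c e x * Γ.step n a e x) := by
      congr 1; funext e x; rw [mul_comm]
    rw [e1, e2, integral_step_mul hn _ hu, integral_step_mul hn _ hM.isL1]
    refine Finset.sum_congr rfl fun e _ => Finset.sum_congr rfl fun i _ => ?_
    beta_reduce
    rw [cellIntegral_step hn, ha, cellAvg, div_mul_cancel₀ _ (mesh_pos hn e).ne']
  have h2 : 0 ≤ Γ.integral fun e x => Γ.step n (fun e i => f (a e i)) e x * (dz e x - dy e x) := by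
    refine integral_step_monotone_mul_nonneg hn a (hdzL.sub hdyL) ?_ (fun U hU => ?_) hf
    · rw [integral_sub hdzL hdyL, hz.1.integral_deriv, hy.1.integral_deriv, sub_self]
    · simp only [mul_sub]
      rw [integral_sub (hsL _ hdzL) (hsL _ hdyL), sub_nonneg]
      exact hopt y dy hy U hU
  -- Optimality of `z` on a superlevel set `D` makes its pairing with `χ_D` a dual bound for `χ_D`;
  -- the definition of `h` compares it with the length, hence with the integral of `ξ` over `D`.
  have h3 : 0 ≤ Γ.integral fun e x => Γ.step n (fun e i => g (a e i)) e x *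
      (dz e x - Γ.cheeger * ξ e x) := by
    have hξL := hξ.isL1.const_mul Γ.cheeger
    refine integral_step_monotone_mul_nonneg hn a (hdzL.sub hξL) ?_ (fun U hU => ?_) hg
    · rw [integral_sub hdzL hξL, integral_const_mul, hz.1.integral_deriv, hξ0, mul_zero, sub_self]
    · simp only [mul_sub]
      rw [integral_sub (hsL _ hdzL) (hsL _ hξL), sub_nonneg]
      set D : E → Set ℝ := fun e => {x | a e ⌊x / Γ.mesh n e⌋₊ ∈ U} with hD
      have hχ : Γ.step n (fun e i => U.indicator (fun _ => (1 : ℝ)) (a e i)) = chi D := by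
        rfl
      have hχL : Γ.IsL1 (chi D) := by
        obtain ⟨M, hM⟩ := exists_step_bddBy (Γ := Γ) hn
          fun e i => U.indicator (fun _ => (1 : ℝ)) (a e i)
        rw [← hχ]; exact hM.isL1
      have hb : Γ.DualBound (chi D) (Γ.integral fun e x => chi D e x * dz e x) :=
        fun y' dy' hy' => by rw [← hχ]; exact hopt y' dy' hy' U hU
      rw [hχ]
      refine le_trans ?_ (hb.cheeger_mul_min_le hχL)
      simp only [mul_left_comm _ Γ.cheeger]
      rw [integral_const_mul]
      exact mul_le_mul_of_nonneg_left (integral_chi_mul_le hχL hξ hξ0) (cheeger_nonneg Γ)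
  have h4 := hC z dz hz
  rw [h1] at h4
  have hfs : ∀ e x, f (Γ.step n a e x) = Γ.step n (fun e i => f (a e i)) e x := fun _ _ => rfl
  have hgs : ∀ e x, g (Γ.step n a e x) = Γ.step n (fun e i => g (a e i)) e x := fun _ _ => rfl
  have h5 : Γ.integral (fun e x => Γ.step n a e x * dz e x) =
      Γ.integral (fun e x => Γ.step n (fun e i => f (a e i)) e x * dz e x) +
      Γ.integral (fun e x => Γ.step n (fun e i => g (a e i)) e x * dz e x) := by
    rw [← integral_add (hsL _ hdzL) (hsL _ hdzL)]
    congr 1; funext e x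
    rw [← hfs, ← hgs, ← add_mul, hfg]
  simp only [mul_sub] at h2 h3
  rw [integral_sub (hsL _ hdzL) (hsL _ hdyL)] at h2
  rw [integral_sub (hsL _ hdzL) (hsL _ (hξ.isL1.const_mul _))] at h3
  simp only [mul_left_comm _ Γ.cheeger] at h3
  rw [integral_const_mul] at h3
  simp only [hfs, hgs]
  linarith

/-- Bounded `L¹`-convergence suffices for testing with square integrable functions. -/
theorem tendsto_integral_mul {w : ℕ → E → ℝ → ℝ} {v f : E → ℝ → ℝ} {K : ℝ}
    (hw : ∀ n, Γ.BddBy (w n) K) (hv : Γ.BddBy v K) (hf : Γ.IsL2 f)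
    (h : Filter.Tendsto (fun n => Γ.integral fun e x => |w n e x - v e x|) Filter.atTop (nhds 0)) :
    Filter.Tendsto (fun n => Γ.integral fun e x => w n e x * f e x) Filter.atTop
      (nhds (Γ.integral fun e x => v e x * f e x)) := by
  set Q := Γ.integral fun e x => f e x ^ 2 with hQ
  have hQL : Γ.IsL1 fun e x => f e x ^ 2 := fun e => (hf e).integrable_sq
  have hQ0 : 0 ≤ Q := integral_nonneg fun e x => sq_nonneg _
  have hsL : ∀ n, Γ.IsL1 fun e x => w n e x - v e x := fun n => (hw n).isL1.sub hv.isL1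
  -- Young's inequality with weight `ε`; boundedness reduces the square of `|w n - v|` to a multiple
  -- of its first power.
  have key : ∀ n, ∀ ε > 0, |(Γ.integral fun e x => w n e x * f e x) -
      Γ.integral fun e x => v e x * f e x| ≤
      (2 * K / ε) * (Γ.integral fun e x => |w n e x - v e x|) + ε * Q := fun n ε hε => by
    have h1 := (hw n).mul_isL1 hf.isL1
    have h2 := hv.mul_isL1 hf.isL1
    rw [← integral_sub h1 h2, hQ, ← integral_const_mul, ← integral_const_mul,
      ← integral_add ((hsL n).abs.const_mul _) (hQL.const_mul _)]
    refine (abs_integral_le _).trans (integral_mono (h1.sub h2).abs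
      (((hsL n).abs.const_mul _).add (hQL.const_mul _)) fun e => ?_)
    filter_upwards [(hw n e).2, (hv e).2] with x hx1 hx2
    rw [← sub_mul, abs_mul]
    set d := |w n e x - v e x| with hd
    have hd0 : 0 ≤ d := abs_nonneg _
    have hd1 : d ≤ 2 * K := (abs_sub _ _).trans (by linarith)
    have h3 : d * |f e x| ≤ d ^ 2 / ε + ε * f e x ^ 2 := by
      rw [← sq_abs (f e x)]
      have h4 : d * |f e x| * ε ≤ d ^ 2 + ε ^ 2 * |f e x| ^ 2 := by
        nlinarith [sq_nonneg (d - ε * |f e x|), sq_nonneg d, sq_nonneg (ε * |f e x|)]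
      have h5 : d ^ 2 / ε + ε * |f e x| ^ 2 = (d ^ 2 + ε ^ 2 * |f e x| ^ 2) / ε := by
        field_simp
      rw [h5, le_div_iff₀ hε]; exact h4
    have h6 : d ^ 2 / ε ≤ 2 * K / ε * d := by
      rw [sq, mul_div_right_comm]
      exact mul_le_mul_of_nonneg_right (by gcongr) hd0
    linarith
  rw [tendsto_iff_dist_tendsto_zero]
  simp only [Real.dist_eq]
  rw [Metric.tendsto_atTop]
  intro ε hε
  set δ := ε / (2 * (Q + 1)) with hδ
  have hδ0 : 0 < δ := by positivity
  have hlim := h.const_mul (2 * K / δ)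
  rw [mul_zero] at hlim
  obtain ⟨N, hN⟩ := Metric.tendsto_atTop.1 hlim (ε / 2) (by positivity)
  refine ⟨N, fun n hn => ?_⟩
  have h1 := hN n hn
  rw [Real.dist_eq, sub_zero] at h1 ⊢
  rw [abs_abs]
  have h2 := le_abs_self (2 * K / δ * Γ.integral fun e x => |w n e x - v e x|)
  have h3 : δ * Q ≤ ε / 2 := by
    have : δ * (Q + 1) = ε / 2 := by rw [hδ]; field_simp
    nlinarith
  linarith [key n δ hδ0]

theorem tendsto_integral_sub_step [Nonempty E] {u : E → ℝ → ℝ} {C : ℝ} (hu : Γ.IsL1 u)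
    (h : Γ.DualBound u C) :
    Filter.Tendsto (fun n : ℕ => Γ.integral fun e x =>
      |Γ.step (n + 1) (Γ.cellAvg (n + 1) u) e x - u e x|) Filter.atTop (nhds 0) := by
  have hlim : Filter.Tendsto (fun n : ℕ => 2 * Γ.totalLength / ((n + 1 : ℕ) : ℝ) * C)
      Filter.atTop (nhds 0) := by
    have h1 := (tendsto_const_div_atTop_nhds_zero_nat (2 * Γ.totalLength)).comp
      (Filter.tendsto_add_atTop_nat 1)
    simpa using h1.mul_const C
  refine squeeze_zero (fun n => integral_nonneg fun _ _ => abs_nonneg _) (fun n => ?_) hlim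
  have := h.integral_sub_step_le (n := n + 1) (Nat.succ_pos n) hu
  simpa only [abs_sub_comm] using this

/-- The total variation controls the sum of the variation of `f ∘ u` and, through the Cheeger
constant, the deviation of `g ∘ u` from its medians, when `f + g` is the identity. -/
theorem IsBV.integral_comp_add_le [Nonempty E] {u : E → ℝ → ℝ} (hu : Γ.IsBV u) {f g : ℝ → ℝ}
    (hf : Monotone f) (hg : Monotone g) (hfg : ∀ x, f x + g x = x) {y dy : E → ℝ → ℝ}
    (hy : Γ.IsAdmissible y dy) {ξ : E → ℝ → ℝ} (hξ : Γ.BddBy ξ 1) (hξ0 : Γ.integral ξ = 0) :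
    Γ.integral (fun e x => f (u e x) * dy e x) +
      Γ.cheeger * Γ.integral (fun e x => g (u e x) * ξ e x) ≤ Γ.TV u := by
  obtain ⟨M, hM0, hM⟩ := hu.exists_bddBy
  -- Two monotone functions whose sum is the identity are both `1`-Lipschitz, so composition
  -- preserves `L¹` convergence.
  have hlip : ∀ p q : ℝ → ℝ, Monotone p → Monotone q → (∀ x, p x + q x = x) →
      ∀ x x', |p x - p x'| ≤ |x - x'| := fun p q hp hq hpq x x' => by
    have e1 := hpq x
    have e2 := hpq x'
    rcases le_total x x' with hx | hx
    · have := hp hx; have := hq hx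
      rw [abs_of_nonpos (by linarith), abs_of_nonpos (by linarith)]; linarith
    · have := hp hx; have := hq hx
      rw [abs_of_nonneg (by linarith), abs_of_nonneg (by linarith)]; linarith
  have hstep : ∀ n : ℕ, Γ.BddBy (Γ.step (n + 1) (Γ.cellAvg (n + 1) u)) M := fun n =>
    step_bddBy (Nat.succ_pos n) fun e i hi => hM.cellAvg_le (Nat.succ_pos n) e hi
  have hcomp : ∀ p q : ℝ → ℝ, Monotone p → Monotone q → (∀ x, p x + q x = x) →
      ∀ F : E → ℝ → ℝ, Γ.IsL2 F → Filter.Tendsto (fun n : ℕ => Γ.integral fun e x =>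
        p (Γ.step (n + 1) (Γ.cellAvg (n + 1) u) e x) * F e x) Filter.atTop
        (nhds (Γ.integral fun e x => p (u e x) * F e x)) := fun p q hp hq hpq F hF => by
    have hbd : ∀ w : E → ℝ → ℝ, Γ.BddBy w M → Γ.BddBy (fun e x => p (w e x)) (M + |p 0|) :=
      fun w hw e => by
        refine ⟨(hp.measurable.comp_aemeasurable (hw e).1.aemeasurable).aestronglyMeasurable, ?_⟩
        filter_upwards [(hw e).2] with x hx
        have h1 := hlip p q hp hq hpq (w e x) 0
        rw [sub_zero] at h1
        have h2 := abs_sub_abs_le_abs_sub (p (w e x)) (p 0)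
        linarith
    refine tendsto_integral_mul (K := M + |p 0|) (fun n => hbd _ (hstep n))
      (hbd _ hM) hF ?_
    refine squeeze_zero (fun n => integral_nonneg fun _ _ => abs_nonneg _) (fun n => ?_)
      (tendsto_integral_sub_step hu.isL1 hu.dualBound)
    refine integral_mono ((hbd _ (hstep n)).isL1.sub (hbd _ hM).isL1).abs
      ((hstep n).isL1.sub hu.isL1).abs fun e => Filter.Eventually.of_forall fun x => ?_
    exact hlip p q hp hq hpq _ _
  have hgf : ∀ x, g x + f x = x := fun x => by rw [add_comm, hfg]
  refine le_of_tendsto ((hcomp f g hf hg hfg dy hy.1.isL2_deriv).add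
    ((hcomp g f hg hf hgf ξ hξ.isL2).const_mul Γ.cheeger)) (Filter.Eventually.of_forall fun n => ?_)
  exact hu.dualBound.integral_step_add_le (Nat.succ_pos n) hu.isL1 hf hg hfg hy hξ hξ0

/-- Poincaré's inequality, in dual form. -/
theorem IsBV.cheeger_mul_integral_le [Nonempty E] {u ξ : E → ℝ → ℝ} (hu : Γ.IsBV u)
    (hξ : Γ.BddBy ξ 1) (hξ0 : Γ.integral ξ = 0) :
    Γ.cheeger * Γ.integral (fun e x => u e x * ξ e x) ≤ Γ.TV u := by
  have := hu.integral_comp_add_le (f := fun _ => 0) (g := id) monotone_const monotone_id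
    (by simp) isAdmissible_zero hξ hξ0
  simpa [integral] using this

/-! ### Flows on the graph and a lower bound for the perimeter -/

-- Writes Kirchhoff's sum as a sum over all edges that is linear in the values at the ends, so that
-- flows can be superposed.
open Classical in
theorem sum_incident_ite (Γ : MetricGraph V E) (p q : E → ℝ) (v : V) :
    ∑ e with (v = Γ.ini e ∨ v = Γ.ter e), (if v = Γ.ter e then p e else - q e) =
      ∑ e, ((if v = Γ.ter e then p e else 0) - if v = Γ.ini e then q e else 0) := by
  rw [Finset.sum_filter]
  refine Finset.sum_congr rfl fun e _ => ?_
  by_cases h1 : v = Γ.ter e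
  · have h2 : v ≠ Γ.ini e := fun h => Γ.no_loops e (h.symm.trans h1)
    rw [if_pos (Or.inr h1), if_pos h1, if_pos h1, if_neg h2, sub_zero]
  · by_cases h2 : v = Γ.ini e
    · rw [if_pos (Or.inl h2), if_neg h1, if_neg h1, if_pos h2, zero_sub]
    · rw [if_neg (not_or.2 ⟨h2, h1⟩), if_neg h1, if_neg h2, sub_zero]

open Classical in
/-- Unit flows between any two vertices of the connected graph `Γ`. -/
theorem exists_unit_flow (Γ : MetricGraph V E) (r v : V) : ∃ a : E → ℝ, ∀ w : V,
    ∑ e, ((if w = Γ.ter e then a e else 0) - if w = Γ.ini e then a e else 0) =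
      (if w = v then 1 else 0) - if w = r then 1 else 0 := by
  have hr : (SimpleGraph.fromRel fun v w => ∃ e, Γ.ini e = v ∧ Γ.ter e = w).Reachable r v :=
    Γ.connected.preconnected r v
  rw [SimpleGraph.reachable_iff_reflTransGen] at hr
  induction hr with
  | refl => exact ⟨0, fun w => by simp⟩
  | @tail v v' _ hadj ih =>
    obtain ⟨a, ha⟩ := ih
    -- A path is prolonged by one edge; `σ` records whether it is traversed along its orientation.
    obtain ⟨e₀, σ, he⟩ : ∃ (e₀ : E) (σ : ℝ), ∀ w : V, σ * ((if w = Γ.ter e₀ then 1 else 0) -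
        if w = Γ.ini e₀ then 1 else 0) = (if w = v' then 1 else 0) - if w = v then 1 else 0 := by
      rw [SimpleGraph.fromRel_adj] at hadj
      rcases hadj.2 with ⟨e, rfl, rfl⟩ | ⟨e, rfl, rfl⟩
      · exact ⟨e, 1, fun w => by ring⟩
      · exact ⟨e, -1, fun w => by ring⟩
    refine ⟨fun e => a e + if e = e₀ then σ else 0, fun w => ?_⟩
    have h1 : ∀ e, ((if w = Γ.ter e then (a e + if e = e₀ then σ else 0) else 0) -
        if w = Γ.ini e then (a e + if e = e₀ then σ else 0) else 0) =
        ((if w = Γ.ter e then a e else 0) - if w = Γ.ini e then a e else 0) +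
        if e = e₀ then σ * ((if w = Γ.ter e then 1 else 0) - if w = Γ.ini e then 1 else 0) else 0 :=
      fun e => by split_ifs <;> ring
    simp only [h1]
    rw [Finset.sum_add_distrib, ha w, Finset.sum_ite_eq' Finset.univ e₀, if_pos (Finset.mem_univ _),
      he w]
    ring

/-- The divergence equation with Kirchhoff's condition can be solved with a bound in terms of the
`L¹`-norm of the right-hand side. -/
theorem exists_isXK_bound [Nonempty E] (Γ : MetricGraph V E) : ∃ C, 0 < C ∧ ∀ s : E → ℝ → ℝ,
    Γ.IsL2 s → Γ.integral s = 0 →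
    ∃ z, Γ.IsXK z s ∧ ∀ e, ∀ x ∈ Γ.edge e, |z e x| ≤ C * Γ.integral fun e x => |s e x| := by
  classical
  let r : V := Γ.ini (Classical.arbitrary E)
  choose a ha using exists_unit_flow Γ r
  refine ⟨(∑ v, ∑ e, |a v e|) + 1, by positivity, fun s hs hs0 => ?_⟩
  set S : E → ℝ := fun e => ∫ x in Γ.edge e, s e x with hS
  set N := Γ.integral fun e x => |s e x| with hN
  have hSN : ∑ e, |S e| ≤ N := Finset.sum_le_sum fun e _ => abs_integral_le_integral_abs
  set b : V → ℝ := fun v => ∑ e, if v = Γ.ter e then S e else 0 with hb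
  have hbN : ∀ v, |b v| ≤ N := fun v => by
    refine (Finset.abs_sum_le_sum_abs _ _).trans (le_trans (Finset.sum_le_sum fun e _ => ?_) hSN)
    split_ifs
    · exact le_rfl
    · simp
  have hb0 : ∑ v, b v = 0 := by
    simp only [hb]
    rw [Finset.sum_comm]
    refine (Finset.sum_congr rfl fun e _ => ?_).trans hs0
    rw [Finset.sum_ite_eq' Finset.univ (Γ.ter e), if_pos (Finset.mem_univ _)]
  -- Primitives starting from `0` leave the excess `b v` at each vertex. It is carried off by unit
  -- flows from the root `r`, whose contributions at `r` cancel because `b` sums to zero.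
  set A : E → ℝ := fun e => - ∑ v, b v * a v e with hA
  have hAN : ∀ e, |A e| ≤ (∑ v, ∑ e, |a v e|) * N := fun e => by
    simp only [hA]
    rw [abs_neg, Finset.sum_mul]
    refine (Finset.abs_sum_le_sum_abs _ _).trans (Finset.sum_le_sum fun v _ => ?_)
    rw [abs_mul, mul_comm]
    refine mul_le_mul ?_ (hbN v) (abs_nonneg _) (Finset.sum_nonneg fun _ _ => abs_nonneg _)
    exact Finset.single_le_sum (f := fun e => |a v e|) (fun _ _ => abs_nonneg _) (Finset.mem_univ e)
  have hdiv : ∀ w, ∑ e, ((if w = Γ.ter e then A e else 0) - if w = Γ.ini e then A e else 0) =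
      - b w := fun w => by
    have h1 : ∀ e, ((if w = Γ.ter e then A e else 0) - if w = Γ.ini e then A e else 0) =
        - ∑ v, b v * ((if w = Γ.ter e then a v e else 0) - if w = Γ.ini e then a v e else 0) :=
      fun e => by
        simp only [hA]
        split_ifs <;> simp
    simp only [h1]
    rw [Finset.sum_neg_distrib, Finset.sum_comm]
    simp only [← Finset.mul_sum, ha]
    simp only [mul_sub]
    rw [Finset.sum_sub_distrib, ← Finset.sum_mul, hb0]
    simp
  refine ⟨_, isXK_primitive hs A fun v => ?_, fun e x hx => ?_⟩
  · rw [sum_incident_ite Γ (fun e => A e + S e) A v]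
    have h2 : ∀ e, ((if v = Γ.ter e then A e + S e else 0) - if v = Γ.ini e then A e else 0) =
        ((if v = Γ.ter e then A e else 0) - if v = Γ.ini e then A e else 0) +
          if v = Γ.ter e then S e else 0 := fun e => by split_ifs <;> ring
    simp only [h2]
    rw [Finset.sum_add_distrib, hdiv v]
    simp [hb]
  · have h3 : |∫ y in (0 : ℝ)..x, s e y| ≤ N := by
      rw [intervalIntegral.integral_of_le hx.1.le]
      refine abs_integral_le_integral_abs.trans ?_
      refine le_trans (b := ∫ y in Γ.edge e, |s e y|) ?_ ?_
      · refine setIntegral_mono_set (hs.isL1 e).abs (Filter.Eventually.of_forall fun _ => abs_nonneg _)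
          (Filter.Eventually.of_forall fun y hy => ⟨hy.1, hy.2.trans_lt hx.2⟩)
      · exact Finset.single_le_sum (f := fun e => ∫ y in Γ.edge e, |s e y|)
          (fun e _ => MeasureTheory.integral_nonneg fun _ => abs_nonneg _) (Finset.mem_univ e)
    refine (abs_add_le _ _).trans ?_
    rw [add_mul, one_mul]
    exact add_le_add (hAN e) h3

/-- The perimeter of nontrivial sets is bounded below. -/
theorem exists_perimeter_bound [Nonempty E] (Γ : MetricGraph V E) : ∃ c, 0 < c ∧
    ∀ (D : E → Set ℝ) (P : ℝ), Γ.IsL1 (chi D) → 0 < Γ.length D → Γ.length D < Γ.totalLength →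
      Γ.DualBound (chi D) P → c ≤ P := by
  obtain ⟨C, hC, hflow⟩ := exists_isXK_bound Γ
  refine ⟨1 / (2 * C), by positivity, fun D P hD h0 h1 hP => ?_⟩
  set l := Γ.length D with hl
  set m := Γ.totalLength - l with hm
  have hm0 : 0 < m := by rw [hm]; linarith
  set κ := 1 / (2 * C) with hκ
  have hκ0 : 0 < κ := by positivity
  -- A source spread uniformly over `D` and a sink spread over the complement, each of total mass
  -- `κ`. The `L¹` norm is `2 * κ`, so the field is bounded by `1`, and pairing with `χ_D` gives `κ`
  -- whatever the length of `D`.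
  set s : E → ℝ → ℝ := fun e x => κ * (l⁻¹ * chi D e x - m⁻¹ * (1 - chi D e x)) with hs
  have hχ := hD.chi_bddBy
  have h1χ : Γ.IsL1 fun e x => 1 - chi D e x := (isL1_const 1).sub hD
  have hint1 : Γ.integral (fun e x => 1 - chi D e x) = m := by
    rw [integral_sub (isL1_const 1) hD, integral_const, ← length_eq_integral hD, one_mul]
  have hs2 : Γ.IsL2 s := fun e =>
    (((hχ.isL2 e).const_mul _).sub (((memLp_const (1 : ℝ)).sub (hχ.isL2 e)).const_mul _)).const_mul _
  have hs0 : Γ.integral s = 0 := by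
    simp only [hs]
    rw [integral_const_mul, integral_sub (hD.const_mul _) (h1χ.const_mul _), integral_const_mul,
      integral_const_mul, hint1, ← length_eq_integral hD, inv_mul_cancel₀ h0.ne',
      inv_mul_cancel₀ hm0.ne', sub_self, mul_zero]
  have hsN : (Γ.integral fun e x => |s e x|) ≤ κ * 2 := by
    have h2 : Γ.integral (fun e x => κ * (l⁻¹ * chi D e x + m⁻¹ * (1 - chi D e x))) = κ * 2 := by
      rw [integral_const_mul, integral_add (hD.const_mul _) (h1χ.const_mul _), integral_const_mul,
        integral_const_mul, hint1, ← length_eq_integral hD, inv_mul_cancel₀ h0.ne',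
        inv_mul_cancel₀ hm0.ne']
      norm_num
    rw [← h2]
    refine integral_mono hs2.isL1.abs (((hD.const_mul _).add (h1χ.const_mul _)).const_mul _)
      fun e => Filter.Eventually.of_forall fun x => ?_
    simp only [hs]
    rw [abs_mul, abs_of_pos hκ0]
    refine mul_le_mul_of_nonneg_left ?_ hκ0.le
    have a1 : 0 ≤ l⁻¹ * chi D e x := mul_nonneg (inv_pos.2 h0).le (chi_nonneg _ _ _)
    have a2 : 0 ≤ m⁻¹ * (1 - chi D e x) :=
      mul_nonneg (inv_pos.2 hm0).le (by linarith [chi_le_one D e x])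
    rw [abs_le]; constructor <;> linarith
  obtain ⟨z, hz, hzb⟩ := hflow s hs2 hs0
  have hadm : Γ.IsAdmissible z s := ⟨hz, fun e => by
    filter_upwards [ae_mem_edge e] with x hx
    refine (hzb e x hx).trans ?_
    calc C * _ ≤ C * (κ * 2) := by gcongr
      _ = 1 := by rw [hκ]; field_simp⟩
  refine le_trans (le_of_eq ?_) (hP z s hadm)
  have h3 : ∀ e x, chi D e x * s e x = (κ * l⁻¹) * chi D e x := fun e x => by
    simp only [hs]
    by_cases hx : x ∈ D e
    · simp [chi, hx]
    · simp [chi, hx]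
  simp only [h3]
  rw [integral_const_mul, ← length_eq_integral hD, mul_assoc, inv_mul_cancel₀ h0.ne', mul_one]

/-! ### Existence of a Cheeger cut -/

/-- Sets of positive length and finite perimeter exist. -/
theorem exists_finitePerimeter [Nonempty E] (Γ : MetricGraph V E) : ∃ D : E → Set ℝ,
    Γ.FinitePerimeter D ∧ 0 < Γ.length D ∧ Γ.length D < Γ.totalLength := by
  classical
  let e₀ : E := Classical.arbitrary E
  -- The set is the first half of one edge; the optimal field itself supplies a finite dual bound.
  let a : E → ℕ → ℝ := fun e i => if e = e₀ ∧ i = 0 then 1 else 0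
  obtain ⟨z, c, hz, hopt⟩ := exists_optimal_field (Γ := Γ) two_pos a
  set D : E → Set ℝ := fun e => {x | a e ⌊x / Γ.mesh 2 e⌋₊ ∈ Ioi (0 : ℝ)} with hD
  have hχ : Γ.step 2 (fun e i => (Ioi (0 : ℝ)).indicator (fun _ => (1 : ℝ)) (a e i)) = chi D := rfl
  have hχL : Γ.IsL1 (chi D) := by
    obtain ⟨M, hM⟩ := exists_step_bddBy (Γ := Γ) two_pos
      fun e i => (Ioi (0 : ℝ)).indicator (fun _ => (1 : ℝ)) (a e i)
    rw [← hχ]; exact hM.isL1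
  have hb : Γ.DualBound (chi D) (Γ.integral fun e x => chi D e x * Γ.step 2 c e x) :=
    fun y dy hy => by rw [← hχ]; exact hopt y dy hy _ (isUpperSet_Ioi 0)
  have hlen : Γ.length D = Γ.mesh 2 e₀ := by
    have h1 := integral_step_mul (Γ := Γ) two_pos
      (fun e i => (Ioi (0 : ℝ)).indicator (fun _ => (1 : ℝ)) (a e i)) (isL1_const 1)
    simp only [mul_one] at h1
    rw [length_eq_integral hχL, ← hχ]
    refine h1.trans ?_
    rw [cellSum, Finset.sum_eq_single e₀]
    · rw [Finset.sum_eq_single 0]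
      · simp [a, cellIntegral]
      · intro i _ hi; simp [a, hi]
      · simp
    · intro e _ he
      refine Finset.sum_eq_zero fun i _ => ?_
      simp [a, he]
    · simp
  have hpos := Γ.len_pos e₀
  refine ⟨D, hb.isBV hχL, ?_, ?_⟩
  · rw [hlen]; exact mesh_pos two_pos e₀
  · rw [hlen, mesh]
    have := len_le_totalLength (Γ := Γ) e₀
    push_cast
    linarith

/-- A bounded sequence in `BV` is relatively compact in `L¹`. -/
theorem exists_subseq_tendsto [Nonempty E] {w : ℕ → E → ℝ → ℝ} {C : ℝ} (hw : ∀ k, Γ.BddBy (w k) 1)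
    (hC : ∀ k, Γ.DualBound (w k) C) : ∃ (φ : ℕ → ℕ) (v : E → ℝ → ℝ), StrictMono φ ∧ Γ.IsL1 v ∧
      Filter.Tendsto (fun k => Γ.integral fun e x => |w (φ k) e x - v e x|)
        Filter.atTop (nhds 0) := by
  classical
  -- All cell averages on all partitions are collected in a compact product of intervals, which
  -- replaces a diagonal argument; indices beyond the last cell get the value `0`.
  let p : ℕ → (ℕ × E × ℕ) → ℝ := fun k q =>
    if q.2.2 < q.1 + 1 then Γ.cellAvg (q.1 + 1) (w k) q.2.1 q.2.2 else 0
  have hp : ∀ k, p k ∈ Set.pi univ fun _ : ℕ × E × ℕ => Icc (-1 : ℝ) 1 := fun k q _ => by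
    simp only [p]
    split_ifs with h
    · exact abs_le.1 ((hw k).cellAvg_le (Nat.succ_pos _) q.2.1 h)
    · simp
  obtain ⟨p₀, -, φ, hφ, hlim⟩ := (isCompact_univ_pi fun _ => isCompact_Icc).tendsto_subseq hp
  rw [tendsto_pi_nhds] at hlim
  have hsub : ∀ k l, Γ.IsL1 fun e x => w k e x - w l e x := fun k l => (hw k).isL1.sub (hw l).isL1
  -- On a fixed fine partition the averages converge, and the distance from each function to its
  -- averages is small uniformly in `k`.
  have hcau : ∀ ε > 0, ∃ N, ∀ k ≥ N, ∀ l ≥ N,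
      (Γ.integral fun e x => |w (φ k) e x - w (φ l) e x|) < ε := fun ε hε => by
    obtain ⟨n, hn⟩ : ∃ n : ℕ, 2 * Γ.totalLength / ((n + 1 : ℕ) : ℝ) * C < ε / 4 := by
      have h1 := ((tendsto_const_div_atTop_nhds_zero_nat (2 * Γ.totalLength)).comp
        (Filter.tendsto_add_atTop_nat 1)).mul_const C
      rw [zero_mul] at h1
      exact (h1.eventually (gt_mem_nhds (show (0 : ℝ) < ε / 4 by positivity))).exists
    have hn0 : 0 < n + 1 := Nat.succ_pos n
    set a : ℕ → E → ℕ → ℝ := fun k => Γ.cellAvg (n + 1) (w (φ k)) with ha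
    have hst : ∀ k, Γ.BddBy (Γ.step (n + 1) (a k)) 1 := fun k =>
      step_bddBy hn0 fun e i hi => (hw (φ k)).cellAvg_le hn0 e hi
    have hsum : ∀ k l, (Γ.integral fun e x => |Γ.step (n + 1) (a k) e x - Γ.step (n + 1) (a l) e x|)
        = cellSum (n + 1) fun e i => |a k e i - a l e i| * Γ.mesh (n + 1) e := fun k l => by
      have h1 := integral_step_mul (Γ := Γ) hn0 (fun e i => |a k e i - a l e i|) (isL1_const 1)
      simp only [mul_one] at h1
      refine h1.trans (Finset.sum_congr rfl fun e _ => Finset.sum_congr rfl fun i _ => ?_)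
      simp only [cellIntegral, intervalIntegral.integral_const, smul_eq_mul]
      push_cast; ring
    have hcell : ∀ e, ∀ i < n + 1, Filter.Tendsto (fun k => a k e i) Filter.atTop
        (nhds (p₀ (n, e, i))) := fun e i hi => by
      refine (hlim (n, e, i)).congr fun k => ?_
      simp only [Function.comp, p, if_pos hi, ha]
    have hlim2 : Filter.Tendsto (fun k => cellSum (n + 1) fun e i =>
        |a k e i - p₀ (n, e, i)| * Γ.mesh (n + 1) e) Filter.atTop (nhds 0) := by
      have : (0 : ℝ) = ∑ e : E, ∑ i ∈ Finset.range (n + 1),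
          |p₀ (n, e, i) - p₀ (n, e, i)| * Γ.mesh (n + 1) e := by simp
      rw [this]
      exact tendsto_finsetSum _ fun e _ => tendsto_finsetSum _ fun i hi =>
        (((hcell e i (Finset.mem_range.1 hi)).sub_const _).abs).mul_const _
    obtain ⟨N, hN⟩ := Filter.eventually_atTop.1
      (hlim2.eventually (gt_mem_nhds (show (0 : ℝ) < ε / 4 by positivity)))
    refine ⟨N, fun k hk l hl => ?_⟩
    have h1 := (hC (φ k)).integral_sub_step_le hn0 (hw _).isL1
    have h2 := (hC (φ l)).integral_sub_step_le hn0 (hw _).isL1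
    have h3 : cellSum (n + 1) (fun e i => |a k e i - a l e i| * Γ.mesh (n + 1) e) ≤
        cellSum (n + 1) (fun e i => |a k e i - p₀ (n, e, i)| * Γ.mesh (n + 1) e) +
        cellSum (n + 1) (fun e i => |a l e i - p₀ (n, e, i)| * Γ.mesh (n + 1) e) := by
      simp only [cellSum, ← Finset.sum_add_distrib, ← add_mul]
      refine Finset.sum_le_sum fun e _ => Finset.sum_le_sum fun i _ =>
        mul_le_mul_of_nonneg_right ?_ (mesh_pos hn0 e).le
      rw [abs_sub_comm (a l e i)]
      exact abs_sub_le _ _ _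
    have h4 : (Γ.integral fun e x => |w (φ k) e x - w (φ l) e x|) ≤
        (Γ.integral fun e x => |w (φ k) e x - Γ.step (n + 1) (a k) e x|) +
        (Γ.integral fun e x => |Γ.step (n + 1) (a k) e x - Γ.step (n + 1) (a l) e x|) +
        (Γ.integral fun e x => |w (φ l) e x - Γ.step (n + 1) (a l) e x|) := by
      have i1 := ((hw (φ k)).isL1.sub (hst k).isL1).abs
      have i2 := ((hst k).isL1.sub (hst l).isL1).abs
      have i3 := ((hw (φ l)).isL1.sub (hst l).isL1).abs
      rw [← integral_add i1 i2, ← integral_add (i1.add i2) i3]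
      refine integral_mono (hsub _ _).abs ((i1.add i2).add i3) fun e =>
        Filter.Eventually.of_forall fun x => ?_
      have j1 := abs_sub_le (w (φ k) e x) (Γ.step (n + 1) (a k) e x) (w (φ l) e x)
      have j2 := abs_sub_le (Γ.step (n + 1) (a k) e x) (Γ.step (n + 1) (a l) e x) (w (φ l) e x)
      rw [abs_sub_comm (Γ.step (n + 1) (a l) e x)] at j2
      linarith
    rw [hsum] at h4
    have h5 := hN k hk
    have h6 := hN l hl
    linarith
  have hedge : ∀ e, ∃ g : ℝ → ℝ, Integrable g (Γ.edgeMeasure e) ∧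
      Filter.Tendsto (fun k => ∫ x in Γ.edge e, |w (φ k) e x - g x|) Filter.atTop (nhds 0) :=
    fun e => by
      set F : ℕ → Lp ℝ 1 (Γ.edgeMeasure e) := fun k => ((hw (φ k)).isL1 e).toL1 _ with hF
      have hnorm : ∀ (f g : ℝ → ℝ) (hf : Integrable f (Γ.edgeMeasure e))
          (hg : Integrable g (Γ.edgeMeasure e)),
          dist (hf.toL1 f) (hg.toL1 g) = ∫ x in Γ.edge e, |f x - g x| := fun f g hf hg => by
        rw [dist_eq_norm, ← Integrable.toL1_sub, L1.norm_of_fun_eq_integral_norm]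
        rfl
      have hFc : CauchySeq F := Metric.cauchySeq_iff.2 fun ε hε => by
        obtain ⟨N, hN⟩ := hcau ε hε
        refine ⟨N, fun k hk l hl => lt_of_le_of_lt ?_ (hN k hk l hl)⟩
        rw [hF, hnorm]
        exact Finset.single_le_sum (f := fun e => ∫ x in Γ.edge e, |w (φ k) e x - w (φ l) e x|)
          (fun e _ => MeasureTheory.integral_nonneg fun _ => abs_nonneg _) (Finset.mem_univ e)
      obtain ⟨G, hG⟩ := cauchySeq_tendsto_of_complete hFc
      refine ⟨G, L1.integrable_coeFn G, ?_⟩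
      rw [tendsto_iff_dist_tendsto_zero] at hG
      refine hG.congr fun k => ?_
      conv_lhs => rw [← Integrable.toL1_coeFn G (L1.integrable_coeFn G)]
      exact hnorm _ _ _ _
  choose v hv hvlim using hedge
  refine ⟨φ, v, hφ, hv, ?_⟩
  have := tendsto_finsetSum (Finset.univ : Finset E) fun e _ => hvlim e
  simpa [integral] using this

/-- Only the upper bound for the perimeter is needed: the reverse inequality is the definition of
`h`, because `D` is not longer than its complement. -/
theorem isCheegerCut_of_dualBound {D : E → Set ℝ} (hD : Γ.IsL1 (chi D)) (h0 : 0 < Γ.length D)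
    (h1 : Γ.length D ≤ Γ.totalLength / 2)
    (h : Γ.DualBound (chi D) (Γ.cheeger * Γ.length D)) : Γ.IsCheegerCut D := by
  refine ⟨h.isBV hD, h0, h1, le_antisymm ?_ ?_⟩
  · rw [le_div_iff₀ h0]
    have := (h.isBV hD).dualBound.cheeger_mul_min_le hD
    rwa [min_eq_left (by rw [length_compl hD]; linarith)] at this
  · rw [div_le_iff₀ h0]; exact h.TV_le

theorem FinitePerimeter.isL1 {D : E → Set ℝ} (h : Γ.FinitePerimeter D) : Γ.IsL1 (chi D) :=
  IsBV.isL1 h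

/-- Almost optimal sets for the Cheeger constant. -/
theorem exists_almost_cheegerCut [Nonempty E] (Γ : MetricGraph V E) {ε : ℝ} (hε : 0 < ε) :
    ∃ D : E → Set ℝ, Γ.IsL1 (chi D) ∧ 0 < Γ.length D ∧ Γ.length D ≤ Γ.totalLength / 2 ∧
      Γ.DualBound (chi D) ((Γ.cheeger + ε) * Γ.length D) := by
  obtain ⟨D₀, hD₀⟩ := exists_finitePerimeter Γ
  obtain ⟨r, ⟨D, hD, h0, h1, rfl⟩, hr⟩ := exists_lt_of_csInf_lt
    (s := {r | ∃ D : E → Set ℝ, Γ.FinitePerimeter D ∧ 0 < Γ.length D ∧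
      Γ.length D < Γ.totalLength ∧ r = Γ.Per D / min (Γ.length D) (Γ.length (Γ.compl D))})
    ⟨_, D₀, hD₀.1, hD₀.2.1, hD₀.2.2, rfl⟩ (b := Γ.cheeger + ε)
    (show Γ.cheeger < Γ.cheeger + ε by linarith)
  have hDL := hD.isL1
  have hc := length_compl hDL
  have hmin : 0 < min (Γ.length D) (Γ.length (Γ.compl D)) := lt_min h0 (by rw [hc]; linarith)
  rw [div_lt_iff₀ hmin] at hr
  have hdb : Γ.DualBound (chi D) ((Γ.cheeger + ε) * min (Γ.length D) (Γ.length (Γ.compl D))) :=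
    fun z dz hz => (IsBV.dualBound hD z dz hz).trans hr.le
  rcases le_total (Γ.length D) (Γ.length (Γ.compl D)) with hle | hle
  · rw [min_eq_left hle] at hdb
    exact ⟨D, hDL, h0, by rw [hc] at hle; linarith, hdb⟩
  · rw [min_eq_right hle] at hdb
    -- The complement has indicator `1 - χ_D`; a change of sign and an added constant leave dual
    -- bounds unchanged.
    refine ⟨Γ.compl D, isL1_chi_compl hDL, by rw [hc]; linarith, by rw [hc] at hle ⊢; linarith, ?_⟩
    refine (hdb.neg.add_const (M := 1) (fun e => ?_) 1).congr fun e => ?_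
    · refine ⟨(hDL e).1.neg, Filter.Eventually.of_forall fun x => ?_⟩
      rw [abs_neg]; exact abs_chi_le_one D e x
    · filter_upwards [ae_mem_edge e] with x hx
      rw [chi_compl hx]; ring

theorem exists_isCheegerCut [Nonempty E] (Γ : MetricGraph V E) : ∃ D, Γ.IsCheegerCut D := by
  have hT := totalLength_pos Γ
  have hh := cheeger_nonneg Γ
  choose D hDL hD0 hD1 hDb using fun k : ℕ =>
    exists_almost_cheegerCut Γ (ε := 1 / ((k : ℝ) + 1)) (by positivity)
  have hk1 : ∀ k : ℕ, 1 / ((k : ℝ) + 1) ≤ 1 := fun k => by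
    rw [div_le_one (by positivity)]; linarith [Nat.cast_nonneg (α := ℝ) k]
  obtain ⟨c, hc0, hc⟩ := exists_perimeter_bound Γ
  -- The perimeters are at least `c` and at most `(h + 1) ℓ(D k)`, so no length is lost in the
  -- limit.
  have hlow : ∀ k, c / (Γ.cheeger + 1) ≤ Γ.length (D k) := fun k => by
    have h1 := hc (D k) _ (hDL k) (hD0 k) (by linarith [hD1 k]) (hDb k)
    rw [div_le_iff₀ (by linarith)]
    refine h1.trans ?_
    rw [mul_comm]
    exact mul_le_mul_of_nonneg_left (by linarith [hk1 k]) (hD0 k).le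
  obtain ⟨φ, v, hφ, hv, hlim⟩ := exists_subseq_tendsto (Γ := Γ) (w := fun k => chi (D k))
    (C := (Γ.cheeger + 1) * Γ.totalLength) (fun k => (hDL k).chi_bddBy) fun k z dz hz => by
      refine (hDb k z dz hz).trans (mul_le_mul (by linarith [hk1 k]) (by linarith [hD1 k])
        (hD0 k).le (by linarith))
  -- The distance to `{0, 1}`; its integral vanishes in the limit, so `v` is almost everywhere an
  -- indicator.
  set m : ℝ → ℝ := fun y => min |y| |1 - y| with hm
  have hmL : Γ.IsL1 fun e x => m (v e x) := fun e =>
    (hv e).abs.inf ((integrable_const (1 : ℝ)).sub (hv e)).abs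
  have hm0 : Γ.integral (fun e x => m (v e x)) ≤ 0 := by
    refine ge_of_tendsto hlim (Filter.Eventually.of_forall fun k => ?_)
    refine integral_mono hmL ((hDL _).sub hv).abs fun e => Filter.Eventually.of_forall fun x => ?_
    by_cases hx : x ∈ D (φ k) e
    · simp only [chi, indicator_of_mem hx, Pi.one_apply]; exact min_le_right _ _
    · simp only [chi, indicator_of_notMem hx, zero_sub, abs_neg]; exact min_le_left _ _
  have hmn : ∀ y, 0 ≤ m y := fun y => le_min (abs_nonneg _) (abs_nonneg _)
  have hmz : ∀ e, ∀ᵐ x ∂(Γ.edgeMeasure e), m (v e x) = 0 := fun e => by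
    have h1 : ∫ x in Γ.edge e, m (v e x) = 0 := by
      refine le_antisymm (le_trans ?_ hm0) (MeasureTheory.integral_nonneg fun _ => hmn _)
      exact Finset.single_le_sum (f := fun e => ∫ x in Γ.edge e, m (v e x))
        (fun e _ => MeasureTheory.integral_nonneg fun _ => hmn _) (Finset.mem_univ e)
    exact (integral_eq_zero_iff_of_nonneg (fun _ => hmn _) (hmL e)).1 h1
  set D' : E → Set ℝ := fun e => {x | 1 / 2 < v e x} with hD'
  have hχ : ∀ e, ∀ᵐ x ∂(Γ.edgeMeasure e), v e x = chi D' e x := fun e => by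
    filter_upwards [hmz e] with x hx
    have h1 : v e x = 0 ∨ v e x = 1 := by
      rcases min_choice |v e x| |1 - v e x| with h | h
      · left; rw [hm] at hx; exact abs_eq_zero.1 (h.symm.trans hx)
      · right; rw [hm] at hx; linarith [abs_eq_zero.1 (h.symm.trans hx)]
    rcases h1 with h1 | h1
    · have : x ∉ D' e := fun h => by
        have h' : 1 / 2 < v e x := h
        rw [h1] at h'; norm_num at h'
      rw [h1, chi, indicator_of_notMem this]
    · have : x ∈ D' e := by
        change 1 / 2 < v e x
        rw [h1]; norm_num
      rw [h1, chi, indicator_of_mem this, Pi.one_apply]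
  have hDL' : Γ.IsL1 (chi D') := fun e => (hv e).congr (hχ e)
  have hlim' : Filter.Tendsto (fun k => Γ.integral fun e x => |chi (D (φ k)) e x - chi D' e x|)
      Filter.atTop (nhds 0) := by
    refine hlim.congr fun k => integral_congr fun e => ?_
    filter_upwards [hχ e] with x hx
    rw [hx]
  have htest : ∀ f, Γ.IsL2 f → Filter.Tendsto
      (fun k => Γ.integral fun e x => chi (D (φ k)) e x * f e x) Filter.atTop
      (nhds (Γ.integral fun e x => chi D' e x * f e x)) := fun f hf =>
    tendsto_integral_mul (K := 1) (fun k => (hDL _).chi_bddBy) hDL'.chi_bddBy hf hlim'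
  have hlen : Filter.Tendsto (fun k => Γ.length (D (φ k))) Filter.atTop (nhds (Γ.length D')) := by
    have := htest (fun _ _ => 1) (fun e => memLp_const 1)
    simp only [mul_one] at this
    rw [length_eq_integral hDL']
    exact this.congr fun k => (length_eq_integral (hDL _)).symm
  refine ⟨D', isCheegerCut_of_dualBound hDL' ?_ ?_ fun z dz hz => ?_⟩
  · refine lt_of_lt_of_le (by positivity : 0 < c / (Γ.cheeger + 1))
      (ge_of_tendsto hlen (Filter.Eventually.of_forall fun k => hlow _))
  · exact le_of_tendsto hlen (Filter.Eventually.of_forall fun k => hD1 _)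
  · have h2 : Filter.Tendsto (fun k => (Γ.cheeger + 1 / ((φ k : ℝ) + 1)) * Γ.length (D (φ k)))
        Filter.atTop (nhds ((Γ.cheeger + 0) * Γ.length D')) :=
      ((tendsto_one_div_add_atTop_nhds_zero_nat.comp hφ.tendsto_atTop).const_add _).mul hlen
    rw [add_zero] at h2
    exact le_of_tendsto_of_tendsto' (htest dz hz.1.isL2_deriv) h2 fun k => hDb _ z dz hz

theorem cheeger_pos [Nonempty E] (Γ : MetricGraph V E) : 0 < Γ.cheeger := by
  obtain ⟨D, hD, h0, h1, h2⟩ := exists_isCheegerCut Γ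
  obtain ⟨c, hc0, hc⟩ := exists_perimeter_bound Γ
  rw [h2]
  refine div_pos (hc0.trans_le (hc D _ hD.isL1 h0 ?_ (IsBV.dualBound hD))) h0
  linarith [totalLength_pos Γ]

/-! ### Eigenpairs -/

theorem energy_of_isBV {u : E → ℝ → ℝ} (h : Γ.IsBV u) : Γ.energy u = ((Γ.TV u : ℝ) : EReal) :=
  if_pos h

/-- The function of unit mass associated with a Cheeger cut has total variation `h(Γ)`. -/
theorem IsCheegerCut.dualBound {D : E → Set ℝ} (h : Γ.IsCheegerCut D) :
    Γ.DualBound (fun e x => 1 / Γ.length D * chi D e x) Γ.cheeger := by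
  obtain ⟨hD, h0, h1, h2⟩ := h
  have := (IsBV.dualBound hD).const_mul (c := 1 / Γ.length D) (by positivity)
  rwa [one_div, mul_comm _ (Γ.TV _), ← div_eq_mul_inv, show Γ.TV (chi D) = Γ.Per D from rfl, ← h2,
    ← one_div] at this

theorem IsCheegerCut.norm1_eq {D : E → Set ℝ} (h : Γ.IsCheegerCut D) :
    Γ.norm1 (fun e x => 1 / Γ.length D * chi D e x) = 1 := by
  obtain ⟨hD, h0, h1, h2⟩ := h
  have : ∀ e x, |1 / Γ.length D * chi D e x| = 1 / Γ.length D * chi D e x := fun e x =>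
    abs_of_nonneg (mul_nonneg (by positivity) (chi_nonneg _ _ _))
  simp only [norm1, this]
  rw [integral_const_mul, ← length_eq_integral hD.isL1, one_div, inv_mul_cancel₀ h0.ne']

/-- With a mean-zero sign `ξ`, Poincaré's inequality bounds `h ∫ w ξ` by `TV(w)` for every `w` in
`BV`, with equality for the normalized indicator; this is the subgradient inequality. -/
theorem IsCheegerCut.isEigenpair [Nonempty E] {D : E → Set ℝ} (h : Γ.IsCheegerCut D) :
    Γ.IsEigenpair Γ.cheeger fun e x => 1 / Γ.length D * chi D e x := by
  have hdb := h.dualBound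
  have hn := h.norm1_eq
  obtain ⟨hD, h0, h1, -⟩ := h
  have hT := totalLength_pos Γ
  have hDL := hD.isL1
  have hχ := hDL.chi_bddBy
  set l := Γ.length D with hl
  have huL : Γ.IsL1 fun e x => 1 / l * chi D e x := hDL.const_mul _
  have hu2 : Γ.IsL2 fun e x => 1 / l * chi D e x := fun e => (hχ.isL2 e).const_mul _
  have huBV := hdb.isBV huL
  -- The value off `D` that gives `ξ` mean zero; it is at most `1` because `D` has at most half the
  -- total length.
  set κ := l / (Γ.totalLength - l) with hκ
  have hm0 : 0 < Γ.totalLength - l := by linarith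
  have hκ0 : 0 ≤ κ := by positivity
  have hκ1 : κ ≤ 1 := by rw [hκ, div_le_one hm0]; linarith
  set ξ : E → ℝ → ℝ := fun e x => chi D e x - κ * (1 - chi D e x) with hξ
  have h1χ : Γ.IsL1 fun e x => 1 - chi D e x := (isL1_const 1).sub hDL
  have hξin : ∀ e x, x ∈ D e → ξ e x = 1 := fun e x hx => by simp [hξ, chi, hx]
  have hξout : ∀ e x, x ∉ D e → ξ e x = - κ := fun e x hx => by simp [hξ, chi, hx]
  have hξb : Γ.BddBy ξ 1 := fun e => by
    refine ⟨(hDL.sub (h1χ.const_mul κ) e).1, Filter.Eventually.of_forall fun x => ?_⟩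
    by_cases hx : x ∈ D e
    · rw [hξin e x hx, abs_one]
    · rw [hξout e x hx, abs_neg, abs_of_nonneg hκ0]; exact hκ1
  have hξ0 : Γ.integral ξ = 0 := by
    simp only [hξ]
    rw [integral_sub hDL (h1χ.const_mul κ), integral_const_mul, integral_sub (isL1_const 1) hDL,
      integral_const, ← length_eq_integral hDL, ← hl, one_mul, hκ, div_mul_cancel₀ _ hm0.ne',
      sub_self]
  refine ⟨huBV, hn, ξ, fun e x _ => ?_, hu2, fun e => (hξb.isL2 e).const_mul _, fun w hw => ?_⟩
  · beta_reduce
    by_cases hx : x ∈ D e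
    · have : 0 < 1 / l * chi D e x := by simp [chi, hx, h0]
      rw [hξin e x hx, signSet, if_pos this]; rfl
    · have : 1 / l * chi D e x = 0 := by simp [chi, hx]
      rw [hξout e x hx, this, signSet, if_neg (lt_irrefl _), if_neg (lt_irrefl _)]
      exact ⟨by linarith, by linarith⟩
  · by_cases hwBV : Γ.IsBV w
    · rw [energy_of_isBV huBV, energy_of_isBV hwBV, ← EReal.coe_add, EReal.coe_le_coe_iff]
      have h3 := hwBV.cheeger_mul_integral_le hξb hξ0
      have h4 := hdb.TV_le
      have h5 : Γ.integral (fun e x => Γ.cheeger * ξ e x * (w e x - 1 / l * chi D e x)) =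
          Γ.cheeger * Γ.integral (fun e x => w e x * ξ e x) - Γ.cheeger := by
        have h6 : ∀ e x, Γ.cheeger * ξ e x * (w e x - 1 / l * chi D e x) =
            Γ.cheeger * (w e x * ξ e x - 1 / l * chi D e x) := fun e x => by
          by_cases hx : x ∈ D e
          · rw [hξin e x hx]; ring
          · simp only [chi, indicator_of_notMem hx]; ring
        simp only [h6]
        rw [integral_const_mul, integral_sub (hw.isL1.mul_bddBy hξb) huL, integral_const_mul,
          ← length_eq_integral hDL, ← hl, one_div, inv_mul_cancel₀ h0.ne']
        ring
      rw [h5]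
      linarith
    · rw [energy, energy, if_neg hwBV]
      exact le_top

theorem abs_le_one_of_mem_signSet {a b : ℝ} (h : b ∈ signSet a) : |b| ≤ 1 := by
  unfold signSet at h
  split_ifs at h
  · rw [mem_singleton_iff.1 h]; simp
  · rw [mem_singleton_iff.1 h]; simp
  · exact abs_le.2 h

theorem mul_eq_abs_of_mem_signSet {a b : ℝ} (h : b ∈ signSet a) : a * b = |a| := by
  unfold signSet at h
  split_ifs at h with h1 h2
  · rw [mem_singleton_iff.1 h, abs_of_pos h1, mul_one]
  · rw [mem_singleton_iff.1 h, abs_of_neg h2, mul_neg_one]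
  · have : a = 0 := le_antisymm (not_lt.1 h1) (not_lt.1 h2)
    simp [this]

/-- Nonzero eigenvalues are at least `h(Γ)`. -/
theorem IsEigenpair.cheeger_le [Nonempty E] {lam : ℝ} {u : E → ℝ → ℝ} (h : Γ.IsEigenpair lam u)
    (hlam : lam ≠ 0) : Γ.cheeger ≤ lam := by
  obtain ⟨hu, hn, ξ, hξs, hu2, hξ2, hsub⟩ := h
  obtain ⟨M, -, hM⟩ := hu.exists_bddBy
  have hξb : Γ.BddBy ξ 1 := fun e => by
    refine ⟨?_, ?_⟩
    · refine ((hξ2 e).1.const_mul lam⁻¹).congr (Filter.Eventually.of_forall fun x => ?_)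
      simp only [inv_mul_cancel_left₀ hlam]
    · filter_upwards [ae_mem_edge e] with x hx
      exact abs_le_one_of_mem_signSet (hξs e x hx)
  have huξ : Γ.integral (fun e x => u e x * ξ e x) = 1 := by
    rw [← hn, norm1]
    refine integral_congr fun e => ?_
    filter_upwards [ae_mem_edge e] with x hx
    exact mul_eq_abs_of_mem_signSet (hξs e x hx)
  have hineq : ∀ (w : E → ℝ → ℝ) (C : ℝ), Γ.IsL2 w → Γ.DualBound w C →
      Γ.TV u + Γ.integral (fun e x => lam * ξ e x * (w e x - u e x)) ≤ C := fun w C hw hC => by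
    have h1 := hsub w hw
    rw [energy_of_isBV hu, energy_of_isBV (hC.isBV hw.isL1), ← EReal.coe_add,
      EReal.coe_le_coe_iff] at h1
    exact h1.trans hC.TV_le
  -- The competitors `2u` and `0` give the two inequalities in `TV(u) = λ`; adding constants of
  -- either sign then forces `∫ ξ = 0`.
  have h1 := hineq (fun e x => 2 * u e x) (2 * Γ.TV u) (fun e => (hu2 e).const_mul 2)
    (hu.dualBound.const_mul zero_le_two)
  have h2 := hineq (fun _ _ => 0) 0 (fun e => memLp_const 0) fun z dz hz => by simp [integral]
  have e1 : ∀ e x, lam * ξ e x * (2 * u e x - u e x) = lam * (u e x * ξ e x) := fun e x => by ring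
  have e2 : ∀ e x, lam * ξ e x * (0 - u e x) = (-lam) * (u e x * ξ e x) := fun e x => by ring
  simp only [e1, e2] at h1 h2
  rw [integral_const_mul, huξ] at h1 h2
  have hTV : Γ.TV u = lam := by linarith
  have hconst : ∀ c : ℝ, lam * (c * Γ.integral ξ) ≤ 0 := fun c => by
    have h3 := hineq (fun e x => u e x + c) (Γ.TV u) (fun e => (hu2 e).add (memLp_const c))
      (hu.dualBound.add_const hM c)
    have e3 : ∀ e x, lam * ξ e x * (u e x + c - u e x) = lam * (c * ξ e x) := fun e x => by ring
    simp only [e3] at h3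
    rw [integral_const_mul, integral_const_mul] at h3
    linarith
  have hξ0 : Γ.integral ξ = 0 := by
    have h4 := hconst 1
    have h5 := hconst (-1)
    have h6 : lam * Γ.integral ξ = 0 := by linarith
    exact (mul_eq_zero.1 h6).resolve_left hlam
  have := hu.cheeger_mul_integral_le hξb hξ0
  rwa [huξ, mul_one, hTV] at this

/-! ### Minimizers -/

theorem isL1_chi_superlevel {u : E → ℝ → ℝ} (hu : Γ.IsL1 u) (t : ℝ) :
    Γ.IsL1 (chi (Γ.superlevel u t)) := fun e => by
  have h1 : AEMeasurable (fun x => (Ioi t).indicator (fun _ => (1 : ℝ)) (u e x))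
      (Γ.edgeMeasure e) :=
    (measurable_const.indicator measurableSet_Ioi).comp_aemeasurable (hu e).1.aemeasurable
  refine Integrable.of_bound (C := 1) (h1.aestronglyMeasurable.congr ?_)
    (Filter.Eventually.of_forall (abs_chi_le_one _ e))
  filter_upwards [ae_mem_edge e] with x hx
  by_cases h : t < u e x <;> simp [chi, superlevel, h, hx]

theorem superlevel_neg (u : E → ℝ → ℝ) : Γ.superlevel (-u) 0 = Γ.sublevel u 0 := by
  funext e; ext x; simp [superlevel, sublevel]

theorem sublevel_neg (u : E → ℝ → ℝ) : Γ.sublevel (-u) 0 = Γ.superlevel u 0 := by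
  funext e; ext x; simp [superlevel, sublevel]

/-- If `0` is a median of `u`, then the multivalued sign of `u` has a selection of mean zero. -/
theorem IsMedian.exists_sign {u : E → ℝ → ℝ} (hu : Γ.IsL1 u) (h : Γ.IsMedian u 0) :
    ∃ ξ, Γ.BddBy ξ 1 ∧ Γ.integral ξ = 0 ∧ ∀ e, ∀ x ∈ Γ.edge e, ξ e x ∈ signSet (u e x) := by
  have hP := isL1_chi_superlevel (Γ := Γ) hu 0
  have hN : Γ.IsL1 (chi (Γ.sublevel u 0)) := by
    rw [← superlevel_neg]
    exact isL1_chi_superlevel (fun e => (hu e).neg) 0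
  obtain ⟨hn, hp⟩ := h
  set P := Γ.superlevel u 0 with hPdef
  set N := Γ.sublevel u 0 with hNdef
  set p := Γ.length P with hp'
  set n := Γ.length N with hn'
  set T := Γ.totalLength with hT
  -- The constant on `{u = 0}` that gives mean zero. The median property says `2n ≤ T` and `2p ≤ T`,
  -- hence `|κ| ≤ 1`; if `{u = 0}` is null, then `n = p` and the default value of the quotient is
  -- harmless.
  set κ := (n - p) / (T - p - n) with hκ
  have hκm : κ * (T - p - n) = n - p := by
    rcases eq_or_ne (T - p - n) 0 with h0 | h0
    · rw [h0, mul_zero]; linarith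
    · rw [hκ, div_mul_cancel₀ _ h0]
  have hκ1 : |κ| ≤ 1 := by
    have h0 : 0 ≤ T - p - n := by linarith
    rw [hκ, abs_div, abs_of_nonneg h0]
    refine div_le_one_of_le₀ (abs_le.2 ⟨by linarith, by linarith⟩) h0
  set ξ : E → ℝ → ℝ := fun e x => chi P e x - chi N e x + κ * (1 - chi P e x - chi N e x) with hξ
  have hL1 : Γ.IsL1 fun e x => 1 - chi P e x - chi N e x := ((isL1_const 1).sub hP).sub hN
  have hmem : ∀ e, ∀ x ∈ Γ.edge e, ξ e x ∈ signSet (u e x) := fun e x hx => by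
    rcases lt_trichotomy (u e x) 0 with h0 | h0 | h0
    · have h1 : x ∉ P e := fun h => absurd h.2 (not_lt.2 h0.le)
      have h2 : x ∈ N e := ⟨hx, h0⟩
      rw [signSet, if_neg (not_lt.2 h0.le), if_pos h0]
      simp [hξ, chi, h1, h2]
    · have h1 : x ∉ P e := fun h => by have := h.2; rw [h0] at this; exact lt_irrefl _ this
      have h2 : x ∉ N e := fun h => by have := h.2; rw [h0] at this; exact lt_irrefl _ this
      rw [signSet, h0, if_neg (lt_irrefl _), if_neg (lt_irrefl _)]
      simpa [hξ, chi, h1, h2] using abs_le.1 hκ1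
    · have h1 : x ∈ P e := ⟨hx, h0⟩
      have h2 : x ∉ N e := fun h => absurd h.2 (not_lt.2 h0.le)
      rw [signSet, if_pos h0]
      simp [hξ, chi, h1, h2]
  refine ⟨ξ, fun e => ⟨((hP.sub hN).add (hL1.const_mul κ) e).1, ?_⟩, ?_, hmem⟩
  · filter_upwards [ae_mem_edge e] with x hx
    exact abs_le_one_of_mem_signSet (hmem e x hx)
  · simp only [hξ]
    rw [integral_add (hP.sub hN) (hL1.const_mul κ), integral_const_mul, integral_sub hP hN,
      integral_sub ((isL1_const 1).sub hP) hN, integral_sub (isL1_const 1) hP, integral_const,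
      ← length_eq_integral hP, ← length_eq_integral hN, one_mul, hκm]
    ring

/-- Truncations of the positive part at height `1 / (k + 1)`, rescaled to height `1`, converge to
the indicator of `{u > 0}`. -/
theorem tendsto_clamp (y : ℝ) :
    Filter.Tendsto (fun k : ℕ => min (max (((k : ℝ) + 1) * y) 0) 1) Filter.atTop
      (nhds ((Ioi (0 : ℝ)).indicator (fun _ => 1) y)) := by
  by_cases hy : 0 < y
  · rw [indicator_of_mem (show y ∈ Ioi 0 from hy)]
    obtain ⟨N, hN⟩ := exists_nat_gt (1 / y)
    refine tendsto_const_nhds.congr' ?_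
    filter_upwards [Filter.eventually_ge_atTop N] with k hk
    have h1 : (N : ℝ) ≤ k := Nat.cast_le.2 hk
    have h2 : 1 ≤ ((k : ℝ) + 1) * y := by
      rw [div_lt_iff₀ hy] at hN
      nlinarith
    rw [max_eq_left (by linarith), min_eq_right h2]
  · rw [indicator_of_notMem (show y ∉ Ioi 0 from hy)]
    refine tendsto_const_nhds.congr fun k => ?_
    have h1 : ((k : ℝ) + 1) * y ≤ 0 :=
      mul_nonpos_of_nonneg_of_nonpos (by positivity) (not_lt.1 hy)
    rw [max_eq_right h1, min_eq_left zero_le_one]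

/-- The positivity set of a minimizer is a Cheeger cut. -/
theorem isCheegerCut_superlevel [Nonempty E] {u : E → ℝ → ℝ} (hu : u ∈ Γ.competitors)
    (hTV : Γ.TV u ≤ Γ.cheeger) (h0 : 0 < Γ.length (Γ.superlevel u 0)) :
    Γ.IsCheegerCut (Γ.superlevel u 0) := by
  obtain ⟨hBV, hn, hmed⟩ := hu
  have huL := hBV.isL1
  obtain ⟨ξ, hξb, hξ0, hξs⟩ := hmed.exists_sign huL
  have hDL := isL1_chi_superlevel (Γ := Γ) huL 0
  refine isCheegerCut_of_dualBound hDL h0 hmed.2 fun y dy hy => ?_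
  set D := Γ.superlevel u 0 with hD
  set v : ℕ → E → ℝ → ℝ := fun k e x => min (max (((k : ℝ) + 1) * u e x) 0) 1 with hv
  have hvb : ∀ k, Γ.BddBy (v k) 1 := fun k e => by
    refine ⟨?_, Filter.Eventually.of_forall fun x => ?_⟩
    · have hc : Continuous fun y : ℝ => min (max (((k : ℝ) + 1) * y) 0) 1 := by fun_prop
      exact hc.comp_aestronglyMeasurable (huL e).1
    · simp only [hv]
      rw [abs_of_nonneg (le_min (le_max_right _ _) zero_le_one)]
      exact min_le_right _ _
  have hchi : ∀ e, ∀ x ∈ Γ.edge e, chi D e x = (Ioi (0 : ℝ)).indicator (fun _ => 1) (u e x) :=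
    fun e x hx => by by_cases h : 0 < u e x <;> simp [chi, hD, superlevel, h, hx]
  have hlim : Filter.Tendsto (fun k => Γ.integral fun e x => |v k e x - chi D e x|)
      Filter.atTop (nhds 0) := by
    have h1 : ∀ e, Filter.Tendsto (fun k => ∫ x in Γ.edge e, |v k e x - chi D e x|)
        Filter.atTop (nhds (∫ _ in Γ.edge e, (0 : ℝ))) := fun e => by
      refine tendsto_integral_of_dominated_convergence (fun _ => 2)
        (fun k => (((hvb k).isL1.sub hDL).abs e).1) (integrable_const _)
        (fun k => ?_) ?_
      · filter_upwards [(hvb k e).2] with x hx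
        rw [Real.norm_eq_abs, abs_abs]
        have := abs_sub (v k e x) (chi D e x)
        linarith [abs_chi_le_one D e x]
      · filter_upwards [ae_mem_edge e] with x hx
        have h2 := ((tendsto_clamp (u e x)).sub_const (chi D e x)).abs
        rw [hchi e x hx, sub_self, abs_zero] at h2
        rw [hchi e x hx]
        exact h2
    have h3 := tendsto_finsetSum (Finset.univ : Finset E) fun e _ => h1 e
    simpa [integral] using h3
  have htest : ∀ f, Γ.IsL2 f → Filter.Tendsto (fun k => Γ.integral fun e x => v k e x * f e x)
      Filter.atTop (nhds (Γ.integral fun e x => chi D e x * f e x)) := fun f hf =>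
    tendsto_integral_mul (K := 1) hvb hDL.chi_bddBy hf hlim
  have hmass : Filter.Tendsto (fun k => Γ.cheeger * Γ.integral (v k)) Filter.atTop
      (nhds (Γ.cheeger * Γ.length D)) := by
    have := htest (fun _ _ => 1) (fun e => memLp_const 1)
    simp only [mul_one] at this
    rw [length_eq_integral hDL]
    exact this.const_mul _
  refine le_of_tendsto_of_tendsto' (htest dy hy.1.isL2_deriv) hmass fun k => ?_
  set ε : ℝ := 1 / ((k : ℝ) + 1) with hε
  have hk0 : (0 : ℝ) < (k : ℝ) + 1 := by positivity
  have hε0 : 0 < ε := by positivity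
  set f : ℝ → ℝ := fun x => min (max x 0) ε with hf
  have hfm : Monotone f := fun a b hab => min_le_min_right _ (max_le_max_right _ hab)
  have hf1 : ∀ a b, a ≤ b → f b - f a ≤ b - a := fun a b hab => by
    simp only [hf]
    rcases le_total a 0 with h1 | h1 <;> rcases le_total b 0 with h2 | h2 <;>
      simp only [max_eq_left, max_eq_right, h1, h2] <;>
      rcases le_total a ε with h3 | h3 <;> rcases le_total b ε with h4 | h4 <;>
      simp only [min_eq_left, min_eq_right, h3, h4, hε0.le] <;> linarith
  have hgm : Monotone fun x => x - f x := fun a b hab => by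
    have := hf1 a b hab; simp only; linarith
  have key := hBV.integral_comp_add_le hfm hgm (fun x => by ring) hy hξb hξ0
  have hfv : ∀ e x, f (u e x) = ε * v k e x := fun e x => by
    simp only [hf, hv]
    rw [mul_min_of_nonneg _ _ hε0.le, mul_max_of_nonneg _ _ hε0.le, mul_zero, mul_one, ← mul_assoc,
      hε, one_div, inv_mul_cancel₀ hk0.ne', one_mul]
  have hfL : Γ.IsL1 fun e x => f (u e x) := by
    simp only [hfv]; exact (hvb k).isL1.const_mul ε
  -- Where `f(u) ≠ 0` the function `u` is positive and `ξ = 1`, so the integrand is `|u| - f(u)`,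
  -- and `u` has norm one.
  have hgξ : Γ.integral (fun e x => (u e x - f (u e x)) * ξ e x) =
      1 - Γ.integral fun e x => f (u e x) := by
    rw [← hn, norm1, ← integral_sub huL.abs hfL]
    refine integral_congr fun e => ?_
    filter_upwards [ae_mem_edge e] with x hx
    have h1 := mul_eq_abs_of_mem_signSet (hξs e x hx)
    rw [sub_mul, h1]
    congr 1
    rcases le_or_gt (u e x) 0 with h2 | h2
    · have : f (u e x) = 0 := by
        simp only [hf]; rw [max_eq_right h2, min_eq_left hε0.le]
      rw [this, zero_mul]
    · have h3 := hξs e x hx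
      rw [signSet, if_pos h2] at h3
      rw [mem_singleton_iff.1 h3, mul_one]
  rw [hgξ] at key
  simp only [hfv, mul_assoc] at key
  rw [integral_const_mul, integral_const_mul] at key
  -- The bound `TV(u) ≤ h` cancels the contribution `h ‖u‖₁ = h`; what remains is homogeneous in
  -- `ε`.
  have h9 : ε * Γ.integral (fun e x => v k e x * dy e x) ≤
      ε * (Γ.cheeger * Γ.integral fun e x => v k e x) := by linarith
  exact le_of_mul_le_mul_left h9 hε0

theorem IsCheegerCut.mem_competitors {D : E → Set ℝ} (h : Γ.IsCheegerCut D) :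
    (fun e x => 1 / Γ.length D * chi D e x) ∈ Γ.competitors := by
  have hdb := h.dualBound
  have hn := h.norm1_eq
  obtain ⟨hD, h0, h1, -⟩ := h
  refine ⟨hdb.isBV (hD.isL1.const_mul _), hn, ?_, ?_⟩
  · have : Γ.sublevel (fun e x => 1 / Γ.length D * chi D e x) 0 = fun _ => ∅ := by
      funext e
      refine eq_empty_of_forall_notMem fun x hx => absurd hx.2 (not_lt.2 ?_)
      exact mul_nonneg (by positivity) (chi_nonneg _ _ _)
    rw [this]
    refine le_trans (le_of_eq ?_) (h0.le.trans h1)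
    simp [length]
  · refine le_trans (le_of_eq ?_) h1
    refine Finset.sum_congr rfl fun e _ => ?_
    congr 1
    ext x
    by_cases hx : x ∈ D e <;> simp [superlevel, chi, hx, h0]

/-- The normalized indicator of a Cheeger cut is a competitor of total variation at most `h`.
Minimality enters the theorem only through this bound. -/
theorem IsMinimizer.TV_le_cheeger [Nonempty E] {u : E → ℝ → ℝ} (h : Γ.IsMinimizer u) :
    Γ.TV u ≤ Γ.cheeger := by
  obtain ⟨D, hD⟩ := exists_isCheegerCut Γ
  exact (h.2 _ hD.mem_competitors).trans hD.dualBound.TV_le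

theorem neg_mem_competitors {u : E → ℝ → ℝ} (h : u ∈ Γ.competitors) : -u ∈ Γ.competitors := by
  obtain ⟨h1, h2, h3, h4⟩ := h
  refine ⟨h1.dualBound.neg.isBV fun e => (h1.isL1 e).neg, ?_, ?_, ?_⟩
  · rw [← h2]; simp [norm1]
  · rwa [sublevel_neg]
  · rwa [superlevel_neg]

end MetricGraph

end

/-! ### The theorem -/

theorem mainTheorem2 {V E : Type*} [Fintype V] [Fintype E] [Nonempty E] (Γ : MetricGraph V E) :
    Γ.cheeger = sInf {lam : ℝ | lam ≠ 0 ∧ Γ.IsEigenvalue lam} ∧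
    IsLeast {lam : ℝ | lam ≠ 0 ∧ Γ.IsEigenvalue lam} Γ.cheeger ∧
    ∀ u : E → ℝ → ℝ, Γ.IsMinimizer u →
      (0 < Γ.length (Γ.superlevel u 0) →
        ∃ t : ℝ, 0 ≤ t ∧ Γ.IsCheegerCut (Γ.superlevel u t) ∧
          Γ.IsEigenpair Γ.cheeger fun e x =>
            (1 / Γ.length (Γ.superlevel u t)) * MetricGraph.chi (Γ.superlevel u t) e x) ∧
      (0 < Γ.length (Γ.sublevel u 0) →
        ∃ t : ℝ, 0 ≤ t ∧ Γ.IsCheegerCut (Γ.superlevel (-u) t) ∧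
          Γ.IsEigenpair Γ.cheeger fun e x =>
            (1 / Γ.length (Γ.superlevel (-u) t)) * MetricGraph.chi (Γ.superlevel (-u) t) e x) := by
  have hleast : IsLeast {lam : ℝ | lam ≠ 0 ∧ Γ.IsEigenvalue lam} Γ.cheeger := by
    obtain ⟨D, hD⟩ := MetricGraph.exists_isCheegerCut Γ
    refine ⟨⟨(MetricGraph.cheeger_pos Γ).ne', _, hD.isEigenpair⟩, ?_⟩
    rintro lam ⟨hlam, u, hu⟩
    exact hu.cheeger_le hlam
  refine ⟨hleast.csInf_eq.symm, hleast, fun u hu => ⟨fun h0 => ?_, fun h0 => ?_⟩⟩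
  · have hcut := MetricGraph.isCheegerCut_superlevel hu.1 hu.TV_le_cheeger h0
    exact ⟨0, le_rfl, hcut, hcut.isEigenpair⟩
  · rw [← MetricGraph.superlevel_neg] at h0
    -- Only this bound is needed for `-u`, not its minimality; it follows from the symmetry of dual
    -- bounds under a change of sign.
    have hTV : Γ.TV (-u) ≤ Γ.cheeger :=
      (hu.1.1.dualBound.neg.TV_le).trans hu.TV_le_cheeger
    have hcut := MetricGraph.isCheegerCut_superlevel (MetricGraph.neg_mem_competitors hu.1) hTV h0
    exact ⟨0, le_rfl, hcut, hcut.isEigenpair⟩
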